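/- Let $(z,w_1,w_2)$, $w_j=u_j+\sqrt{-1}\,v_j$, be the coordinates of $\mathbb{C}^3$. A subset $M^4\subset\mathbb{C}^3$ is said to belong to the general Class II if it is a (locally closed) real-analytic submanifold of real dimension $4$, is CR-generic, i.e. $T_pM+J\,T_pM=T_p\mathbb{C}^3$ for every $p\in M$, and if, for every real-analytic local vector field $\mathcal{L}$ generating $T^{1,0}M$ over an open subset of $M$, the fields $$\mathcal{L},\quad \overline{\mathcal{L}},\quad [\mathcal{L},\overline{\mathcal{L}}],\quad [\mathcal{L},[\mathcal{L},\overline{\mathcal{L}}]]$$ constitute a frame for $\mathbb{C}\otimes_{\mathbb{R}}TM$ over that open subset. **Proposition.** (1) Let $M^4\subset\mathbb{C}^3$ belong to the general Class II, with $0\in M$. Then there is a biholomorphism $\Phi$, with $\Phi(0)=0$, from an open neighbourhood $\Omega$ of $0$ onto a polydisc $\Delta_\delta=\{|z|,|w_1|,|w_2|<\delta\}$, $\delta>0$, such that $\Phi(M\cap\Omega)$ is the set of points of $\Delta_\delta$ satisfying $$\begin{aligned} v_1&=z\bar z+z\bar z\,O_2(z,\bar z)+z\bar z\,O_1(u_1)+z\bar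 z\,O_1(u_2),\\ v_2&=z^2\bar z+z\bar z^2+z\bar z\,O_2(z,\bar z)+z\bar z\,O_1(u_1)+z\bar z\,O_1(u_2).\end{aligned}$$ Here, in each equation, $O_2(z,\bar z)$ is a real-valued real-analytic function of $z$, $|z|<\delta$, which is $O(|z|^2)$ at $0$, and $O_1(u_j)$ is $u_j$ times a real-valued real-analytic function of $(z,u_1,u_2)$, $|z|,|u_1|,|u_2|<\delta$. (2) The model obtained by taking all remainders equal to zero is Beloshapka's cubic $$v_1=z\bar z,\qquad v_2=z^2\bar z+z\bar z^2,$$ and it belongs itself to the general Class II. -/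

import Mathlib

open scoped TensorProduct

noncomputable section

namespace CRClassII

/-- The space `ℂ³`, with coordinates `(z, w₁, w₂)`. -/
abbrev C3 : Type := ℂ × ℂ × ℂ

/-- The complex structure of `ℂ³`, multiplication by `√-1`, as a real-linear map. -/
def J : C3 →ₗ[ℝ] C3 := DistribSMul.toLinearMap ℝ C3 Complex.I

/-- `M` is a (locally closed, embedded) real-analytic submanifold of `ℂ³` of real codimension `2`,
that is of real dimension `4`: near each of its points it is the zero set of a real-analytic map to
`ℝ²` whose differential is onto. -/
def IsAnalyticSubmanifold4 (M : Set C3) : Prop :=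
  ∀ p ∈ M, ∃ (U : Set C3) (ρ : C3 → ℝ × ℝ), IsOpen U ∧ p ∈ U ∧ AnalyticOnNhd ℝ ρ U ∧
    M ∩ U = {x ∈ U | ρ x = 0} ∧ ∀ x ∈ M ∩ U, Function.Surjective (fderiv ℝ ρ x)

/-- The real tangent space `T_p M`. (For a submanifold the tangent cone already is a subspace, and
the span changes nothing.) -/
def tangentSpace (M : Set C3) (p : C3) : Submodule ℝ C3 :=
  Submodule.span ℝ (tangentConeAt ℝ M p)

/-- `M` is CR-generic: `T_p M + J T_p M = T_p ℂ³` at each point `p` of `M`. -/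
def IsCRGeneric (M : Set C3) : Prop :=
  ∀ p ∈ M, tangentSpace M p ⊔ (tangentSpace M p).map J = ⊤

/-- The complexified tangent space `ℂ ⊗ T_p M`, inside `ℂ ⊗ T_p ℂ³ = ℂ ⊗ ℂ³`. -/
def complexTangentSpace (M : Set C3) (p : C3) : Submodule ℂ (ℂ ⊗[ℝ] C3) :=
  (tangentSpace M p).baseChange ℂ

/-- `T^{1,0}_p M`: the vectors of `ℂ ⊗ T_p M` on which the complexification of `J` acts as
multiplication by `√-1`. -/
def T10 (M : Set C3) (p : C3) : Submodule ℂ (ℂ ⊗[ℝ] C3) :=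
  complexTangentSpace M p ⊓ Module.End.eigenspace (J.baseChange ℂ) Complex.I

/-- A complex vector field `re + √-1 im` on `ℂ³`, a section of `ℂ ⊗ Tℂ³`; `re` and `im` are real
vector fields. -/
structure ComplexField where
  re : C3 → C3
  im : C3 → C3

namespace ComplexField

/-- The value of a complex vector field at a point. -/
def value (X : ComplexField) (p : C3) : ℂ ⊗[ℝ] C3 :=
  (1 : ℂ) ⊗ₜ[ℝ] X.re p + Complex.I ⊗ₜ[ℝ] X.im p

/-- The conjugate vector field. -/
def conj (X : ComplexField) : ComplexField where
  re := X.re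
  im := fun p => -X.im p

/-- The complex-bilinear extension of the Lie bracket of real vector fields. -/
def bracket (X Y : ComplexField) : ComplexField where
  re := fun p => VectorField.lieBracket ℝ X.re Y.re p - VectorField.lieBracket ℝ X.im Y.im p
  im := fun p => VectorField.lieBracket ℝ X.re Y.im p + VectorField.lieBracket ℝ X.im Y.re p

end ComplexField

/-- `L` is a real-analytic local generator of `T^{1,0}M` over the open subset `M ∩ U` of `M`.
A local section over `M` is represented by an extension to an open set `U` of `ℂ³`. Extensions
exist locally, and at points of `M` iterated brackets of fields which are tangent to `M` along `M`
do not depend on them. -/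
def IsLocalGenerator (M U : Set C3) (L : ComplexField) : Prop :=
  AnalyticOnNhd ℝ L.re U ∧ AnalyticOnNhd ℝ L.im U ∧
    ∀ p ∈ M ∩ U, Submodule.span ℂ {L.value p} = T10 M p

/-- At `p`, the fields `L`, `L̄`, `[L, L̄]`, `[L, [L, L̄]]` are a basis of `ℂ ⊗ T_p M`. -/
def IsFrameAt (M : Set C3) (L : ComplexField) (p : C3) : Prop :=
  let v : Fin 4 → ℂ ⊗[ℝ] C3 :=
    ![L.value p, L.conj.value p, (L.bracket L.conj).value p,
      (L.bracket (L.bracket L.conj)).value p]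
  LinearIndependent ℂ v ∧ Submodule.span ℂ (Set.range v) = complexTangentSpace M p

/-- `M ⊂ ℂ³` is a real-analytic CR-generic submanifold of dimension `4` belonging to the general
class II. -/
def IsGeneralClassII (M : Set C3) : Prop :=
  IsAnalyticSubmanifold4 M ∧ IsCRGeneric M ∧
    ∀ (U : Set C3) (L : ComplexField), IsOpen U → IsLocalGenerator M U L →
      ∀ p ∈ M ∩ U, IsFrameAt M L p

/-- The data of a remainder `O₂(z, z̄) + O₁(u₁) + O₁(u₂)`, where `O₁(uⱼ)` means `uⱼ` times a function
of `(z, z̄, u₁, u₂)`. -/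
structure Remainder where
  a : ℂ → ℝ
  b₁ : ℂ × ℝ × ℝ → ℝ
  b₂ : ℂ × ℝ × ℝ → ℝ

namespace Remainder

/-- The remainder as a function of `z`, `u₁`, `u₂`. -/
def eval (r : Remainder) (z : ℂ) (u₁ u₂ : ℝ) : ℝ :=
  r.a z + u₁ * r.b₁ (z, u₁, u₂) + u₂ * r.b₂ (z, u₁, u₂)

/-- The functions are real-analytic for `|z|, |u₁|, |u₂| < δ`, and the first one vanishes to
order at least `2` at the origin. -/
def IsAdmissible (r : Remainder) (δ : ℝ) : Prop :=
  AnalyticOnNhd ℝ r.a (Metric.ball 0 δ) ∧ AnalyticOnNhd ℝ r.b₁ (Metric.ball 0 δ) ∧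
    AnalyticOnNhd ℝ r.b₂ (Metric.ball 0 δ) ∧
    r.a =O[nhds 0] (fun z : ℂ => ‖z‖ ^ 2)

/-- The zero remainder. -/
def zero : Remainder where
  a := fun _ => 0
  b₁ := fun _ => 0
  b₂ := fun _ => 0

end Remainder

open ComplexConjugate in
/-- The set of points `(z, u₁ + √-1 v₁, u₂ + √-1 v₂)` of `ℂ³` such that
`v₁ = z z̄ + z z̄ r₁(z, z̄, u₁, u₂)` and `v₂ = z² z̄ + z z̄² + z z̄ r₂(z, z̄, u₁, u₂)`. -/
def normalForm (r₁ r₂ : Remainder) : Set C3 :=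
  {q | ((q.2.1.im : ℝ) : ℂ) = q.1 * conj q.1 +
        q.1 * conj q.1 * (r₁.eval q.1 q.2.1.re q.2.2.re : ℝ) ∧
      ((q.2.2.im : ℝ) : ℂ) = q.1 ^ 2 * conj q.1 + q.1 * conj q.1 ^ 2 +
        q.1 * conj q.1 * (r₂.eval q.1 q.2.1.re q.2.2.re : ℝ)}

open ComplexConjugate in
/-- Beloshapka's cubic: `v₁ = z z̄`, `v₂ = z² z̄ + z z̄²`. -/
def beloshapkaCubic : Set C3 :=
  {q | ((q.2.1.im : ℝ) : ℂ) = q.1 * conj q.1 ∧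
      ((q.2.2.im : ℝ) : ℂ) = q.1 ^ 2 * conj q.1 + q.1 * conj q.1 ^ 2}

end CRClassII

end

/-! Part (1) rests on normal coordinates for a real-analytic generic submanifold. Genericity gives
complex-linear coordinates in which `M` has a defining function `ρ` with differential `(Im w₁, Im
w₂)` at `0`. Its complexification `R(x, y)` is holomorphic, with `R(x, x̄) = ρ(x)` and a symmetry
under `(x, y) ↦ (ȳ, x̄)`. The slice `z = 0` of `M` is an edge `w = s + √-1 γ(s)`, and `w = G(z, s)`
is the Segre variety of the edge point with parameter `s`. In the coordinates `(z, s)` the equation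
of `M` becomes `v = Φ(z, z̄, u)` with `Φ(z, 0, u) = Φ(0, ζ, u) = 0`, so that every remainder term is
divisible by `z z̄` at once: `v = z z̄ ψ(z, u)`. The lemmas are `exists_normal_coordinates`,
`exists_factorization` and `exists_graph_chart`.

The frame condition is then read at `0`. In such a chart `T^{1,0}M` is generated by a field `L` with
components `(1, z̄ C)`. Modulo `L` and `L̄`, the value of `[L, L̄]` at `0` is governed by `ψ(0)`,
and that of `[L, [L, L̄]]` by `H = 2 ∂ψ/∂z(0)`. A covector annihilating both `ψ(0)` and `H` would
yield a function whose differential kills the whole frame but not the tangent space, so `ψ(0)` and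
`H` are linearly independent (`det_ne_zero_of_isFrameAt`).

This independence allows a substitution `z ↦ l z (1 + ν z)`, together with a real linear change of
`w`, that brings `ψ` to `(1, 2 Re z)` up to terms `O₂(z, z̄)`, `O₁(u₁)` and `O₁(u₂)`. Since `z z̄ (2
Re z) = z² z̄ + z z̄²`, this is the normal form; the remainders come from division by `u₁` and `u₂`
(`exists_normalized_chart`, `exists_remainders`).

For part (2), an arbitrary generator and its brackets are applied to the antiholomorphic
coordinates; the resulting linear system is triangular, whatever the coefficient of the generator
is. -/

noncomputable section

open Filter Topology ContDiff

/-! ### Analytic germs: complexification, division, implicit functions -/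

section AnalyticTools

/-- A formal multilinear series with geometrically bounded coefficients has positive radius of
convergence. -/
theorem FormalMultilinearSeries.radius_pos_of_norm_le_geometric {𝕜 E F : Type*}
    [NontriviallyNormedField 𝕜] [NormedAddCommGroup E] [NormedSpace 𝕜 E] [NormedAddCommGroup F]
    [NormedSpace 𝕜 F] (p : FormalMultilinearSeries 𝕜 E F) {C a : ℝ} (ha : 0 < a)
    (h : ∀ n, ‖p n‖ ≤ C * a ^ n) : 0 < p.radius := by
  let r : NNReal := ⟨a⁻¹, by positivity⟩
  have hle : (r : ENNReal) ≤ p.radius := by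
    refine p.le_radius_of_bound C fun n => ?_
    calc ‖p n‖ * (r : ℝ) ^ n = ‖p n‖ * (a⁻¹) ^ n := rfl
      _ ≤ (C * a ^ n) * (a⁻¹) ^ n := by
          gcongr
          exact h n
      _ = C := by
          rw [mul_assoc, ← mul_pow, mul_inv_cancel₀ ha.ne', one_pow, mul_one]
  refine lt_of_lt_of_le ?_ hle
  rw [ENNReal.coe_pos, ← NNReal.coe_pos]
  exact inv_pos.2 ha

/-- Complexification of a real-analytic function: if the complex-linear forms `m i` on `V` extend
the coordinates of `E` along `c : E → V`, then a real-analytic germ on `E` extends along `c` to a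
holomorphic germ on `V`, which is compatible with every antilinear involution that is compatible
with the forms `m i`. -/
theorem AnalyticAt.exists_complexification {E V ι : Type*} [Fintype ι]
    [NormedAddCommGroup E] [NormedSpace ℝ E] [NormedAddCommGroup V] [NormedSpace ℂ V]
    (b : Module.Basis ι ℝ E) (c : E → V) (hc : ContinuousAt c 0) (hc0 : c 0 = 0)
    (m : ι → V →L[ℂ] ℂ) (hm : ∀ x i, m i (c x) = b.repr x i) {f : E → ℝ} (hf : AnalyticAt ℝ f 0) :
    ∃ R : V → ℂ, AnalyticAt ℂ R 0 ∧ (∀ᶠ x in 𝓝 0, R (c x) = f x) ∧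
      ∀ σ : V → V, (∀ v i, m i (σ v) = star (m i v)) → ∀ v, R (σ v) = star (R v) := by
  obtain ⟨p, r, hp⟩ := hf
  obtain ⟨C, a, hC, ha, hpa⟩ := p.le_mul_pow_of_radius_pos (lt_of_lt_of_le hp.r_pos hp.r_le)
  -- The `n`-th Taylor term is a polynomial in the coordinates `b.repr x i`. Replacing these by the
  -- forms `m i` keeps its coefficients, and since they are real the sum commutes with conjugation.
  let P : FormalMultilinearSeries ℂ V ℂ := fun n =>
    ∑ s : Fin n → ι, ((p n fun i => b (s i) : ℝ) : ℂ) •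
      (ContinuousMultilinearMap.mkPiAlgebra ℂ (Fin n) ℂ).compContinuousLinearMap fun i => m (s i)
  have hPapp : ∀ n (v : V), (P n fun _ => v) =
      ∑ s : Fin n → ι, ((p n fun i => b (s i) : ℝ) : ℂ) * ∏ i, m (s i) v := by
    intro n v
    simp [P]
  -- The sum over all `s : Fin n → ι` of products is the `n`-th power of one sum. The summand `1`
  -- only ensures that the ratio is positive.
  have hPnorm : ∀ n, ‖P n‖ ≤ C * (a * (1 + ∑ i, ‖b i‖ * ‖m i‖)) ^ n := by
    intro n
    calc ‖P n‖ ≤ ∑ s : Fin n → ι, ‖p n‖ * ∏ i, (‖b (s i)‖ * ‖m (s i)‖) := by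
          refine norm_sum_le_of_le _ fun s _ => ?_
          rw [norm_smul, Finset.prod_mul_distrib, ← mul_assoc]
          gcongr
          · simpa using (p n).le_opNorm fun i => b (s i)
          · refine (ContinuousMultilinearMap.norm_compContinuousLinearMap_le _ _).trans ?_
            simp
      _ = ‖p n‖ * (∑ i, ‖b i‖ * ‖m i‖) ^ n := by
          rw [← Finset.mul_sum]
          congr 1
          have := Finset.prod_univ_sum (fun _ : Fin n => (Finset.univ : Finset ι))
            (fun _ j => ‖b j‖ * ‖m j‖)
          simpa using this.symm
      _ ≤ (C * a ^ n) * (1 + ∑ i, ‖b i‖ * ‖m i‖) ^ n := by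
          have h0 : 0 ≤ ∑ i, ‖b i‖ * ‖m i‖ := Finset.sum_nonneg fun i _ => by positivity
          gcongr
          · exact hpa n
          · linarith
      _ = _ := by rw [mul_assoc, ← mul_pow]
  have h0 : 0 ≤ ∑ i, ‖b i‖ * ‖m i‖ := Finset.sum_nonneg fun i _ => by positivity
  have hrad : 0 < P.radius :=
    P.radius_pos_of_norm_le_geometric (by positivity) hPnorm
  have hPs := P.hasFPowerSeriesOnBall hrad
  refine ⟨P.sum, ⟨P, _, hPs⟩, ?_, ?_⟩
  · have h1 : ∀ᶠ x in 𝓝 (0 : E), x ∈ Metric.eball (0 : E) r := Metric.eball_mem_nhds _ hp.r_pos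
    have h2 : ∀ᶠ x in 𝓝 (0 : E), c x ∈ Metric.eball (0 : V) P.radius :=
      hc.eventually_mem (by rw [hc0]; exact Metric.eball_mem_nhds _ hrad)
    filter_upwards [h1, h2] with x hx1 hx2
    have hs1 := hp.hasSum hx1
    have hs2 := hPs.hasSum hx2
    rw [zero_add] at hs1 hs2
    refine hs2.unique ?_
    have hs1' := Complex.hasSum_ofReal.2 hs1
    refine hs1'.congr_fun ?_
    intro n
    rw [hPapp]
    have hx : (fun _ : Fin n => x) = fun _ => ∑ j, b.repr x j • b j := by
      funext _; exact (b.sum_repr x).symm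
    rw [hx, ContinuousMultilinearMap.map_sum]
    push_cast
    refine Finset.sum_congr rfl fun s _ => ?_
    rw [ContinuousMultilinearMap.map_smul_univ]
    simp only [hm, smul_eq_mul]
    push_cast
    ring
  · intro σ hσ v
    have key : ∀ n, (P n fun _ => σ v) = star (P n fun _ => v) := by
      intro n
      simp [hPapp, hσ]
    simp only [FormalMultilinearSeries.sum, key, tsum_star]

/-- Division of an analytic germ by a linear form. -/
theorem AnalyticAt.exists_sub_eq_smul {𝕜 E F : Type*}
    [NontriviallyNormedField 𝕜] [NormedAddCommGroup E] [NormedSpace 𝕜 E] [NormedAddCommGroup F]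
    [NormedSpace 𝕜 F] [CompleteSpace F] {f : E → F} (hf : AnalyticAt 𝕜 f 0) (l : E →L[𝕜] 𝕜)
    (v : E) :
    ∃ g : E → F, AnalyticAt 𝕜 g 0 ∧ ∀ᶠ x in 𝓝 0, f x - f (x - l x • v) = l x • g x := by
  obtain ⟨p, r, hp⟩ := hf
  obtain ⟨C, a, hC, ha, hpa⟩ := p.le_mul_pow_of_radius_pos (lt_of_lt_of_le hp.r_pos hp.r_le)
  let π : E →L[𝕜] E := ContinuousLinearMap.id 𝕜 E - l.smulRight v
  have hπ : ∀ x, π x = x - l x • v := fun x => by simp [π]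
  -- Telescoping: the arguments `x` are exchanged for `π x` one slot at a time. The exchange in slot
  -- `k` costs `x - π x = l x • v`, from which the factor `l x` is pulled out. Slot `k` must receive
  -- `v` and not `π v`, hence `i ≤ k`.
  let q : FormalMultilinearSeries 𝕜 E F := fun n =>
    ∑ k : Fin (n + 1), ((p (n + 1)).compContinuousLinearMap fun i =>
      if i ≤ k then ContinuousLinearMap.id 𝕜 E else π).curryMid k v
  let A : ℝ := 1 + ‖π‖
  have hA : 1 ≤ A := by simp [A]
  have hqnorm : ∀ n, ‖q n‖ ≤ (C * a * A * ‖v‖) * (2 * (a * A)) ^ n := by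
    intro n
    calc ‖q n‖ ≤ ∑ k : Fin (n + 1), (C * a ^ (n + 1)) * A ^ (n + 1) * ‖v‖ := by
          refine norm_sum_le_of_le _ fun k _ => ?_
          refine (ContinuousLinearMap.le_opNorm _ _).trans ?_
          gcongr
          refine (MultilinearMap.mkContinuousLinear_norm_le _ (norm_nonneg _) _).trans ?_
          refine (ContinuousMultilinearMap.norm_compContinuousLinearMap_le _ _).trans ?_
          gcongr
          · exact hpa _
          · calc _ ≤ ∏ _i : Fin (n + 1), A := by
                  refine Finset.prod_le_prod (fun i _ => norm_nonneg _) fun i _ => ?_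
                  split_ifs
                  · exact (ContinuousLinearMap.norm_id_le (𝕜 := 𝕜) (E := E)).trans hA
                  · simp [A]
              _ = A ^ (n + 1) := by simp
      _ = (n + 1 : ℕ) * ((C * a ^ (n + 1)) * A ^ (n + 1) * ‖v‖) := by simp
      _ ≤ 2 ^ n * ((C * a ^ (n + 1)) * A ^ (n + 1) * ‖v‖) := by
          gcongr
          exact_mod_cast Nat.lt_two_pow_self
      _ = _ := by rw [mul_pow, mul_pow]; ring
  have hqapp : ∀ n x, l x • (q n fun _ => x) =
      (p (n + 1) fun _ => x) - (p (n + 1) fun _ => π x) := by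
    intro n x
    let S : ℕ → F := fun k => p (n + 1) fun i => if (i : ℕ) < k then x else π x
    have hterm : ∀ k : Fin (n + 1), l x • (((p (n + 1)).compContinuousLinearMap fun i =>
        if i ≤ k then ContinuousLinearMap.id 𝕜 E else π).curryMid k v fun _ => x)
        = S (k + 1) - S k := by
      intro k
      rw [ContinuousMultilinearMap.curryMid_apply]
      simp only [ContinuousMultilinearMap.compContinuousLinearMap_apply]
      have e1 : (fun i => (if i ≤ k then ContinuousLinearMap.id 𝕜 E else π)
          (k.insertNth (α := fun _ => E) v (fun _ => x) i)) =
          Function.update (fun i : Fin (n + 1) => if (i : ℕ) < k then x else π x) k v := by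
        funext i
        rcases eq_or_ne i k with rfl | hik
        · simp
        · obtain ⟨j, rfl⟩ := Fin.exists_succAbove_eq hik
          rw [Fin.insertNth_apply_succAbove, Function.update_of_ne hik]
          by_cases h : (k.succAbove j : ℕ) < k
          · have h' : k.succAbove j ≤ k := le_of_lt h
            simp [h, h']
          · have h' : ¬ k.succAbove j ≤ k := fun hle => h (lt_of_le_of_ne hle fun e => hik (Fin.ext e))
            simp [h, h']
      have e2 : (fun i : Fin (n + 1) => if (i : ℕ) < k + 1 then x else π x) =
          Function.update (fun i : Fin (n + 1) => if (i : ℕ) < k then x else π x) k x := by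
        funext i
        rcases eq_or_ne i k with rfl | hik
        · simp
        · rw [Function.update_of_ne hik]
          have : (i : ℕ) ≠ k := fun h => hik (Fin.ext h)
          congr 1
          simp only [eq_iff_iff]
          omega
      have e3 : (fun i : Fin (n + 1) => if (i : ℕ) < k then x else π x) =
          Function.update (fun i : Fin (n + 1) => if (i : ℕ) < k then x else π x) k (π x) := by
        funext i
        rcases eq_or_ne i k with rfl | hik
        · simp
        · rw [Function.update_of_ne hik]
      simp only [S]
      rw [e1, e2, ← (p (n + 1)).map_update_smul]
      conv_rhs => rw [e3]
      simp only [Function.update_idem]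
      rw [← (p (n + 1)).map_update_sub, hπ, sub_sub_cancel]
    simp only [q, sum_apply, Finset.smul_sum]
    rw [Finset.sum_congr rfl fun k _ => hterm k,
      Fin.sum_univ_eq_sum_range (fun k => S (k + 1) - S k) (n + 1), Finset.sum_range_sub]
    simp only [S]
    congr 2
    funext i
    simp [i.2]
  have hrad : 0 < q.radius := q.radius_pos_of_norm_le_geometric (by positivity) hqnorm
  have hqs := q.hasFPowerSeriesOnBall hrad
  refine ⟨q.sum, ⟨q, _, hqs⟩, ?_⟩
  have h1 : ∀ᶠ x in 𝓝 (0 : E), x ∈ Metric.eball (0 : E) r := Metric.eball_mem_nhds _ hp.r_pos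
  have h2 : ∀ᶠ x in 𝓝 (0 : E), π x ∈ Metric.eball (0 : E) r :=
    π.continuous.continuousAt.eventually_mem
      (by rw [map_zero]; exact Metric.eball_mem_nhds _ hp.r_pos)
  have h3 : ∀ᶠ x in 𝓝 (0 : E), x ∈ Metric.eball (0 : E) q.radius := Metric.eball_mem_nhds _ hrad
  filter_upwards [h1, h2, h3] with x hx1 hx2 hx3
  have hs := (hp.hasSum hx1).sub (hp.hasSum hx2)
  have hs3 := (hqs.hasSum hx3).const_smul (l x)
  simp only [zero_add] at hs hs3
  rw [← hπ]
  refine HasSum.unique ?_ hs3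
  simp only [hqapp]
  have := (hasSum_nat_add_iff' 1).2 hs
  have e0 : (p 0 fun _ => x) = p 0 fun _ => π x := congrArg _ (Subsingleton.elim _ _)
  simpa [e0] using this

/-- An analytic germ vanishing to first order is `O(‖x‖²)`. -/
theorem AnalyticAt.isBigO_norm_sq {𝕜 E F : Type*}
    [NontriviallyNormedField 𝕜] [NormedAddCommGroup E] [NormedSpace 𝕜 E] [NormedAddCommGroup F]
    [NormedSpace 𝕜 F] {f : E → F} (hf : AnalyticAt 𝕜 f 0) (h0 : f 0 = 0)
    (h1 : HasFDerivAt f (0 : E →L[𝕜] F) 0) : f =O[𝓝 0] fun x => ‖x‖ ^ 2 := by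
  obtain ⟨p, hp⟩ := hf
  have hO := hp.isBigO_sub_partialSum_pow 2
  have e0 : ∀ y : E, (p 0 fun _ => y) = 0 := fun y => (hp.coeff_zero _).trans h0
  have e1 : ∀ y : E, (p 1 fun _ => y) = 0 := by
    intro y
    have := hp.hasFDerivAt.unique h1
    have h2 := DFunLike.congr_fun this y
    simp only [continuousMultilinearCurryFin1_apply, zero_apply] at h2
    rw [← h2]
    congr 1
  simpa [FormalMultilinearSeries.partialSum, Finset.sum_range_succ, e0, e1] using hO

/-- Analytic implicit function theorem at the origin. -/
theorem AnalyticAt.exists_implicitFunction {𝕜 X Y Z : Type*} [RCLike 𝕜]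
    [NormedAddCommGroup X] [NormedSpace 𝕜 X] [CompleteSpace X]
    [NormedAddCommGroup Y] [NormedSpace 𝕜 Y] [CompleteSpace Y]
    [NormedAddCommGroup Z] [NormedSpace 𝕜 Z] [CompleteSpace Z]
    {H : X × Y → Z} (hH : AnalyticAt 𝕜 H 0) (h0 : H 0 = 0) {H' : X × Y →L[𝕜] Z}
    (hH' : HasFDerivAt H H' 0) (e : Y ≃L[𝕜] Z) (he : ∀ y, H' (0, y) = e y) :
    ∃ g : X → Y, AnalyticAt 𝕜 g 0 ∧ g 0 = 0 ∧ (∀ᶠ p in 𝓝 0, H p = 0 ↔ p.2 = g p.1) ∧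
      ∃ g' : X →L[𝕜] Y, HasFDerivAt g g' 0 ∧ ∀ x, H' (x, g' x) = 0 := by
  have cd : ContDiffAt 𝕜 ω H (0 : X × Y) := hH.contDiffAt
  have hinv : (fderiv 𝕜 H (0 : X × Y) ∘L .inr 𝕜 X Y).IsInvertible := by
    rw [hH'.fderiv]
    exact ⟨e, by ext y; simp [he]⟩
  have hne : (ω : WithTop ℕ∞) ≠ 0 := by simp
  set g := cd.implicitFunction hne hinv
  have hg0 : g 0 = 0 := cd.implicitFunction_apply_self hne hinv
  have hga : AnalyticAt 𝕜 g 0 := (cd.contDiffAt_implicitFunction hne hinv).analyticAt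
  refine ⟨g, hga, hg0, ?_, fderiv 𝕜 g 0, hga.differentiableAt.hasFDerivAt, fun x => ?_⟩
  · filter_upwards [cd.eventually_apply_eq_iff_implicitFunction hne hinv] with p hp
    rw [h0] at hp
    rw [hp, eq_comm]
  · have h1 := cd.eventually_apply_implicitFunction hne hinv
    have hH'' : HasFDerivAt H H' ((fun x => (x, g x)) (0 : X)) := by
      simp only [hg0]
      exact hH'
    have h2 : HasFDerivAt (fun x => H (x, g x)) _ (0 : X) :=
      hH''.comp (0 : X) ((hasFDerivAt_id (𝕜 := 𝕜) (0 : X)).prodMk hga.differentiableAt.hasFDerivAt)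
    have h3 : HasFDerivAt (fun x => H (x, g x)) (0 : X →L[𝕜] Z) 0 := by
      refine (hasFDerivAt_const (0 : Z) (0 : X)).congr_of_eventuallyEq ?_
      filter_upwards [h1] with x hx
      rw [hx, h0]
    simpa using DFunLike.congr_fun (h2.unique h3) x

theorem AnalyticAt.clm_apply {𝕜 D E F : Type*}
    [NontriviallyNormedField 𝕜] [NormedAddCommGroup D] [NormedSpace 𝕜 D] [NormedAddCommGroup E]
    [NormedSpace 𝕜 E] [NormedAddCommGroup F] [NormedSpace 𝕜 F] {c : D → E →L[𝕜] F} {u : D → E}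
    {x : D} (hc : AnalyticAt 𝕜 c x) (hu : AnalyticAt 𝕜 u x) :
    AnalyticAt 𝕜 (fun y => c y (u y)) x :=
  ((ContinuousLinearMap.id 𝕜 (E →L[𝕜] F)).analyticAt_bilinear (c x, u x)).comp₂ hc hu

end AnalyticTools

namespace CRClassII

/-! ### Real and imaginary parts in the complexified tangent space -/

section Tensor

/-- The real part on `ℂ ⊗ ℂ³`. -/
def tensorRe : ℂ ⊗[ℝ] C3 →ₗ[ℝ] C3 :=
  TensorProduct.lift ((LinearMap.lsmul ℝ C3).comp Complex.reLm)

/-- The imaginary part on `ℂ ⊗ ℂ³`. -/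
def tensorIm : ℂ ⊗[ℝ] C3 →ₗ[ℝ] C3 :=
  TensorProduct.lift ((LinearMap.lsmul ℝ C3).comp Complex.imLm)

@[simp] theorem tensorRe_tmul (c : ℂ) (x : C3) : tensorRe (c ⊗ₜ x) = c.re • x := rfl

@[simp] theorem tensorIm_tmul (c : ℂ) (x : C3) : tensorIm (c ⊗ₜ x) = c.im • x := rfl

theorem tensor_eq_re_add_im (v : ℂ ⊗[ℝ] C3) :
    v = (1 : ℂ) ⊗ₜ[ℝ] tensorRe v + Complex.I ⊗ₜ[ℝ] tensorIm v := by
  induction v with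
  | zero => simp
  | tmul c x =>
    rw [tensorRe_tmul, tensorIm_tmul, TensorProduct.tmul_smul, TensorProduct.tmul_smul,
      TensorProduct.smul_tmul', TensorProduct.smul_tmul', ← TensorProduct.add_tmul]
    congr 1
    apply Complex.ext <;> simp
  | add v w hv hw =>
    rw [map_add, map_add, TensorProduct.tmul_add, TensorProduct.tmul_add]
    nth_rewrite 1 [hv, hw]
    abel

theorem tensor_ext {v w : ℂ ⊗[ℝ] C3} (h₁ : tensorRe v = tensorRe w)
    (h₂ : tensorIm v = tensorIm w) : v = w := by
  rw [tensor_eq_re_add_im v, tensor_eq_re_add_im w, h₁, h₂]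

theorem tensorRe_smul (c : ℂ) (v : ℂ ⊗[ℝ] C3) :
    tensorRe (c • v) = c.re • tensorRe v - c.im • tensorIm v := by
  induction v with
  | zero => simp
  | tmul d x =>
    rw [TensorProduct.smul_tmul']
    simp [sub_smul, mul_smul]
  | add v w hv hw => simp only [smul_add, map_add, hv, hw]; abel

theorem tensorIm_smul (c : ℂ) (v : ℂ ⊗[ℝ] C3) :
    tensorIm (c • v) = c.re • tensorIm v + c.im • tensorRe v := by
  induction v with
  | zero => simp
  | tmul d x =>
    rw [TensorProduct.smul_tmul']
    simp [add_smul, mul_smul]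
  | add v w hv hw => simp only [smul_add, map_add, hv, hw]; abel

theorem mem_baseChange_iff {S : Submodule ℝ C3} {v : ℂ ⊗[ℝ] C3} :
    v ∈ S.baseChange ℂ ↔ tensorRe v ∈ S ∧ tensorIm v ∈ S := by
  constructor
  · rintro ⟨u, rfl⟩
    induction u with
    | zero => simp
    | tmul c x =>
      simp only [LinearMap.baseChange_tmul, Submodule.subtype_apply, tensorRe_tmul, tensorIm_tmul]
      exact ⟨S.smul_mem _ x.2, S.smul_mem _ x.2⟩
    | add a b ha hb =>
      simp only [map_add]
      exact ⟨S.add_mem ha.1 hb.1, S.add_mem ha.2 hb.2⟩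
  · rintro ⟨h₁, h₂⟩
    rw [tensor_eq_re_add_im v]
    exact Submodule.add_mem _ (Submodule.tmul_mem_baseChange_of_mem _ h₁)
      (Submodule.tmul_mem_baseChange_of_mem _ h₂)

@[simp] theorem J_apply (x : C3) : J x = Complex.I • x := rfl

/-- Comparing real parts in `J v = √-1 v` gives the last condition, and the comparison of imaginary
parts then adds nothing. A vector of type `(1,0)` is thus determined by its real part, which lets
later arguments work with real vectors of `ℂ³`. -/
theorem mem_T10_iff {M : Set C3} {p : C3} {v : ℂ ⊗[ℝ] C3} :
    v ∈ T10 M p ↔ tensorRe v ∈ tangentSpace M p ∧ tensorIm v ∈ tangentSpace M p ∧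
      tensorIm v = -(Complex.I • tensorRe v) := by
  rw [T10, Submodule.mem_inf, complexTangentSpace, mem_baseChange_iff, and_assoc,
    Module.End.mem_eigenspace_iff]
  refine and_congr_right fun _ => and_congr_right fun _ => ?_
  have hre : tensorRe (J.baseChange ℂ v) = Complex.I • tensorRe v := by
    clear * -
    induction v with
    | zero => simp
    | tmul c x =>
      rw [LinearMap.baseChange_tmul, tensorRe_tmul, tensorRe_tmul, J_apply, smul_comm]
    | add a b ha hb => rw [map_add, map_add, map_add, ha, hb, smul_add]
  have him : tensorIm (J.baseChange ℂ v) = Complex.I • tensorIm v := by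
    clear * -
    induction v with
    | zero => simp
    | tmul c x =>
      rw [LinearMap.baseChange_tmul, tensorIm_tmul, tensorIm_tmul, J_apply, smul_comm]
    | add a b ha hb => rw [map_add, map_add, map_add, ha, hb, smul_add]
  constructor
  · intro h
    have := congrArg tensorRe h
    rw [hre, tensorRe_smul] at this
    simp only [Complex.I_re, zero_smul, Complex.I_im, one_smul, zero_sub] at this
    rw [this, neg_neg]
  · intro h
    apply tensor_ext
    · rw [hre, tensorRe_smul, h]; simp
    · rw [him, tensorIm_smul, h]; simp [smul_smul]

end Tensor

/-! ### Complex vector fields as derivations -/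

namespace ComplexField

@[simp] theorem tensorRe_value (X : ComplexField) (p : C3) : tensorRe (X.value p) = X.re p := by
  simp [value]

@[simp] theorem tensorIm_value (X : ComplexField) (p : C3) : tensorIm (X.value p) = X.im p := by
  simp [value]

theorem liftBaseChange_value (l : C3 →ₗ[ℝ] ℂ) (X : ComplexField) (p : C3) :
    l.liftBaseChange ℂ (X.value p) = l (X.re p) + Complex.I * l (X.im p) := by
  simp [value]

/-- Real-analyticity of a complex vector field at a point. -/
def IsAnalyticAt (X : ComplexField) (p : C3) : Prop :=
  AnalyticAt ℝ X.re p ∧ AnalyticAt ℝ X.im p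

/-- The derivative of a complex-valued function along a complex vector field. -/
def deriv (X : ComplexField) (f : C3 → ℂ) (p : C3) : ℂ :=
  fderiv ℝ f p (X.re p) + Complex.I * fderiv ℝ f p (X.im p)

/-- Tangency of a complex vector field to `M` at a point. -/
def IsTangentAt (X : ComplexField) (M : Set C3) (p : C3) : Prop :=
  X.re p ∈ tangentSpace M p ∧ X.im p ∈ tangentSpace M p

variable {X Y : ComplexField} {p : C3} {f g : C3 → ℂ} {M : Set C3}

theorem IsAnalyticAt.conj (hX : X.IsAnalyticAt p) : X.conj.IsAnalyticAt p :=
  ⟨hX.1, hX.2.neg⟩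

theorem _root_.AnalyticAt.lieBracket {V W : C3 → C3} (hV : AnalyticAt ℝ V p)
    (hW : AnalyticAt ℝ W p) : AnalyticAt ℝ (VectorField.lieBracket ℝ V W) p := by
  have h1 := hW.fderiv.clm_apply hV
  have h2 := hV.fderiv.clm_apply hW
  exact h1.sub h2

theorem IsAnalyticAt.bracket (hX : X.IsAnalyticAt p) (hY : Y.IsAnalyticAt p) :
    (X.bracket Y).IsAnalyticAt p :=
  ⟨(hX.1.lieBracket hY.1).sub (hX.2.lieBracket hY.2),
    (hX.1.lieBracket hY.2).add (hX.2.lieBracket hY.1)⟩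

theorem IsAnalyticAt.deriv (hX : X.IsAnalyticAt p) (hf : AnalyticAt ℝ f p) :
    AnalyticAt ℝ (X.deriv f) p :=
  (hf.fderiv.clm_apply hX.1).add (analyticAt_const.mul (hf.fderiv.clm_apply hX.2))

theorem deriv_congr (h : f =ᶠ[𝓝 p] g) : X.deriv f p = X.deriv g p := by
  simp only [deriv, h.fderiv_eq]

theorem deriv_const (c : ℂ) : X.deriv (fun _ => c) p = 0 := by
  simp [deriv]

theorem deriv_mul (hf : DifferentiableAt ℝ f p) (hg : DifferentiableAt ℝ g p) :
    X.deriv (fun x => f x * g x) p = f p * X.deriv g p + g p * X.deriv f p := by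
  have : fderiv ℝ (fun x => f x * g x) p = f p • fderiv ℝ g p + g p • fderiv ℝ f p :=
    (hf.hasFDerivAt.mul hg.hasFDerivAt).fderiv
  simp only [deriv, this, add_apply, smul_apply, smul_eq_mul]
  ring

theorem deriv_sub (hf : DifferentiableAt ℝ f p) (hg : DifferentiableAt ℝ g p) :
    X.deriv (fun x => f x - g x) p = X.deriv f p - X.deriv g p := by
  have : fderiv ℝ (fun x => f x - g x) p = fderiv ℝ f p - fderiv ℝ g p :=
    (hf.hasFDerivAt.sub hg.hasFDerivAt).fderiv
  simp only [deriv, this, sub_apply]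
  ring

theorem deriv_add (hf : DifferentiableAt ℝ f p) (hg : DifferentiableAt ℝ g p) :
    X.deriv (fun x => f x + g x) p = X.deriv f p + X.deriv g p := by
  have : fderiv ℝ (fun x => f x + g x) p = fderiv ℝ f p + fderiv ℝ g p :=
    (hf.hasFDerivAt.add hg.hasFDerivAt).fderiv
  simp only [deriv, this, add_apply]
  ring

/-- The derivative along the bracket is the commutator of the derivatives. -/
theorem deriv_bracket (hX : X.IsAnalyticAt p) (hY : Y.IsAnalyticAt p) (hf : AnalyticAt ℝ f p) :
    (X.bracket Y).deriv f p = X.deriv (Y.deriv f) p - Y.deriv (X.deriv f) p := by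
  have key : ∀ {V W : C3 → C3}, AnalyticAt ℝ V p → AnalyticAt ℝ W p →
      fderiv ℝ f p (VectorField.lieBracket ℝ V W p) =
        fderiv ℝ (fun x => fderiv ℝ f x (W x)) p (V p) -
          fderiv ℝ (fun x => fderiv ℝ f x (V x)) p (W p) := fun hV hW =>
    VectorField.fderiv_apply_lieBracket (n := ω) hf.contDiffAt (by simp)
      hW.differentiableAt hV.differentiableAt
  have hd : ∀ {V W : C3 → C3}, AnalyticAt ℝ V p → AnalyticAt ℝ W p →
      fderiv ℝ (fun x => fderiv ℝ f x (V x) + Complex.I * fderiv ℝ f x (W x)) p =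
        fderiv ℝ (fun x => fderiv ℝ f x (V x)) p +
          Complex.I • fderiv ℝ (fun x => fderiv ℝ f x (W x)) p := fun hV hW => by
    have h1 := (hf.fderiv.clm_apply hV).differentiableAt.hasFDerivAt
    have h2 := (hf.fderiv.clm_apply hW).differentiableAt.hasFDerivAt
    exact (h1.add (h2.const_mul Complex.I)).fderiv
  have e0 : ∀ (Z : ComplexField) (g : C3 → ℂ),
      Z.deriv g p = fderiv ℝ g p (Z.re p) + Complex.I * fderiv ℝ g p (Z.im p) := fun _ _ => rfl
  have e1 : fderiv ℝ (Y.deriv f) p = _ := hd hY.1 hY.2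
  have e2 : fderiv ℝ (X.deriv f) p = _ := hd hX.1 hX.2
  rw [e0 X, e0 Y, e0 (X.bracket Y), e1, e2]
  simp only [bracket, map_sub, map_add, key hX.1 hY.1, key hX.2 hY.2, key hX.1 hY.2,
    key hX.2 hY.1, add_apply, smul_apply, smul_eq_mul]
  linear_combination (-(fderiv ℝ (fun x => fderiv ℝ f x (Y.im x)) p (X.im p)) +
    fderiv ℝ (fun x => fderiv ℝ f x (X.im x)) p (Y.im p)) * Complex.I_mul_I

/-- Functions vanishing on `M` are killed by tangent fields. -/
theorem IsTangentAt.deriv_eq_zero (hX : X.IsTangentAt M p) (hf : DifferentiableAt ℝ f p)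
    (h0 : ∀ᶠ x in 𝓝[M] p, f x = 0) (hp : f p = 0) : X.deriv f p = 0 := by
  have h1 : HasFDerivWithinAt f (fderiv ℝ f p) M p := hf.hasFDerivAt.hasFDerivWithinAt
  have h2 : HasFDerivWithinAt f (0 : C3 →L[ℝ] ℂ) M p :=
    (hasFDerivWithinAt_const (0 : ℂ) p M).congr_of_eventuallyEq h0 hp
  have h3 : tangentSpace M p ≤ LinearMap.ker (fderiv ℝ f p : C3 →ₗ[ℝ] ℂ) := by
    rw [tangentSpace, Submodule.span_le]
    intro v hv
    exact h1.unique_on h2 hv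
  have ha : fderiv ℝ f p (X.re p) = 0 := h3 hX.1
  have hb : fderiv ℝ f p (X.im p) = 0 := h3 hX.2
  simp [deriv, ha, hb]

end ComplexField

/-- The tangent space of the zero set of a submersion is the kernel of the differential. -/
theorem tangentSpace_eq_ker {F : Type*} [NormedAddCommGroup F] [NormedSpace ℝ F]
    [FiniteDimensional ℝ F] {M : Set C3} {p : C3} {ρ : C3 → F} {ρ' : C3 →L[ℝ] F}
    (hM : ∀ᶠ x in 𝓝 p, x ∈ M ↔ ρ x = 0) (hp : p ∈ M) (hρ : HasStrictFDerivAt ρ ρ' p)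
    (hs : Function.Surjective ρ') : tangentSpace M p = LinearMap.ker (ρ' : C3 →ₗ[ℝ] F) := by
  have hρp : ρ p = 0 := hM.self_of_nhds.1 hp
  apply le_antisymm
  · rw [tangentSpace, Submodule.span_le]
    intro v hv
    have h2 : HasFDerivWithinAt ρ (0 : C3 →L[ℝ] F) M p := by
      refine (hasFDerivWithinAt_const (0 : F) p M).congr_of_eventuallyEq ?_ hρp
      filter_upwards [hM.filter_mono nhdsWithin_le_nhds, self_mem_nhdsWithin] with x hx hxM
      exact hx.1 hxM
    exact hρ.hasFDerivAt.hasFDerivWithinAt.unique_on h2 hv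
  · intro v hv
    have hr : ρ'.range = ⊤ := LinearMap.range_eq_top.2 hs
    -- The implicit function parametrizes the level set by the kernel, with the inclusion as its
    -- differential at `0`. It therefore carries the full tangent cone of the kernel into that of
    -- `M`.
    let g : ρ'.ker → C3 := hρ.implicitFunction ρ ρ' hr (ρ p)
    have hg : HasFDerivAt g ρ'.ker.subtypeL 0 := (hρ.to_implicitFunction hr).hasFDerivAt
    have hg0 : g 0 = p := hρ.implicitFunction_apply_image hr
    have hgM : ∀ᶠ y in 𝓝 (0 : ρ'.ker), g y ∈ M := by
      have h1 := (hρ.map_implicitFunction_eq hr)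
      have h2 : Tendsto (fun y : ρ'.ker => (ρ p, y)) (𝓝 0) (𝓝 (ρ p, 0)) :=
        (Continuous.prodMk_right (ρ p)).tendsto 0
      have h3 : ∀ᶠ y in 𝓝 (0 : ρ'.ker), g y ∈ M ↔ ρ (g y) = 0 := by
        have := hg.continuousAt.tendsto
        rw [hg0] at this
        exact this.eventually hM
      filter_upwards [h2.eventually h1, h3] with y hy1 hy2
      rw [hy2]
      exact hy1.trans hρp
    let s : Set ρ'.ker := {y | g y ∈ M}
    have hs0 : s ∈ 𝓝 (0 : ρ'.ker) := hgM
    have h1 := (hg.hasFDerivWithinAt (s := s)).mapsTo_tangent_cone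
    have h2 : tangentConeAt ℝ s (0 : ρ'.ker) = Set.univ := by
      have := tangentConeAt_inter_nhds (𝕜 := ℝ) (s := Set.univ) hs0
      rw [Set.univ_inter] at this
      rw [this, tangentConeAt_univ]
    rw [h2, hg0] at h1
    have h3 := h1 (Set.mem_univ (⟨v, hv⟩ : ρ'.ker))
    exact Submodule.subset_span (tangentConeAt_mono (Set.image_subset_iff.2 fun y hy => hy) h3)

/-! ### Tangent fields, their brackets, and generators of `T^{1,0}M` -/

section General

variable {M : Set C3} {p : C3}

namespace ComplexField

variable {X Y : ComplexField} {f g : C3 → ℂ}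

theorem deriv_eq_liftBaseChange (X : ComplexField) (f : C3 → ℂ) (p : C3) :
    X.deriv f p = (fderiv ℝ f p : C3 →ₗ[ℝ] ℂ).liftBaseChange ℂ (X.value p) := by
  rw [liftBaseChange_value]
  rfl

/-- This and the next three lemmas say that a field `a - √-1 J a` differentiates holomorphic
functions by `2 df(a)` and kills antiholomorphic ones, while its conjugate does the opposite. -/
theorem deriv_of_linear (hX : X.im p = -(Complex.I • X.re p))
    (hf : ∀ v, fderiv ℝ f p (Complex.I • v) = Complex.I * fderiv ℝ f p v) :
    X.deriv f p = 2 * fderiv ℝ f p (X.re p) := by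
  rw [deriv, hX, map_neg, hf]
  linear_combination -(fderiv ℝ f p (X.re p)) * Complex.I_mul_I

theorem conj_deriv_of_linear (hX : X.im p = -(Complex.I • X.re p))
    (hf : ∀ v, fderiv ℝ f p (Complex.I • v) = Complex.I * fderiv ℝ f p v) :
    X.conj.deriv f p = 0 := by
  simp only [deriv, conj]
  rw [hX, neg_neg, hf]
  linear_combination (fderiv ℝ f p (X.re p)) * Complex.I_mul_I

theorem deriv_of_antilinear (hX : X.im p = -(Complex.I • X.re p))
    (hf : ∀ v, fderiv ℝ f p (Complex.I • v) = -(Complex.I * fderiv ℝ f p v)) :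
    X.deriv f p = 0 := by
  rw [deriv, hX, map_neg, hf]
  linear_combination (fderiv ℝ f p (X.re p)) * Complex.I_mul_I

theorem conj_deriv_of_antilinear (hX : X.im p = -(Complex.I • X.re p))
    (hf : ∀ v, fderiv ℝ f p (Complex.I • v) = -(Complex.I * fderiv ℝ f p v)) :
    X.conj.deriv f p = 2 * fderiv ℝ f p (X.re p) := by
  simp only [deriv, conj]
  rw [hX, neg_neg, hf]
  linear_combination -(fderiv ℝ f p (X.re p)) * Complex.I_mul_I

theorem IsTangentAt.conj (hX : X.IsTangentAt M p) : X.conj.IsTangentAt M p :=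
  ⟨hX.1, Submodule.neg_mem _ hX.2⟩

theorem IsTangentAt.deriv_congr (hX : X.IsTangentAt M p) (hf : DifferentiableAt ℝ f p)
    (hg : DifferentiableAt ℝ g p) (h : ∀ᶠ x in 𝓝 p, x ∈ M → f x = g x) (hp : p ∈ M) :
    X.deriv f p = X.deriv g p := by
  rw [← sub_eq_zero, ← deriv_sub hf hg]
  refine hX.deriv_eq_zero (hf.sub hg) ?_ (sub_eq_zero.2 (h.self_of_nhds hp))
  filter_upwards [h.filter_mono nhdsWithin_le_nhds, self_mem_nhdsWithin] with x hx hxM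
  exact sub_eq_zero.2 (hx hxM)

/-- The bracket of fields which are tangent to `M` along `M` is tangent to `M`. -/
theorem IsTangentAt.bracket {ρ : C3 → ℝ × ℝ} (hρ : AnalyticAt ℝ ρ p) (hp : p ∈ M)
    (hker : ∀ᶠ x in 𝓝 p, x ∈ M → tangentSpace M x = LinearMap.ker (fderiv ℝ ρ x : C3 →ₗ[ℝ] ℝ × ℝ))
    (hXa : X.IsAnalyticAt p) (hYa : Y.IsAnalyticAt p)
    (hX : ∀ᶠ x in 𝓝 p, x ∈ M → X.IsTangentAt M x) (hY : ∀ᶠ x in 𝓝 p, x ∈ M → Y.IsTangentAt M x) :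
    (X.bracket Y).IsTangentAt M p := by
  -- Each component `l ∘ ρ` is differentiated to zero along `M` by both fields. The derivative by
  -- one field thus vanishes on `M` and is killed by the other, tangent field, so the commutator
  -- kills `l ∘ ρ`.
  have key : ∀ l : ℝ × ℝ →L[ℝ] ℝ, l (fderiv ℝ ρ p ((X.bracket Y).re p)) = 0 ∧
      l (fderiv ℝ ρ p ((X.bracket Y).im p)) = 0 := by
    intro l
    let L : ℝ × ℝ →L[ℝ] ℂ := Complex.ofRealCLM.comp l
    let r : C3 → ℂ := fun x => L (ρ x)
    have hr : AnalyticAt ℝ r p := (L.analyticAt _).comp hρ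
    have hfd : ∀ᶠ x in 𝓝 p, fderiv ℝ r x = L.comp (fderiv ℝ ρ x) := by
      filter_upwards [hρ.eventually_analyticAt] with x hx
      exact (L.hasFDerivAt.comp x hx.differentiableAt.hasFDerivAt).fderiv
    have hz : ∀ Z : ComplexField, (∀ᶠ x in 𝓝 p, x ∈ M → Z.IsTangentAt M x) →
        ∀ᶠ x in 𝓝 p, x ∈ M → Z.deriv r x = 0 := by
      intro Z hZ
      filter_upwards [hZ, hfd, hker] with x hx hfx hkx hxM
      have h1 := (hx hxM).1
      have h2 := (hx hxM).2
      rw [hkx hxM, LinearMap.mem_ker] at h1 h2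
      simp only [ContinuousLinearMap.coe_coe] at h1 h2
      simp [deriv, hfx, h1, h2]
    have h0 : (X.bracket Y).deriv r p = 0 := by
      have e1 : X.deriv (Y.deriv r) p = 0 := by
        rw [(hX.self_of_nhds hp).deriv_congr (hYa.deriv hr).differentiableAt
          (differentiableAt_const (0 : ℂ)) (hz Y hY) hp, deriv_const]
      have e2 : Y.deriv (X.deriv r) p = 0 := by
        rw [(hY.self_of_nhds hp).deriv_congr (hXa.deriv hr).differentiableAt
          (differentiableAt_const (0 : ℂ)) (hz X hX) hp, deriv_const]
      rw [deriv_bracket hXa hYa hr, e1, e2, sub_zero]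
    rw [deriv, hfd.self_of_nhds] at h0
    simp only [L, ContinuousLinearMap.comp_apply, Complex.ofRealCLM_apply] at h0
    have hre := congrArg Complex.re h0
    have him := congrArg Complex.im h0
    simp only [Complex.add_re, Complex.mul_re, Complex.I_re, Complex.I_im, Complex.ofReal_re,
      Complex.ofReal_im, Complex.add_im, Complex.mul_im, Complex.zero_re, Complex.zero_im] at hre him
    exact ⟨by linarith, by linarith⟩
  have hk := hker.self_of_nhds hp
  have h1 := key (ContinuousLinearMap.fst ℝ ℝ ℝ)
  have h2 := key (ContinuousLinearMap.snd ℝ ℝ ℝ)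
  rw [IsTangentAt, hk, LinearMap.mem_ker, LinearMap.mem_ker]
  exact ⟨Prod.ext h1.1 h2.1, Prod.ext h1.2 h2.2⟩

end ComplexField

theorem mem_complexTangentSpace_value_iff {X : ComplexField} :
    X.value p ∈ complexTangentSpace M p ↔ X.IsTangentAt M p := by
  rw [complexTangentSpace, mem_baseChange_iff, X.tensorRe_value, X.tensorIm_value]
  rfl

/-- This bound suffices for the frame property: independent tangent vectors, as many as the real
dimension, must span. -/
theorem finrank_complexTangentSpace_le :
    Module.finrank ℂ (complexTangentSpace M p) ≤ Module.finrank ℝ (tangentSpace M p) := by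
  rw [complexTangentSpace, Submodule.baseChange,
    ← Module.finrank_baseChange (R := ℂ) (M' := tangentSpace M p)]
  exact LinearMap.finrank_range_le ((tangentSpace M p).subtype.baseChange ℂ)

/-- A local generator of `T^{1,0}M` is tangent to `M` and of type `(1,0)` along `M`. -/
theorem IsLocalGenerator.isTangentAt {U : Set C3} {L : ComplexField} (hL : IsLocalGenerator M U L)
    (hp : p ∈ M ∩ U) : L.IsTangentAt M p ∧ L.im p = -(Complex.I • L.re p) := by
  have h : L.value p ∈ T10 M p := by
    rw [← hL.2.2 p hp]
    exact Submodule.mem_span_singleton_self _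
  rw [mem_T10_iff, L.tensorRe_value, L.tensorIm_value] at h
  exact ⟨⟨h.1, h.2.1⟩, h.2.2⟩

/-- A local generator is a multiple of any tangent vector field of type `(1,0)`. -/
theorem IsLocalGenerator.exists_eq_smul {U : Set C3} {L : ComplexField}
    (hL : IsLocalGenerator M U L) (hp : p ∈ M ∩ U) {a : C3} (ha : a ∈ tangentSpace M p)
    (ha' : Complex.I • a ∈ tangentSpace M p) (h0 : a ≠ 0) :
    ∃ c : ℂ, c ≠ 0 ∧ L.re p = c • a := by
  have h : (1 : ℂ) ⊗ₜ[ℝ] a + Complex.I ⊗ₜ[ℝ] (-(Complex.I • a)) ∈ T10 M p := by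
    rw [mem_T10_iff]
    simp [ha, ha']
  rw [← hL.2.2 p hp, Submodule.mem_span_singleton] at h
  obtain ⟨d, hd⟩ := h
  have h1 := congrArg tensorRe hd
  rw [tensorRe_smul, L.tensorRe_value, L.tensorIm_value, (hL.isTangentAt hp).2] at h1
  simp only [smul_neg, sub_neg_eq_add, map_add, tensorRe_tmul, Complex.one_re, one_smul,
    Complex.I_re, zero_smul, neg_zero, add_zero] at h1
  have h2 : d • L.re p = a := by
    rw [← h1]
    conv_lhs => rw [← Complex.re_add_im d]
    rw [add_smul, mul_smul]
    simp only [Complex.coe_smul]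
  have hd0 : d ≠ 0 := by
    rintro rfl
    exact h0 (by rw [← h2, zero_smul])
  exact ⟨d⁻¹, inv_ne_zero hd0, by rw [← h2, smul_smul, inv_mul_cancel₀ hd0, one_smul]⟩

end General

/-! ### Beloshapka's cubic belongs to the general Class II -/

section Cubic

/-- A defining function of Beloshapka's cubic. -/
def cubicDefining (q : C3) : ℝ × ℝ :=
  (q.2.1.im - (q.1.re ^ 2 + q.1.im ^ 2), q.2.2.im - 2 * q.1.re * (q.1.re ^ 2 + q.1.im ^ 2))

theorem mem_beloshapkaCubic_iff {q : C3} : q ∈ beloshapkaCubic ↔ cubicDefining q = 0 := by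
  simp only [beloshapkaCubic, cubicDefining, Set.mem_ofPred_eq, Prod.ext_iff, Complex.ext_iff,
    Prod.fst_zero, Prod.snd_zero]
  simp only [pow_two, Complex.mul_re, Complex.mul_im, Complex.add_re, Complex.add_im,
    Complex.conj_re, Complex.conj_im, Complex.ofReal_re, Complex.ofReal_im]
  constructor
  · rintro ⟨⟨h1, -⟩, h2, -⟩
    exact ⟨by linear_combination h1, by linear_combination h2⟩
  · rintro ⟨h1, h2⟩
    exact ⟨⟨by linear_combination h1, by ring⟩, by linear_combination h2, by ring⟩

theorem analyticAt_cubicDefining (p : C3) : AnalyticAt ℝ cubicDefining p := by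
  have h1 : AnalyticAt ℝ (fun q : C3 => q.1.re) p :=
    (Complex.reCLM.comp (ContinuousLinearMap.fst ℝ ℂ (ℂ × ℂ))).analyticAt p
  have h2 : AnalyticAt ℝ (fun q : C3 => q.1.im) p :=
    (Complex.imCLM.comp (ContinuousLinearMap.fst ℝ ℂ (ℂ × ℂ))).analyticAt p
  have h3 : AnalyticAt ℝ (fun q : C3 => q.2.1.im) p :=
    (Complex.imCLM.comp ((ContinuousLinearMap.fst ℝ ℂ ℂ).comp
      (ContinuousLinearMap.snd ℝ ℂ (ℂ × ℂ)))).analyticAt p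
  have h4 : AnalyticAt ℝ (fun q : C3 => q.2.2.im) p :=
    (Complex.imCLM.comp ((ContinuousLinearMap.snd ℝ ℂ ℂ).comp
      (ContinuousLinearMap.snd ℝ ℂ (ℂ × ℂ)))).analyticAt p
  unfold cubicDefining
  fun_prop

theorem fderiv_cubicDefining (p v : C3) : fderiv ℝ cubicDefining p v =
    (v.2.1.im - 2 * (p.1.re * v.1.re + p.1.im * v.1.im),
      v.2.2.im - (2 * v.1.re * (p.1.re ^ 2 + p.1.im ^ 2) +
        4 * p.1.re * (p.1.re * v.1.re + p.1.im * v.1.im))) := by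
  have h1 : HasFDerivAt (fun q : C3 => q.1.re) _ p :=
    (Complex.reCLM.comp (ContinuousLinearMap.fst ℝ ℂ (ℂ × ℂ))).hasFDerivAt
  have h2 : HasFDerivAt (fun q : C3 => q.1.im) _ p :=
    (Complex.imCLM.comp (ContinuousLinearMap.fst ℝ ℂ (ℂ × ℂ))).hasFDerivAt
  have h3 : HasFDerivAt (fun q : C3 => q.2.1.im) _ p :=
    (Complex.imCLM.comp ((ContinuousLinearMap.fst ℝ ℂ ℂ).comp
      (ContinuousLinearMap.snd ℝ ℂ (ℂ × ℂ)))).hasFDerivAt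
  have h4 : HasFDerivAt (fun q : C3 => q.2.2.im) _ p :=
    (Complex.imCLM.comp ((ContinuousLinearMap.snd ℝ ℂ ℂ).comp
      (ContinuousLinearMap.snd ℝ ℂ (ℂ × ℂ)))).hasFDerivAt
  have h5 := (h1.pow 2).add (h2.pow 2)
  have h := (h3.sub h5).prodMk (h4.sub ((h1.const_mul 2).mul h5))
  have h' : fderiv ℝ cubicDefining p = _ := h.fderiv
  rw [h']
  simp
  constructor <;> ring

theorem surjective_fderiv_cubicDefining (p : C3) :
    Function.Surjective (fderiv ℝ cubicDefining p) := by
  rintro ⟨s, t⟩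
  refine ⟨(0, s * Complex.I, t * Complex.I), ?_⟩
  rw [fderiv_cubicDefining]
  simp

theorem tangentSpace_beloshapkaCubic {p : C3} (hp : p ∈ beloshapkaCubic) :
    tangentSpace beloshapkaCubic p = LinearMap.ker (fderiv ℝ cubicDefining p : C3 →ₗ[ℝ] ℝ × ℝ) :=
  tangentSpace_eq_ker (Eventually.of_forall fun _ => mem_beloshapkaCubic_iff) hp
    (analyticAt_cubicDefining p).hasStrictFDerivAt (surjective_fderiv_cubicDefining p)

theorem mem_tangentSpace_beloshapkaCubic {p v : C3} (hp : p ∈ beloshapkaCubic) :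
    v ∈ tangentSpace beloshapkaCubic p ↔
      v.2.1.im = 2 * (p.1.re * v.1.re + p.1.im * v.1.im) ∧
        v.2.2.im = 2 * v.1.re * (p.1.re ^ 2 + p.1.im ^ 2) +
          4 * p.1.re * (p.1.re * v.1.re + p.1.im * v.1.im) := by
  rw [tangentSpace_beloshapkaCubic hp, LinearMap.mem_ker, ContinuousLinearMap.coe_coe,
    fderiv_cubicDefining, Prod.mk_eq_zero, sub_eq_zero, sub_eq_zero]

theorem isAnalyticSubmanifold4_beloshapkaCubic : IsAnalyticSubmanifold4 beloshapkaCubic := by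
  intro p _
  refine ⟨Set.univ, cubicDefining, isOpen_univ, Set.mem_univ _,
    fun x _ => analyticAt_cubicDefining x, ?_, fun x _ => surjective_fderiv_cubicDefining x⟩
  ext x
  simp [mem_beloshapkaCubic_iff]

/-- The cubic is a graph over `(z, Re w)`. Any vector differs from the tangent vector with the same
`z` and `Re w` components by `√-1 (0, s, t)` with `s`, `t` real, and `(0, s, t)` is itself tangent.
-/
theorem isCRGeneric_beloshapkaCubic : IsCRGeneric beloshapkaCubic := by
  intro p hp
  rw [eq_top_iff]
  rintro ⟨ζ, ω₁, ω₂⟩ -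
  set l₁ : ℝ := 2 * (p.1.re * ζ.re + p.1.im * ζ.im)
  set l₂ : ℝ := 2 * ζ.re * (p.1.re ^ 2 + p.1.im ^ 2) +
    4 * p.1.re * (p.1.re * ζ.re + p.1.im * ζ.im)
  refine Submodule.mem_sup.2 ⟨(ζ, ⟨ω₁.re, l₁⟩, ⟨ω₂.re, l₂⟩), ?_,
    Complex.I • (0, ((ω₁.im - l₁ : ℝ) : ℂ), ((ω₂.im - l₂ : ℝ) : ℂ)), ?_, ?_⟩
  · rw [mem_tangentSpace_beloshapkaCubic hp]
    exact ⟨rfl, rfl⟩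
  · refine Submodule.mem_map.2 ⟨_, ?_, rfl⟩
    rw [mem_tangentSpace_beloshapkaCubic hp]
    simp
  · refine Prod.ext (by simp) (Prod.ext ?_ ?_) <;> apply Complex.ext <;> simp

theorem finrank_tangentSpace_beloshapkaCubic {p : C3} (hp : p ∈ beloshapkaCubic) :
    Module.finrank ℝ (tangentSpace beloshapkaCubic p) = 4 := by
  rw [tangentSpace_beloshapkaCubic hp]
  have h := LinearMap.finrank_range_add_finrank_ker
    (fderiv ℝ cubicDefining p : C3 →ₗ[ℝ] ℝ × ℝ)
  rw [LinearMap.range_eq_top.2 (surjective_fderiv_cubicDefining p), finrank_top] at h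
  simp only [Module.finrank_prod, Module.finrank_self, Complex.finrank_real_complex] at h
  omega

theorem normalForm_zero : normalForm Remainder.zero Remainder.zero = beloshapkaCubic := by
  simp [normalForm, beloshapkaCubic, Remainder.eval, Remainder.zero]

/-- Every local generator of `T^{1,0}` of the cubic yields a frame. -/
theorem IsLocalGenerator.isFrameAt_beloshapkaCubic {U : Set C3} {L : ComplexField} (hU : IsOpen U)
    (hL : IsLocalGenerator beloshapkaCubic U L) {p : C3} (hp : p ∈ beloshapkaCubic ∩ U) :
    IsFrameAt beloshapkaCubic L p := by
  set M := beloshapkaCubic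
  -- Along `M` the field `L` kills the antiholomorphic coordinates `Zb`, `W₁`, `W₂`. On these
  -- functions `[L, L̄]` therefore acts as `L L̄`, and `[L, [L, L̄]]` as `L [L, L̄]`.
  let Z : C3 → ℂ := fun q => q.1
  let Zb : C3 → ℂ := fun q => star q.1
  let W₁ : C3 → ℂ := fun q => star q.2.1
  let W₂ : C3 → ℂ := fun q => star q.2.2
  have aZ : ∀ q, AnalyticAt ℝ Z q := fun q => (ContinuousLinearMap.fst ℝ ℂ (ℂ × ℂ)).analyticAt q
  let cZb : C3 →L[ℝ] ℂ := Complex.conjCLE.toContinuousLinearMap.comp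
    (ContinuousLinearMap.fst ℝ ℂ (ℂ × ℂ))
  let cW₁ : C3 →L[ℝ] ℂ := Complex.conjCLE.toContinuousLinearMap.comp
    ((ContinuousLinearMap.fst ℝ ℂ ℂ).comp (ContinuousLinearMap.snd ℝ ℂ (ℂ × ℂ)))
  let cW₂ : C3 →L[ℝ] ℂ := Complex.conjCLE.toContinuousLinearMap.comp
    ((ContinuousLinearMap.snd ℝ ℂ ℂ).comp (ContinuousLinearMap.snd ℝ ℂ (ℂ × ℂ)))
  have aZb : ∀ q, AnalyticAt ℝ Zb q := fun q => cZb.analyticAt q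
  have aW₁ : ∀ q, AnalyticAt ℝ W₁ q := fun q => cW₁.analyticAt q
  have aW₂ : ∀ q, AnalyticAt ℝ W₂ q := fun q => cW₂.analyticAt q
  have dZ : ∀ q v, fderiv ℝ Z q v = v.1 := fun q v =>
    DFunLike.congr_fun (ContinuousLinearMap.fst ℝ ℂ (ℂ × ℂ)).hasFDerivAt.fderiv v
  have dZb : ∀ q v, fderiv ℝ Zb q v = star v.1 := fun q v =>
    DFunLike.congr_fun cZb.hasFDerivAt.fderiv v
  have dW₁ : ∀ q v, fderiv ℝ W₁ q v = star v.2.1 := fun q v =>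
    DFunLike.congr_fun cW₁.hasFDerivAt.fderiv v
  have dW₂ : ∀ q v, fderiv ℝ W₂ q v = star v.2.2 := fun q v =>
    DFunLike.congr_fun cW₂.hasFDerivAt.fderiv v
  -- `E₁` and `E₂` are the conjugated `w`-components of the holomorphic tangent vector `a` with
  -- `z`-component `1`, found by differentiating `w - w̄ = 2√-1 v` in `z` with `z̄` and `w̄` fixed.
  let E₁ : C3 → ℂ := fun q => (-2 * Complex.I) * Z q
  let E₂ : C3 → ℂ := fun q => (-2 * Complex.I) * (Z q * (2 * Zb q + Z q))
  have aE₁ : ∀ q, AnalyticAt ℝ E₁ q := fun q => analyticAt_const.mul (aZ q)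
  have aE₂ : ∀ q, AnalyticAt ℝ E₂ q := fun q =>
    analyticAt_const.mul ((aZ q).mul ((analyticAt_const.mul (aZb q)).add (aZ q)))
  let T := L.bracket L.conj
  let S := L.bracket T
  have aL : ∀ q ∈ U, L.IsAnalyticAt q := fun q hq => ⟨hL.1 q hq, hL.2.1 q hq⟩
  have aLb : ∀ q ∈ U, L.conj.IsAnalyticAt q := fun q hq => (aL q hq).conj
  have aT : ∀ q ∈ U, T.IsAnalyticAt q := fun q hq => (aL q hq).bracket (aLb q hq)
  have nhdsU : ∀ q ∈ U, ∀ᶠ x in 𝓝 q, x ∈ U := fun q hq => hU.mem_nhds hq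
  have tL : ∀ q ∈ M ∩ U, L.IsTangentAt M q := fun q hq => (hL.isTangentAt hq).1
  have typeL : ∀ q ∈ M ∩ U, L.im q = -(Complex.I • L.re q) := fun q hq => (hL.isTangentAt hq).2
  have ker : ∀ q, ∀ᶠ x in 𝓝 q, x ∈ M → tangentSpace M x =
      LinearMap.ker (fderiv ℝ cubicDefining x : C3 →ₗ[ℝ] ℝ × ℝ) := fun q =>
    Eventually.of_forall fun x hx => tangentSpace_beloshapkaCubic hx
  have tT : ∀ q ∈ M ∩ U, T.IsTangentAt M q := fun q hq =>
    ComplexField.IsTangentAt.bracket (analyticAt_cubicDefining q) hq.1 (ker q) (aL q hq.2)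
      (aLb q hq.2) ((nhdsU q hq.2).mono fun x hx hxM => tL x ⟨hxM, hx⟩)
      ((nhdsU q hq.2).mono fun x hx hxM => (tL x ⟨hxM, hx⟩).conj)
  have tS : ∀ q ∈ M ∩ U, S.IsTangentAt M q := fun q hq =>
    ComplexField.IsTangentAt.bracket (analyticAt_cubicDefining q) hq.1 (ker q) (aL q hq.2)
      (aT q hq.2) ((nhdsU q hq.2).mono fun x hx hxM => tL x ⟨hxM, hx⟩)
      ((nhdsU q hq.2).mono fun x hx hxM => tT x ⟨hxM, hx⟩)
  let f : C3 → ℂ := L.deriv Z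
  let g : C3 → ℂ := L.conj.deriv Zb
  have af : ∀ q ∈ U, AnalyticAt ℝ f q := fun q hq => (aL q hq).deriv (aZ q)
  have ag : ∀ q ∈ U, AnalyticAt ℝ g q := fun q hq => (aLb q hq).deriv (aZb q)
  -- the values of the coordinate functions along `L` and its conjugate
  have base : ∀ q ∈ M ∩ U, f q ≠ 0 ∧ g q ≠ 0 ∧ L.deriv Zb q = 0 ∧ L.deriv W₁ q = 0 ∧
      L.deriv W₂ q = 0 ∧ L.conj.deriv Z q = 0 ∧ L.conj.deriv W₁ q = g q * E₁ q ∧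
      L.conj.deriv W₂ q = g q * E₂ q := by
    intro q hq
    have hX := typeL q hq
    let a : C3 := (1, 2 * Complex.I * star q.1, 2 * Complex.I * (2 * q.1 * star q.1 + star q.1 ^ 2))
    have ha : a ∈ tangentSpace M q := by
      rw [mem_tangentSpace_beloshapkaCubic hq.1]
      simp [a, pow_two]
      ring
    have ha' : Complex.I • a ∈ tangentSpace M q := by
      rw [mem_tangentSpace_beloshapkaCubic hq.1]
      simp [a, pow_two]
      ring
    obtain ⟨c, hc, hLc⟩ := hL.exists_eq_smul hq ha ha' (fun h => one_ne_zero (congrArg Prod.fst h))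
    have hf : f q = 2 * c := by
      refine (ComplexField.deriv_of_linear hX fun v => by simp [dZ]).trans ?_
      rw [dZ, hLc]
      simp [a]
    have hg : g q = 2 * star c := by
      refine (ComplexField.conj_deriv_of_antilinear hX fun v => by simp [dZb]).trans ?_
      rw [dZb, hLc]
      simp [a]
    refine ⟨by rw [hf]; simpa using hc, by rw [hg]; simpa using hc,
      ComplexField.deriv_of_antilinear hX fun v => by simp [dZb],
      ComplexField.deriv_of_antilinear hX fun v => by simp [dW₁],
      ComplexField.deriv_of_antilinear hX fun v => by simp [dW₂],
      ComplexField.conj_deriv_of_linear hX fun v => by simp [dZ], ?_, ?_⟩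
    · rw [ComplexField.conj_deriv_of_antilinear hX fun v => by simp [dW₁], dW₁, hLc, hg]
      simp [a, E₁, Z]
      ring
    · rw [ComplexField.conj_deriv_of_antilinear hX fun v => by simp [dW₂], dW₂, hLc, hg]
      simp [a, E₂, Z, Zb]
      ring
  have dmul : ∀ {X : ComplexField} {φ ψ : C3 → ℂ} {q : C3}, AnalyticAt ℝ φ q → AnalyticAt ℝ ψ q →
      X.deriv (fun x => φ x * ψ x) q = φ q * X.deriv ψ q + ψ q * X.deriv φ q := fun h1 h2 =>
    ComplexField.deriv_mul h1.differentiableAt h2.differentiableAt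
  have dadd : ∀ {X : ComplexField} {φ ψ : C3 → ℂ} {q : C3}, AnalyticAt ℝ φ q → AnalyticAt ℝ ψ q →
      X.deriv (fun x => φ x + ψ x) q = X.deriv φ q + X.deriv ψ q := fun h1 h2 =>
    ComplexField.deriv_add h1.differentiableAt h2.differentiableAt
  have dcmul : ∀ {X : ComplexField} {ψ : C3 → ℂ} {q : C3} (c : ℂ), AnalyticAt ℝ ψ q →
      X.deriv (fun x => c * ψ x) q = c * X.deriv ψ q := fun c h => by
    rw [dmul analyticAt_const h, ComplexField.deriv_const]; ring
  have onM : ∀ {X : ComplexField} {φ ψ : C3 → ℂ} {q : C3}, q ∈ M ∩ U → X.IsTangentAt M q →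
      AnalyticAt ℝ φ q → AnalyticAt ℝ ψ q → (∀ x ∈ M ∩ U, φ x = ψ x) →
      X.deriv φ q = X.deriv ψ q := fun hq hX h1 h2 h =>
    hX.deriv_congr h1.differentiableAt h2.differentiableAt
      ((nhdsU _ hq.2).mono fun x hx hxM => h x ⟨hxM, hx⟩) hq.1
  let t : C3 → ℂ := T.deriv Zb
  have at_ : ∀ q ∈ U, AnalyticAt ℝ t q := fun q hq => (aT q hq).deriv (aZb q)
  have LE₁ : ∀ q ∈ M ∩ U, L.deriv E₁ q = -2 * Complex.I * f q := fun q _ =>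
    dcmul _ (aZ q)
  let B₂ : C3 → ℂ := fun q => (-4 * Complex.I) * (Z q + Zb q)
  have aB₂ : ∀ q, AnalyticAt ℝ B₂ q := fun q => analyticAt_const.mul ((aZ q).add (aZb q))
  have LE₂ : ∀ q ∈ M ∩ U, L.deriv E₂ q = B₂ q * f q := fun q hq => by
    have h1 : AnalyticAt ℝ (fun x => 2 * Zb x) q := analyticAt_const.mul (aZb q)
    have h2 : AnalyticAt ℝ (fun x => 2 * Zb x + Z x) q := h1.add (aZ q)
    have h3 : AnalyticAt ℝ (fun x => Z x * (2 * Zb x + Z x)) q := (aZ q).mul h2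
    have e3 : L.deriv E₂ q = _ := dcmul _ h3
    rw [e3, dmul (aZ q) h2, dadd h1 (aZ q), dcmul _ (aZb q), (base q hq).2.2.1]
    simp only [B₂, f]
    ring
  have LB₂ : ∀ q ∈ M ∩ U, L.deriv B₂ q = -4 * Complex.I * f q := fun q hq => by
    have h1 : AnalyticAt ℝ (fun x => Z x + Zb x) q := (aZ q).add (aZb q)
    have e1 : L.deriv B₂ q = _ := dcmul _ h1
    rw [e1, dadd (aZ q) (aZb q), (base q hq).2.2.1, add_zero]
  -- the second bracket
  have brT : ∀ q ∈ M ∩ U, ∀ (φ E : C3 → ℂ), (∀ q, AnalyticAt ℝ φ q) → (∀ q, AnalyticAt ℝ E q) →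
      (∀ x ∈ M ∩ U, L.deriv φ x = 0) → (∀ x ∈ M ∩ U, L.conj.deriv φ x = g x * E x) →
      T.deriv φ q = g q * L.deriv E q + E q * t q := by
    intro q hq φ E hφ hE h1 h2
    have e0 : t q = L.deriv g q := by
      have : L.conj.deriv (L.deriv Zb) q = 0 := by
        rw [onM hq (tL q hq).conj ((aL q hq.2).deriv (aZb q)) analyticAt_const
          (fun x hx => (base x hx).2.2.1), ComplexField.deriv_const]
      have h3 := ComplexField.deriv_bracket (aL q hq.2) (aLb q hq.2) (aZb q)
      rw [this, sub_zero] at h3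
      exact h3
    rw [ComplexField.deriv_bracket (aL q hq.2) (aLb q hq.2) (hφ q),
      onM hq (tL q hq) ((aLb q hq.2).deriv (hφ q)) ((ag q hq.2).mul (hE q)) h2,
      onM hq (tL q hq).conj ((aL q hq.2).deriv (hφ q)) analyticAt_const h1,
      ComplexField.deriv_const, sub_zero, e0]
    exact dmul (ag q hq.2) (hE q)
  have T₁ : ∀ q ∈ M ∩ U, T.deriv W₁ q = (-2 * Complex.I) * (g q * f q) + E₁ q * t q := by
    intro q hq
    rw [brT q hq W₁ E₁ aW₁ aE₁ (fun x hx => (base x hx).2.2.2.1)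
      (fun x hx => (base x hx).2.2.2.2.2.2.1), LE₁ q hq]
    ring
  have T₂ : ∀ q ∈ M ∩ U, T.deriv W₂ q = B₂ q * (g q * f q) + E₂ q * t q := by
    intro q hq
    rw [brT q hq W₂ E₂ aW₂ aE₂ (fun x hx => (base x hx).2.2.2.2.1)
      (fun x hx => (base x hx).2.2.2.2.2.2.2), LE₂ q hq]
    ring
  have agf : ∀ q ∈ U, AnalyticAt ℝ (fun x => g x * f x) q := fun q hq =>
    (ag q hq).mul (af q hq)
  -- the third bracket
  have brS : ∀ (φ : C3 → ℂ) (ψ : C3 → ℂ), AnalyticAt ℝ φ p → AnalyticAt ℝ ψ p →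
      (∀ x ∈ M ∩ U, L.deriv φ x = 0) → (∀ x ∈ M ∩ U, T.deriv φ x = ψ x) →
      S.deriv φ p = L.deriv ψ p := by
    intro φ ψ hφ hψ h1 h2
    rw [ComplexField.deriv_bracket (aL p hp.2) (aT p hp.2) hφ,
      onM hp (tL p hp) ((aT p hp.2).deriv hφ) hψ h2,
      onM hp (tT p hp) ((aL p hp.2).deriv hφ) analyticAt_const h1,
      ComplexField.deriv_const, sub_zero]
  have Sb : S.deriv Zb p = L.deriv t p :=
    brS Zb t (aZb p) (at_ p hp.2) (fun x hx => (base x hx).2.2.1) fun _ _ => rfl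
  have S₁ : S.deriv W₁ p = (-2 * Complex.I) * L.deriv (fun x => g x * f x) p +
      (E₁ p * L.deriv t p + t p * (-2 * Complex.I * f p)) := by
    have h1 : AnalyticAt ℝ (fun x => (-2 * Complex.I) * (g x * f x)) p :=
      analyticAt_const.mul (agf p hp.2)
    have h2 : AnalyticAt ℝ (fun x => E₁ x * t x) p := (aE₁ p).mul (at_ p hp.2)
    have h3 : AnalyticAt ℝ (fun x => (-2 * Complex.I) * (g x * f x) + E₁ x * t x) p := h1.add h2
    rw [brS W₁ _ (aW₁ p) h3 (fun x hx => (base x hx).2.2.2.1) T₁, dadd h1 h2, dcmul _ (agf p hp.2), dmul (aE₁ p) (at_ p hp.2), LE₁ p hp]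
  have S₂ : S.deriv W₂ p = (B₂ p * L.deriv (fun x => g x * f x) p +
      (g p * f p) * (-4 * Complex.I * f p)) +
      (E₂ p * L.deriv t p + t p * (B₂ p * f p)) := by
    have h1 : AnalyticAt ℝ (fun x => B₂ x * (g x * f x)) p := (aB₂ p).mul (agf p hp.2)
    have h2 : AnalyticAt ℝ (fun x => E₂ x * t x) p := (aE₂ p).mul (at_ p hp.2)
    have h3 : AnalyticAt ℝ (fun x => B₂ x * (g x * f x) + E₂ x * t x) p := h1.add h2
    rw [brS W₂ _ (aW₂ p) h3 (fun x hx => (base x hx).2.2.2.2.1) T₂, dadd h1 h2, dmul (aB₂ p) (agf p hp.2), dmul (aE₂ p) (at_ p hp.2), LE₂ p hp,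
      LB₂ p hp]
  obtain ⟨hf0, hg0, b1, b2, b3, b4, b5, b6⟩ := base p hp
  have hlin : LinearIndependent ℂ ![L.value p, L.conj.value p, T.value p, S.value p] := by
    rw [Fintype.linearIndependent_iff]
    intro c hc
    rw [Fin.sum_univ_four] at hc
    simp only [Matrix.cons_val_zero, Matrix.cons_val_one, Matrix.cons_val] at hc
    have rel : ∀ φ : C3 → ℂ, c 0 * L.deriv φ p + c 1 * L.conj.deriv φ p + c 2 * T.deriv φ p +
        c 3 * S.deriv φ p = 0 := by
      intro φ
      have := congrArg ((fderiv ℝ φ p : C3 →ₗ[ℝ] ℂ).liftBaseChange ℂ) hc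
      simpa only [map_add, map_smul, smul_eq_mul, map_zero,
        ← ComplexField.deriv_eq_liftBaseChange] using this
    have r1 := rel W₁
    have r2 := rel W₂
    have rb := rel Zb
    rw [b2, b5, T₁ p hp, S₁] at r1
    rw [b3, b6, T₂ p hp, S₂] at r2
    rw [b1, Sb] at rb
    change c 0 * 0 + c 1 * g p + c 2 * t p + c 3 * _ = 0 at rb
    set k := L.deriv (fun x => g x * f x) p
    -- Subtracting `E₁` and `E₂` times the relation for `z̄` removes `c 1` and the unknown `L t`.
    -- The first relation then removes `c 2` from the second, leaving the contribution of `L B₂ =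
    -- -4√-1 f`, which is nonzero: this is where the cubic terms enter.
    have q1 : (-2 * Complex.I) * (c 2 * (g p * f p) + c 3 * (k + t p * f p)) = 0 := by
      linear_combination r1 - E₁ p * rb
    have q1' : c 2 * (g p * f p) + c 3 * (k + t p * f p) = 0 := by
      simpa using q1
    have q2 : c 3 * (-4 * Complex.I * (g p * f p * f p)) = 0 := by
      linear_combination r2 - E₂ p * rb - B₂ p * q1'
    have c3 : c 3 = 0 := by simpa [hf0, hg0] using q2
    have c2 : c 2 = 0 := by simpa [hf0, hg0, c3] using q1'
    have c1 : c 1 = 0 := by simpa [hg0, c3, c2] using rb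
    have c0 : c 0 = 0 := by
      have := rel Z
      simpa [hf0, c3, c2, c1, show L.deriv Z p ≠ 0 from hf0] using this
    intro i
    fin_cases i
    exacts [c0, c1, c2, c3]
  refine ⟨hlin, ?_⟩
  apply Submodule.eq_of_le_of_finrank_le
  · rw [Submodule.span_le]
    rintro _ ⟨i, rfl⟩
    fin_cases i
    exacts [mem_complexTangentSpace_value_iff.2 (tL p hp),
      mem_complexTangentSpace_value_iff.2 (tL p hp).conj,
      mem_complexTangentSpace_value_iff.2 (tT p hp), mem_complexTangentSpace_value_iff.2 (tS p hp)]
  · refine finrank_complexTangentSpace_le.trans ?_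
    rw [finrank_tangentSpace_beloshapkaCubic hp.1]
    have := finrank_span_eq_card hlin
    rw [Fintype.card_fin] at this
    exact this.ge

theorem isGeneralClassII_beloshapkaCubic : IsGeneralClassII beloshapkaCubic :=
  ⟨isAnalyticSubmanifold4_beloshapkaCubic, isCRGeneric_beloshapkaCubic,
    fun _ _ hU hL _ hp => hL.isFrameAt_beloshapkaCubic hU hp⟩

end Cubic

/-! ### Linear coordinates and complexification of a defining function -/

section NormalCoordinates

/-- Near a point of a CR-generic submanifold there are linear coordinates in which the submanifold
has a defining function with differential `(Im w₁, Im w₂)`. -/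
theorem exists_linear_coordinates {M : Set C3} (h0 : (0 : C3) ∈ M) (hM : IsAnalyticSubmanifold4 M)
    (hG : IsCRGeneric M) : ∃ (e : C3 ≃L[ℂ] C3) (ρ : C3 → ℝ × ℝ), AnalyticAt ℝ ρ 0 ∧
      (∀ᶠ q in 𝓝 0, e q ∈ M ↔ ρ q = 0) ∧ ∀ v, fderiv ℝ ρ 0 v = (v.2.1.im, v.2.2.im) := by
  obtain ⟨U, ρ, hU, hpU, hρ, hMU, hs⟩ := hM 0 h0
  have hρ0 : AnalyticAt ℝ ρ 0 := hρ 0 hpU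
  have hmem : ∀ᶠ x in 𝓝 (0 : C3), x ∈ M ↔ ρ x = 0 := by
    filter_upwards [hU.mem_nhds hpU] with x hx
    have := Set.ext_iff.1 hMU x
    simp only [Set.mem_inter_iff, hx, and_true, Set.mem_ofPred_eq, true_and] at this
    exact this
  set d := fderiv ℝ ρ 0
  have hsurj : Function.Surjective d := hs 0 ⟨h0, hpU⟩
  have hT : tangentSpace M 0 = LinearMap.ker (d : C3 →ₗ[ℝ] ℝ × ℝ) :=
    tangentSpace_eq_ker hmem h0 hρ0.hasStrictFDerivAt hsurj
  have hgen := hG 0 h0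
  rw [hT] at hgen
  let c : ℝ × ℝ → ℂ × ℂ := fun t => ((t.1 : ℂ), (t.2 : ℂ))
  have c_add : ∀ s t, c (s + t) = c s + c t := fun s t => by simp [c]
  have c_neg : ∀ s, c (-s) = -c s := fun s => by simp [c]
  have c_smul : ∀ (r : ℝ) s, c (r • s) = (r : ℂ) • c s := fun r s => by simp [c]
  -- The unique complex-linear map with imaginary part `d`; its real part at `x` is forced to be `d
  -- (√-1 x)`.
  let l : C3 →ₗ[ℂ] ℂ × ℂ :=
    { toFun := fun x => c (d (Complex.I • x)) + Complex.I • c (d x)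
      map_add' := fun x y => by
        simp only [smul_add, map_add, c_add]; abel
      map_smul' := fun a x => by
        have h1 : ∀ x : C3, d (a • x) = a.re • d x + a.im • d (Complex.I • x) := fun x => by
          rw [← d.map_smul, ← d.map_smul, ← map_add]
          congr 1
          conv_lhs => rw [← Complex.re_add_im a, add_smul, mul_smul]
          simp only [Complex.coe_smul]
        have h2 : d (Complex.I • a • x) = a.re • d (Complex.I • x) - a.im • d x := by
          rw [smul_comm, h1, smul_smul, Complex.I_mul_I, neg_one_smul, map_neg, smul_neg,
            sub_eq_add_neg]
        rw [h1, h2, sub_eq_add_neg, c_add, c_add, c_neg, c_smul, c_smul, c_smul, c_smul,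
          RingHom.id_apply]
        refine Prod.ext ?_ ?_ <;>
        · simp only [Prod.fst_add, Prod.snd_add, Prod.smul_fst, Prod.smul_snd, Prod.fst_neg,
            Prod.snd_neg, smul_eq_mul]
          conv_rhs => rw [← Complex.re_add_im a]
          ring_nf
          rw [Complex.I_sq]
          ring }
  have l_im : ∀ x, ((l x).1.im, (l x).2.im) = d x := fun x => by
    simp [l, c]
  have l_re : ∀ x, ((l x).1.re, (l x).2.re) = d (Complex.I • x) := fun x => by
    simp [l, c]
  have hl : Function.Surjective l := by
    -- real dual argument: a covector killing the range vanishes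
    rw [← LinearMap.range_eq_top]
    by_contra hne
    obtain ⟨φ, hφ0, hφ⟩ := Submodule.exists_le_ker_of_lt_top _ (lt_top_iff_ne_top.2 hne)
    apply hφ0
    set α := φ (1, 0)
    set β := φ (0, 1)
    have hφe : ∀ w : ℂ × ℂ, φ w = w.1 * α + w.2 * β := fun w => by
      have : w = w.1 • ((1 : ℂ), (0 : ℂ)) + w.2 • ((0 : ℂ), (1 : ℂ)) := by
        refine Prod.ext ?_ ?_ <;> simp
      conv_lhs => rw [this]
      rw [map_add, map_smul, map_smul, smul_eq_mul, smul_eq_mul]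
    have hker : ∀ x, (l x).1 * α + (l x).2 * β = 0 := fun x => by
      rw [← hφe]
      exact hφ ⟨x, rfl⟩
    have e1 : ∀ x, (d (Complex.I • x)).1 * α.im + (d x).1 * α.re + (d (Complex.I • x)).2 * β.im +
        (d x).2 * β.re = 0 := fun x => by
      have h := congrArg Complex.im (hker x)
      rw [← l_re, ← l_im]
      simp only [Complex.add_im, Complex.mul_im, Complex.zero_im] at h
      linarith
    -- Genericity enters here: `v = a + J b'` with `d a = d b' = 0`, so that `e1` at `b'` retains
    -- only the terms in `d (J b') = d v`.
    have e2 : ∀ v, (d v).1 * α.im + (d v).2 * β.im = 0 := by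
      intro v
      obtain ⟨a, ha, b, hb, rfl⟩ := Submodule.mem_sup.1 (hgen.ge (Submodule.mem_top (x := v)))
      obtain ⟨b', hb', rfl⟩ := Submodule.mem_map.1 hb
      have ha' : d a = 0 := ha
      have hb'' : d b' = 0 := hb'
      have := e1 b'
      simp only [hb'', Prod.fst_zero, Prod.snd_zero, zero_mul, add_zero] at this
      simp only [map_add, ha', zero_add, J_apply]
      exact this
    have e3 : ∀ v, (d v).1 * α.re + (d v).2 * β.re = 0 := fun v => by
      have h1 := e1 v
      have h2 := e2 (Complex.I • v)
      linarith
    obtain ⟨v₁, hv₁⟩ := hsurj (1, 0)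
    obtain ⟨v₂, hv₂⟩ := hsurj (0, 1)
    have a1 := e2 v₁
    have a2 := e2 v₂
    have a3 := e3 v₁
    have a4 := e3 v₂
    simp only [hv₁, hv₂, one_mul, zero_mul, add_zero, zero_add] at a1 a2 a3 a4
    have hα : α = 0 := Complex.ext a3 a1
    have hβ : β = 0 := Complex.ext a4 a2
    ext <;> simp [hφe, hα, hβ]
  -- The vector `k` spans the complex tangent line `ker l`, and `a₁`, `a₂` lift the basis of `ℂ²`.
  -- In the coordinates `z k + w₁ a₁ + w₂ a₂` the map `l` is `(w₁, w₂)`.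
  obtain ⟨k, hk, hk0⟩ := (Submodule.ne_bot_iff _).1
    (LinearMap.ker_ne_bot_of_finrank_lt (f := l) (by simp))
  obtain ⟨a₁, ha₁⟩ := hl (1, 0)
  obtain ⟨a₂, ha₂⟩ := hl (0, 1)
  let E : C3 →ₗ[ℂ] C3 :=
    { toFun := fun q => q.1 • k + q.2.1 • a₁ + q.2.2 • a₂
      map_add' := fun x y => by simp only [Prod.fst_add, Prod.snd_add, add_smul]; abel
      map_smul' := fun a x => by
        simp only [Prod.smul_fst, Prod.smul_snd, smul_eq_mul, mul_smul, smul_add,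
          RingHom.id_apply] }
  have hlE : ∀ q, l (E q) = q.2 := fun q => by
    have : l k = 0 := hk
    simp only [E, LinearMap.coe_mk, AddHom.coe_mk, map_add, map_smul, this, ha₁, ha₂]
    refine Prod.ext ?_ ?_ <;> simp
  have hE : Function.Injective E := by
    rw [← LinearMap.ker_eq_bot, LinearMap.ker_eq_bot']
    intro q hq
    have h2 : q.2 = 0 := by rw [← hlE, hq, map_zero]
    have h1 : q.1 • k = 0 := by
      have : E q = q.1 • k + q.2.1 • a₁ + q.2.2 • a₂ := rfl
      rw [this, h2] at hq
      simpa using hq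
    exact Prod.ext ((smul_eq_zero.1 h1).resolve_right hk0) h2
  let e : C3 ≃L[ℂ] C3 := (LinearEquiv.ofInjectiveEndo E hE).toContinuousLinearEquiv
  have he : ∀ q, e q = E q := fun q => rfl
  let eR : C3 →L[ℝ] C3 := (e : C3 →L[ℂ] C3).restrictScalars ℝ
  have hρe : AnalyticAt ℝ ρ (eR 0) := by rw [map_zero]; exact hρ0
  refine ⟨e, fun q => ρ (eR q), hρe.comp (eR.analyticAt 0), ?_, fun v => ?_⟩
  · have : Tendsto e (𝓝 0) (𝓝 0) := by
      have := e.continuous.tendsto 0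
      rwa [map_zero] at this
    exact this.eventually hmem
  · have h1 : HasFDerivAt ρ d (eR 0) := by
      rw [map_zero]; exact hρ0.differentiableAt.hasFDerivAt
    have h2 := (h1.comp (0 : C3) eR.hasFDerivAt).fderiv
    change fderiv ℝ (ρ ∘ eR) 0 v = _
    rw [h2]
    change d (E v) = _
    rw [← l_im, hlE]

/-- Complexification of a defining function near the origin. -/
theorem exists_complexification_of_defining {ρ : C3 → ℝ × ℝ} (hρ : AnalyticAt ℝ ρ 0) :
    ∃ R : C3 × C3 → ℂ × ℂ, AnalyticAt ℂ R 0 ∧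
      (∀ᶠ x in 𝓝 0, R (x, star x) = (((ρ x).1 : ℂ), ((ρ x).2 : ℂ))) ∧
      ∀ x y, R (star y, star x) = star (R (x, y)) := by
  let b := Complex.basisOneI.prod (Complex.basisOneI.prod Complex.basisOneI)
  -- The forms `(x + y)/2` and `(x - y)/(2√-1)` restrict to the real and imaginary parts on `y =
  -- x̄`, and the involution `(x, y) ↦ (ȳ, x̄)` conjugates their values.
  let mm : Fin 2 → (C3 →L[ℂ] ℂ) → (C3 × C3 →L[ℂ] ℂ) := fun i π =>
    ![(2 : ℂ)⁻¹ • (π.comp (ContinuousLinearMap.fst ℂ C3 C3) +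
        π.comp (ContinuousLinearMap.snd ℂ C3 C3)),
      (2 * Complex.I)⁻¹ • (π.comp (ContinuousLinearMap.fst ℂ C3 C3) -
        π.comp (ContinuousLinearMap.snd ℂ C3 C3))] i
  let π₀ : C3 →L[ℂ] ℂ := ContinuousLinearMap.fst ℂ ℂ (ℂ × ℂ)
  let π₁ : C3 →L[ℂ] ℂ := (ContinuousLinearMap.fst ℂ ℂ ℂ).comp (ContinuousLinearMap.snd ℂ ℂ (ℂ × ℂ))
  let π₂ : C3 →L[ℂ] ℂ := (ContinuousLinearMap.snd ℂ ℂ ℂ).comp (ContinuousLinearMap.snd ℂ ℂ (ℂ × ℂ))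
  let m : Fin 2 ⊕ (Fin 2 ⊕ Fin 2) → (C3 × C3 →L[ℂ] ℂ) :=
    Sum.elim (fun i => mm i π₀) (Sum.elim (fun i => mm i π₁) fun i => mm i π₂)
  have hre : ∀ z : ℂ, 2⁻¹ * (z + star z) = (z.re : ℂ) := fun z => by
    apply Complex.ext <;> simp; ring
  have him : ∀ z : ℂ, (2 * Complex.I)⁻¹ * (z - star z) = (z.im : ℂ) := fun z => by
    have : z - star z = (2 * Complex.I) * z.im := by apply Complex.ext <;> simp; ring
    rw [this, inv_mul_cancel_left₀ (by simp)]
  have hm : ∀ (x : C3) i, m i ((fun x => (x, star x)) x) = (b.repr x i : ℂ) := by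
    intro x i
    rcases i with i | i | i <;> fin_cases i <;>
      simp [m, mm, b, π₀, π₁, π₂, ← hre, ← him, -mul_inv_rev, mul_add]
  have hc : ContinuousAt (fun x : C3 => (x, star x)) 0 := by fun_prop
  have hc0 : (fun x : C3 => (x, star x)) 0 = 0 := by simp
  have hσ : ∀ (v : C3 × C3) i, m i ((fun v : C3 × C3 => (star v.2, star v.1)) v) =
      star (m i v) := by
    intro v i
    have h1 : ∀ z w : ℂ, 2⁻¹ * (star w + star z) = star (2⁻¹ * (z + w)) := fun z w => by
      simp [add_comm]
    have h2 : ∀ z w : ℂ, (2 * Complex.I)⁻¹ * (star w - star z) =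
        star ((2 * Complex.I)⁻¹ * (z - w)) := fun z w => by
      simp; ring
    rcases i with i | i | i <;> fin_cases i
    exacts [h1 v.1.1 v.2.1, h2 v.1.1 v.2.1, h1 v.1.2.1 v.2.2.1, h2 v.1.2.1 v.2.2.1,
      h1 v.1.2.2 v.2.2.2, h2 v.1.2.2 v.2.2.2]
  obtain ⟨R₁, h₁, h₁', h₁''⟩ := AnalyticAt.exists_complexification b _ hc hc0 m hm
    (((ContinuousLinearMap.fst ℝ ℝ ℝ).analyticAt _).comp hρ)
  obtain ⟨R₂, h₂, h₂', h₂''⟩ := AnalyticAt.exists_complexification b _ hc hc0 m hm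
    (((ContinuousLinearMap.snd ℝ ℝ ℝ).analyticAt _).comp hρ)
  refine ⟨fun v => (R₁ v, R₂ v), h₁.prod h₂, ?_, fun x y => ?_⟩
  · filter_upwards [h₁', h₂'] with x hx₁ hx₂
    exact Prod.ext hx₁ hx₂
  · exact Prod.ext (h₁'' _ hσ (x, y)) (h₂'' _ hσ (x, y))

/-- The differential of the complexified defining function. -/
theorem fderiv_complexification {ρ : C3 → ℝ × ℝ} (hρ : AnalyticAt ℝ ρ 0)
    (hd : ∀ v, fderiv ℝ ρ 0 v = (v.2.1.im, v.2.2.im)) {R : C3 × C3 → ℂ × ℂ}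
    (hR : AnalyticAt ℂ R 0)
    (hRρ : ∀ᶠ x in 𝓝 0, R (x, star x) = (((ρ x).1 : ℂ), ((ρ x).2 : ℂ))) (a b : C3) :
    fderiv ℂ R 0 (a, b) = (2 * Complex.I)⁻¹ • (a.2 - b.2) := by
  set R' := fderiv ℂ R 0
  let st : C3 →L[ℝ] C3 := (starL' ℝ : C3 ≃L[ℝ] C3)
  let c : C3 →L[ℝ] C3 × C3 := (ContinuousLinearMap.id ℝ C3).prod st
  let κ : ℝ × ℝ →L[ℝ] ℂ × ℂ := Complex.ofRealCLM.prodMap Complex.ofRealCLM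
  have hc : ∀ x, c x = (x, star x) := fun x => rfl
  have h1 : HasFDerivAt (fun x => R (c x)) ((R'.restrictScalars ℝ).comp c) 0 := by
    have : HasFDerivAt R (R'.restrictScalars ℝ) (c 0) := by
      rw [map_zero]
      exact hR.differentiableAt.hasFDerivAt.restrictScalars ℝ
    exact this.comp (0 : C3) c.hasFDerivAt
  have h2 : HasFDerivAt (fun x => R (c x)) (κ.comp (fderiv ℝ ρ 0)) 0 := by
    have h := κ.hasFDerivAt.comp (0 : C3) hρ.differentiableAt.hasFDerivAt
    refine h.congr_of_eventuallyEq ?_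
    filter_upwards [hRρ] with x hx
    exact hx
  have key : ∀ x : C3, R' (x, star x) = ((x.2.1.im : ℂ), (x.2.2.im : ℂ)) := fun x => by
    have := DFunLike.congr_fun (h1.unique h2) x
    simp only [ContinuousLinearMap.comp_apply, hd, hc] at this
    exact this
  -- The points `(x, x̄)` form a totally real subspace that generates `ℂ³ × ℂ³` over `ℂ`, so the
  -- complex-linear `R'` is determined by its values there.
  set x : C3 := (2 : ℂ)⁻¹ • (a + star b)
  set y : C3 := (2 * Complex.I)⁻¹ • (a - star b)
  have hdec : (a, b) = (x, star x) + Complex.I • (y, star y) := by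
    have e1 : Complex.I * (2 * Complex.I)⁻¹ = 2⁻¹ := by
      field_simp
    have e2 : Complex.I * star (2 * Complex.I)⁻¹ = -(2 : ℂ)⁻¹ := by
      simp only [Complex.star_def, map_inv₀, map_mul, Complex.conj_I, map_ofNat]
      field_simp
    refine Prod.ext ?_ ?_
    · simp only [x, y, Prod.fst_add, Prod.smul_fst, smul_smul, e1, ← smul_add]
      have : a + star b + (a - star b) = (2 : ℂ) • a := by rw [two_smul]; abel
      rw [this, smul_smul]; simp
    · simp only [x, y, Prod.snd_add, Prod.smul_snd, star_smul, smul_smul, e2]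
      have : star (2⁻¹ : ℂ) = 2⁻¹ := by simp
      rw [this, neg_smul, ← sub_eq_add_neg, ← smul_sub]
      have : star (a + star b) - star (a - star b) = (2 : ℂ) • b := by
        rw [two_smul, star_add, star_sub, star_star]; abel
      rw [this, smul_smul]; simp
  rw [hdec, map_add, map_smul, key, key]
  have fin : ∀ p q : ℂ, (((2⁻¹ : ℂ) * (p + star q)).im : ℂ) +
      Complex.I * (((2 * Complex.I)⁻¹ * (p - star q)).im : ℂ) = (2 * Complex.I)⁻¹ * (p - q) := by
    intro p q
    have : (2 * Complex.I)⁻¹ = -(Complex.I / 2) := by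
      rw [mul_inv, Complex.inv_I]; ring
    rw [this]
    apply Complex.ext <;> simp <;> ring
  exact Prod.ext (fin a.2.1 b.2.1) (fin a.2.2 b.2.2)

end NormalCoordinates

/-! ### Normal coordinates from Segre varieties -/

section NormalCoordinates

theorem eventually_comp_zero {A B : Type*} [TopologicalSpace A] [TopologicalSpace B] [Zero A]
    [Zero B] {k : A → B} (hk : ContinuousAt k 0) (hk0 : k 0 = 0) {P : B → Prop}
    (h : ∀ᶠ x in 𝓝 0, P x) : ∀ᶠ y in 𝓝 0, P (k y) := by
  have : Tendsto k (𝓝 0) (𝓝 0) := by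
    have := hk.tendsto
    rwa [hk0] at this
  exact this.eventually h

/-- Normal coordinates, for a complexified defining function `R` of which only the zero set and
the compatibility with conjugation matter. -/
theorem exists_normal_coordinates {R : C3 × C3 → ℂ × ℂ} (hR : AnalyticAt ℂ R 0) (hR0 : R 0 = 0)
    (hR' : ∀ a b, fderiv ℂ R 0 (a, b) = (2 * Complex.I)⁻¹ • (a.2 - b.2))
    (hσ : ∀ x y, R (star y, star x) = star (R (x, y))) :
    ∃ G : C3 → ℂ × ℂ, AnalyticAt ℂ G 0 ∧ G 0 = 0 ∧ (∀ v, fderiv ℂ G 0 v = v.2) ∧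
      ∃ Φ : ℂ × ℂ × (ℂ × ℂ) → ℂ × ℂ, AnalyticAt ℂ Φ 0 ∧
        (∀ᶠ p in 𝓝 (0 : ℂ × (ℂ × ℂ)), Φ (p.1, 0, p.2) = 0) ∧
        (∀ᶠ p in 𝓝 (0 : ℂ × (ℂ × ℂ)), Φ (0, p.1, p.2) = 0) ∧
        (∀ᶠ p in 𝓝 (0 : ℂ × (ℂ × ℂ)), star p.2 = p.2 →
          star (Φ (p.1, star p.1, p.2)) = Φ (p.1, star p.1, p.2)) ∧
        ∀ᶠ p in 𝓝 (0 : (ℂ × (ℂ × ℂ)) × (ℂ × ℂ)), star p.1.2 = p.1.2 → star p.2 = p.2 →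
          (R ((p.1.1, G (p.1.1, p.1.2 + Complex.I • p.2)),
              star ((p.1.1, G (p.1.1, p.1.2 + Complex.I • p.2)) : C3)) = 0 ↔
            p.2 = Φ (p.1.1, star p.1.1, p.1.2)) := by
  have hI2 : (2 * Complex.I)⁻¹ ≠ 0 := inv_ne_zero (by simp)
  have hIinv : ∀ w : ℂ × ℂ, (2 * Complex.I)⁻¹ • (Complex.I • w + Complex.I • w) = w := fun w => by
    rw [← smul_add, ← two_smul ℂ w, smul_smul, smul_smul]
    have : (2 * Complex.I)⁻¹ * Complex.I * 2 = 1 := by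
      rw [mul_assoc, mul_comm Complex.I, inv_mul_cancel₀ (by simp)]
    rw [this, one_smul]
  have star_mk : ∀ (x : ℂ) (y : ℂ × ℂ), star ((x, y) : C3) = (star x, star y) := fun _ _ => rfl
  have starI : star Complex.I = -Complex.I := by simp
  set R' := fderiv ℂ R 0
  have hRd : HasFDerivAt R R' 0 := hR.differentiableAt.hasFDerivAt
  have compR : ∀ {X : Type} [NormedAddCommGroup X] [NormedSpace ℂ X] {A : X → C3 × C3}
      {A' : X →L[ℂ] C3 × C3}, HasFDerivAt A A' 0 → A 0 = 0 →
      HasFDerivAt (fun x => R (A x)) (R'.comp A') 0 := by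
    intro X _ _ A A' hA hA0
    have : HasFDerivAt R R' (A 0) := by rw [hA0]; exact hRd
    exact this.comp (0 : X) hA
  have compRa : ∀ {X : Type} [NormedAddCommGroup X] [NormedSpace ℂ X] {A : X → C3 × C3},
      AnalyticAt ℂ A 0 → A 0 = 0 → AnalyticAt ℂ (fun x => R (A x)) 0 := by
    intro X _ _ A hA hA0
    have : AnalyticAt ℂ R (A 0) := by rw [hA0]; exact hR
    exact this.comp hA
  let sc : (ℂ × ℂ) ≃L[ℂ] (ℂ × ℂ) := ContinuousLinearEquiv.smulLeft (Units.mk0 _ hI2)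
  have hsc : ∀ w, sc w = (2 * Complex.I)⁻¹ • w := fun w => rfl
  -- the edge of the submanifold
  let A₁ : (ℂ × ℂ) × (ℂ × ℂ) →L[ℂ] C3 × C3 :=
    ((0 : (ℂ × ℂ) × (ℂ × ℂ) →L[ℂ] ℂ).prod (ContinuousLinearMap.fst ℂ (ℂ × ℂ) (ℂ × ℂ) +
        Complex.I • ContinuousLinearMap.snd ℂ (ℂ × ℂ) (ℂ × ℂ))).prod
      ((0 : (ℂ × ℂ) × (ℂ × ℂ) →L[ℂ] ℂ).prod (ContinuousLinearMap.fst ℂ (ℂ × ℂ) (ℂ × ℂ) -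
        Complex.I • ContinuousLinearMap.snd ℂ (ℂ × ℂ) (ℂ × ℂ)))
  have hA₁ : ∀ p, A₁ p = ((0, p.1 + Complex.I • p.2), (0, p.1 - Complex.I • p.2)) := fun p => rfl
  obtain ⟨γ, γa, γ0, γiff, γ', γd, γd'⟩ := AnalyticAt.exists_implicitFunction
    (compRa (A₁.analyticAt 0) (map_zero A₁)) (by rw [map_zero, hR0])
    (compR A₁.hasFDerivAt (map_zero A₁)) (ContinuousLinearEquiv.refl ℂ (ℂ × ℂ)) (fun y => by
      rw [ContinuousLinearMap.comp_apply, hA₁, hR']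
      simp only [zero_add, zero_sub, sub_neg_eq_add, hIinv]
      rfl)
  have γ'0 : γ' = 0 := by
    refine ContinuousLinearMap.ext fun s => ?_
    have := γd' s
    rw [ContinuousLinearMap.comp_apply, hA₁, hR'] at this
    have h2 : s + Complex.I • γ' s - (s - Complex.I • γ' s) = Complex.I • γ' s + Complex.I • γ' s := by
      abel
    have h3 : (2 * Complex.I)⁻¹ • (s + Complex.I • γ' s - (s - Complex.I • γ' s)) = 0 := this
    rw [h2, hIinv] at h3
    exact h3
  subst γ'0
  -- the family of Segre varieties through the edge
  have A₂d : HasFDerivAt (fun p : C3 × (ℂ × ℂ) =>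
      (((p.1.1, p.2), (0, p.1.2 - Complex.I • γ p.1.2)) : C3 × C3)) _ 0 :=
    ((hasFDerivAt_fst.fst).prodMk hasFDerivAt_snd).prodMk
      ((hasFDerivAt_const (0 : ℂ) (0 : C3 × (ℂ × ℂ))).prodMk
        ((hasFDerivAt_fst.snd).sub ((HasFDerivAt.comp (0 : C3 × (ℂ × ℂ)) (g := γ)
          (f := fun p : C3 × (ℂ × ℂ) => p.1.2) γd hasFDerivAt_fst.snd).const_smul Complex.I)))
  have aγ : ∀ {X : Type} [NormedAddCommGroup X] [NormedSpace ℂ X] {k : X → ℂ × ℂ},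
      AnalyticAt ℂ k 0 → k 0 = 0 → AnalyticAt ℂ (fun x => γ (k x)) 0 := by
    intro X _ _ k hk hk0
    have : AnalyticAt ℂ γ (k 0) := by rw [hk0]; exact γa
    exact this.comp hk
  have A₂a : AnalyticAt ℂ (fun p : C3 × (ℂ × ℂ) =>
      (((p.1.1, p.2), (0, p.1.2 - Complex.I • γ p.1.2)) : C3 × C3)) 0 := by
    have h1 : AnalyticAt ℂ (fun p : C3 × (ℂ × ℂ) => p.1.2) 0 :=
      ((ContinuousLinearMap.snd ℂ ℂ (ℂ × ℂ)).comp
        (ContinuousLinearMap.fst ℂ C3 (ℂ × ℂ))).analyticAt 0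
    have h0 : AnalyticAt ℂ (fun p : C3 × (ℂ × ℂ) => p.1.1) 0 :=
      ((ContinuousLinearMap.fst ℂ ℂ (ℂ × ℂ)).comp
        (ContinuousLinearMap.fst ℂ C3 (ℂ × ℂ))).analyticAt 0
    have h2 := aγ h1 rfl
    exact (h0.prod analyticAt_snd).prod (analyticAt_const.prod (h1.fun_sub (h2.fun_const_smul (c := Complex.I))))
  have A₂0 : (fun p : C3 × (ℂ × ℂ) =>
      (((p.1.1, p.2), (0, p.1.2 - Complex.I • γ p.1.2)) : C3 × C3)) 0 = 0 := by
    simp [γ0]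
  obtain ⟨G, Ga, G0, Giff, G', Gd, Gd'⟩ := AnalyticAt.exists_implicitFunction
    (compRa A₂a A₂0) ((congrArg R A₂0).trans hR0) (compR A₂d A₂0) sc (fun y => by
      rw [ContinuousLinearMap.comp_apply, hsc]
      exact (hR' _ _).trans (by simp))
  have G'v : ∀ v, G' v = v.2 := by
    intro v
    have h1 := Gd' v
    rw [ContinuousLinearMap.comp_apply] at h1
    have h2 := (hR' _ _).symm.trans h1
    have h3 := (smul_eq_zero.1 h2).resolve_left hI2
    simpa [sub_eq_zero] using h3
  -- the conjugate family
  have A₃d : HasFDerivAt (fun p : C3 × (ℂ × ℂ) =>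
      (((0, p.1.2 + Complex.I • γ p.1.2), (p.1.1, p.2)) : C3 × C3)) _ 0 :=
    ((hasFDerivAt_const (0 : ℂ) (0 : C3 × (ℂ × ℂ))).prodMk
        ((hasFDerivAt_fst.snd).add ((HasFDerivAt.comp (0 : C3 × (ℂ × ℂ)) (g := γ)
          (f := fun p : C3 × (ℂ × ℂ) => p.1.2) γd hasFDerivAt_fst.snd).const_smul
            Complex.I))).prodMk ((hasFDerivAt_fst.fst).prodMk hasFDerivAt_snd)
  have A₃a : AnalyticAt ℂ (fun p : C3 × (ℂ × ℂ) =>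
      (((0, p.1.2 + Complex.I • γ p.1.2), (p.1.1, p.2)) : C3 × C3)) 0 := by
    have h1 : AnalyticAt ℂ (fun p : C3 × (ℂ × ℂ) => p.1.2) 0 :=
      ((ContinuousLinearMap.snd ℂ ℂ (ℂ × ℂ)).comp
        (ContinuousLinearMap.fst ℂ C3 (ℂ × ℂ))).analyticAt 0
    have h0 : AnalyticAt ℂ (fun p : C3 × (ℂ × ℂ) => p.1.1) 0 :=
      ((ContinuousLinearMap.fst ℂ ℂ (ℂ × ℂ)).comp
        (ContinuousLinearMap.fst ℂ C3 (ℂ × ℂ))).analyticAt 0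
    have h2 := aγ h1 rfl
    exact (analyticAt_const.prod (h1.fun_add (h2.fun_const_smul (c := Complex.I)))).prod (h0.prod analyticAt_snd)
  have A₃0 : (fun p : C3 × (ℂ × ℂ) =>
      (((0, p.1.2 + Complex.I • γ p.1.2), (p.1.1, p.2)) : C3 × C3)) 0 = 0 := by
    simp [γ0]
  obtain ⟨H, Ha, H0, Hiff, H', Hd, Hd'⟩ := AnalyticAt.exists_implicitFunction
    (compRa A₃a A₃0) ((congrArg R A₃0).trans hR0) (compR A₃d A₃0)
    (sc.trans (ContinuousLinearEquiv.neg ℂ)) (fun y => by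
      rw [ContinuousLinearMap.comp_apply]
      exact (hR' _ _).trans (by simp [hsc]))
  have H'v : ∀ v, H' v = v.2 := by
    intro v
    have h1 := Hd' v
    rw [ContinuousLinearMap.comp_apply] at h1
    have h2 := (hR' _ _).symm.trans h1
    have h3 := (smul_eq_zero.1 h2).resolve_left hI2
    have h4 : v.2 - H' v = 0 := by simpa using h3
    exact (sub_eq_zero.1 h4).symm
  -- the graphing function
  let prS : (ℂ × ℂ × (ℂ × ℂ)) × (ℂ × ℂ) →L[ℂ] ℂ × ℂ :=
    (ContinuousLinearMap.snd ℂ ℂ (ℂ × ℂ)).comp ((ContinuousLinearMap.snd ℂ ℂ (ℂ × ℂ × ℂ)).comp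
      (ContinuousLinearMap.fst ℂ (ℂ × ℂ × (ℂ × ℂ)) (ℂ × ℂ)))
  let prI : (ℂ × ℂ × (ℂ × ℂ)) × (ℂ × ℂ) →L[ℂ] ℂ × ℂ :=
    Complex.I • ContinuousLinearMap.snd ℂ (ℂ × ℂ × (ℂ × ℂ)) (ℂ × ℂ)
  let kG : (ℂ × ℂ × (ℂ × ℂ)) × (ℂ × ℂ) →L[ℂ] C3 :=
    ((ContinuousLinearMap.fst ℂ ℂ (ℂ × ℂ × ℂ)).comp
      (ContinuousLinearMap.fst ℂ (ℂ × ℂ × (ℂ × ℂ)) (ℂ × ℂ))).prod (prS + prI)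
  let kH : (ℂ × ℂ × (ℂ × ℂ)) × (ℂ × ℂ) →L[ℂ] C3 :=
    ((ContinuousLinearMap.fst ℂ ℂ (ℂ × ℂ)).comp ((ContinuousLinearMap.snd ℂ ℂ (ℂ × ℂ × ℂ)).comp
      (ContinuousLinearMap.fst ℂ (ℂ × ℂ × (ℂ × ℂ)) (ℂ × ℂ)))).prod (prS - prI)
  have kGv : ∀ p, kG p = (p.1.1, p.1.2.2 + Complex.I • p.2) := fun _ => rfl
  have kHv : ∀ p, kH p = (p.1.2.1, p.1.2.2 - Complex.I • p.2) := fun _ => rfl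
  have kG0 : kG 0 = 0 := map_zero kG
  have kH0 : kH 0 = 0 := map_zero kH
  have kGa : AnalyticAt ℂ kG 0 := kG.analyticAt 0
  have kHa : AnalyticAt ℂ kH 0 := kH.analyticAt 0
  have Gka : AnalyticAt ℂ (fun p => G (kG p)) 0 := by
    have : AnalyticAt ℂ G (kG 0) := by rw [kG0]; exact Ga
    exact this.comp kGa
  have Hka : AnalyticAt ℂ (fun p => H (kH p)) 0 := by
    have : AnalyticAt ℂ H (kH 0) := by rw [kH0]; exact Ha
    exact this.comp kHa
  have A₄a : AnalyticAt ℂ (fun p : (ℂ × ℂ × (ℂ × ℂ)) × (ℂ × ℂ) =>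
      (((p.1.1, G (kG p)), (p.1.2.1, H (kH p))) : C3 × C3)) 0 := by
    have h1 : AnalyticAt ℂ (fun p : (ℂ × ℂ × (ℂ × ℂ)) × (ℂ × ℂ) => p.1.1) 0 :=
      ((ContinuousLinearMap.fst ℂ ℂ (ℂ × ℂ × ℂ)).comp
        (ContinuousLinearMap.fst ℂ (ℂ × ℂ × (ℂ × ℂ)) (ℂ × ℂ))).analyticAt 0
    have h2 : AnalyticAt ℂ (fun p : (ℂ × ℂ × (ℂ × ℂ)) × (ℂ × ℂ) => p.1.2.1) 0 :=
      ((ContinuousLinearMap.fst ℂ ℂ (ℂ × ℂ)).comp ((ContinuousLinearMap.snd ℂ ℂ (ℂ × ℂ × ℂ)).comp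
        (ContinuousLinearMap.fst ℂ (ℂ × ℂ × (ℂ × ℂ)) (ℂ × ℂ)))).analyticAt 0
    exact (h1.prod Gka).prod (h2.prod Hka)
  have A₄0 : (fun p : (ℂ × ℂ × (ℂ × ℂ)) × (ℂ × ℂ) =>
      (((p.1.1, G (kG p)), (p.1.2.1, H (kH p))) : C3 × C3)) 0 = 0 := by
    simp [kG0, kH0, G0, H0]
  have Gkd : HasFDerivAt (fun p => G (kG p)) (G'.comp (kG)) 0 := by
    have : HasFDerivAt G G' (kG 0) := by rw [kG0]; exact Gd
    exact this.comp (0 : (ℂ × ℂ × (ℂ × ℂ)) × (ℂ × ℂ)) kG.hasFDerivAt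
  have Hkd : HasFDerivAt (fun p => H (kH p)) (H'.comp (kH)) 0 := by
    have : HasFDerivAt H H' (kH 0) := by rw [kH0]; exact Hd
    exact this.comp (0 : (ℂ × ℂ × (ℂ × ℂ)) × (ℂ × ℂ)) kH.hasFDerivAt
  have A₄d : HasFDerivAt (fun p : (ℂ × ℂ × (ℂ × ℂ)) × (ℂ × ℂ) =>
      (((p.1.1, G (kG p)), (p.1.2.1, H (kH p))) : C3 × C3)) _ 0 :=
    ((hasFDerivAt_fst.fst).prodMk Gkd).prodMk ((hasFDerivAt_fst.snd.fst).prodMk Hkd)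
  obtain ⟨Φ, Φa, Φ0, Φiff, -⟩ := AnalyticAt.exists_implicitFunction
    (compRa A₄a A₄0) ((congrArg R A₄0).trans hR0) (compR A₄d A₄0) (ContinuousLinearEquiv.refl ℂ (ℂ × ℂ))
    (fun y => by
      rw [ContinuousLinearMap.comp_apply]
      refine (hR' _ _).trans ?_
      change (2 * Complex.I)⁻¹ • (G' (kG (0, y)) - H' (kH (0, y))) = y
      rw [G'v, H'v]
      simp only [kGv, kHv, Prod.snd_zero, zero_add, zero_sub, sub_neg_eq_add, hIinv])
  have σ0 : ∀ x y, R (x, y) = 0 → R (star y, star x) = 0 := fun x y h => by rw [hσ, h, star_zero]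
  have cG : ContinuousAt G 0 := Ga.continuousAt
  have cH : ContinuousAt H 0 := Ha.continuousAt
  have cγ : ContinuousAt γ 0 := γa.continuousAt
  have cΦ : ContinuousAt Φ 0 := Φa.continuousAt
  have cγs : ContinuousAt (fun s : ℂ × ℂ => γ (star s)) 0 := by
    refine ContinuousAt.comp (g := γ) ?_ continuous_star.continuousAt
    rwa [star_zero]
  have γzero : ∀ᶠ s in 𝓝 (0 : ℂ × ℂ),
      R ((0, s + Complex.I • γ s), (0, s - Complex.I • γ s)) = 0 := by
    have := eventually_comp_zero (k := fun s : ℂ × ℂ => (s, γ s)) (by fun_prop) (by simp [γ0]) γiff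
    exact this.mono fun s hs => hs.2 rfl
  -- The conjugation symmetry of `R` makes the left side another solution of the equation defining
  -- `γ`, and uniqueness in the implicit function theorem identifies them. The same argument relates
  -- `G` to `H` and gives the reality of `Φ`.
  have γstar : ∀ᶠ s in 𝓝 (0 : ℂ × ℂ), star (γ (star s)) = γ s := by
    have h1 := eventually_comp_zero (k := fun s : ℂ × ℂ => star s) (by fun_prop) (by simp) γzero
    have h2 := eventually_comp_zero (k := fun s : ℂ × ℂ => (s, star (γ (star s))))
      (continuousAt_id.prodMk cγs.star)
      (by simp [γ0]) γiff
    filter_upwards [h1, h2] with s hs1 hs2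
    refine hs2.1 ?_
    have := σ0 _ _ hs1
    simp only [star_mk, star_zero, star_sub, star_add, star_smul, star_star, starI,
      neg_smul, sub_neg_eq_add, ← sub_eq_add_neg] at this
    exact this
  have Gzero : ∀ᶠ q in 𝓝 (0 : C3), R ((q.1, G q), (0, q.2 - Complex.I • γ q.2)) = 0 := by
    have := eventually_comp_zero (k := fun q : C3 => (q, G q)) (by fun_prop) (by simp [G0]) Giff
    exact this.mono fun s hs => hs.2 rfl
  have Hzero : ∀ᶠ q in 𝓝 (0 : C3), R ((0, q.2 + Complex.I • γ q.2), (q.1, H q)) = 0 := by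
    have := eventually_comp_zero (k := fun q : C3 => (q, H q)) (by fun_prop) (by simp [H0]) Hiff
    exact this.mono fun s hs => hs.2 rfl
  have Gedge : ∀ᶠ s in 𝓝 (0 : ℂ × ℂ), s + Complex.I • γ s = G (0, s) := by
    have h2 := eventually_comp_zero
      (k := fun s : ℂ × ℂ => (((0, s), s + Complex.I • γ s) : C3 × (ℂ × ℂ))) (by fun_prop)
      (by simp [γ0]) Giff
    filter_upwards [γzero, h2] with s hs1 hs2
    exact hs2.1 hs1
  have Hedge : ∀ᶠ s in 𝓝 (0 : ℂ × ℂ), s - Complex.I • γ s = H (0, s) := by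
    have h2 := eventually_comp_zero
      (k := fun s : ℂ × ℂ => (((0, s), s - Complex.I • γ s) : C3 × (ℂ × ℂ))) (by fun_prop)
      (by simp [γ0]) Hiff
    filter_upwards [γzero, h2] with s hs1 hs2
    exact hs2.1 hs1
  have cGs : ContinuousAt (fun q : C3 => G (star q)) 0 := by
    refine ContinuousAt.comp (g := G) ?_ continuous_star.continuousAt
    rwa [star_zero]
  have GH : ∀ᶠ q in 𝓝 (0 : C3), star (G (star q)) = H q := by
    have h1 := eventually_comp_zero (k := fun s : C3 => star s) (by fun_prop) (by simp) Gzero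
    have h2 := eventually_comp_zero (k := fun q : C3 => (q, star (G (star q))))
      (continuousAt_id.prodMk cGs.star)
      (by simp [G0]) Hiff
    have h3 := eventually_comp_zero (k := fun q : C3 => q.2) (by fun_prop) (by simp) γstar
    filter_upwards [h1, h2, h3] with q hq1 hq2 hq3
    refine hq2.1 ?_
    have := σ0 _ _ hq1
    simp only [star_mk, star_zero, star_sub, star_smul, star_star, starI,
      neg_smul, sub_neg_eq_add] at this
    rw [← hq3]
    exact this
  -- For `ζ = 0` and `v = 0` the second argument of `R` is `(0, s - √-1 γ(s))`, so the equation for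
  -- `Φ` is the one that defines `G`. Hence `v = 0` is the solution; this is the gain from using
  -- Segre varieties as coordinates.
  have ΦzeroL : ∀ᶠ p in 𝓝 (0 : ℂ × (ℂ × ℂ)), Φ (p.1, 0, p.2) = 0 := by
    have h1 := eventually_comp_zero
      (k := fun p : ℂ × (ℂ × ℂ) => (((p.1, 0, p.2), 0) : (ℂ × ℂ × (ℂ × ℂ)) × (ℂ × ℂ)))
      (by fun_prop) rfl Φiff
    have h2 := eventually_comp_zero (k := fun p : ℂ × (ℂ × ℂ) => p.2) (by fun_prop) rfl Hedge
    filter_upwards [h1, h2, Gzero] with p hp1 hp2 hp3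
    refine (hp1.1 ?_).symm
    simp only [kGv, kHv, smul_zero, add_zero, sub_zero]
    rw [← hp2]
    exact hp3
  have ΦzeroR : ∀ᶠ p in 𝓝 (0 : ℂ × (ℂ × ℂ)), Φ (0, p.1, p.2) = 0 := by
    have h1 := eventually_comp_zero
      (k := fun p : ℂ × (ℂ × ℂ) => (((0, p.1, p.2), 0) : (ℂ × ℂ × (ℂ × ℂ)) × (ℂ × ℂ)))
      (by fun_prop) rfl Φiff
    have h2 := eventually_comp_zero (k := fun p : ℂ × (ℂ × ℂ) => p.2) (by fun_prop) rfl Gedge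
    filter_upwards [h1, h2, Hzero] with p hp1 hp2 hp3
    refine (hp1.1 ?_).symm
    simp only [kGv, kHv, smul_zero, add_zero, sub_zero]
    rw [← hp2]
    exact hp3
  refine ⟨G, Ga, G0, fun v => by rw [Gd.fderiv, G'v], Φ, Φa, ΦzeroL, ΦzeroR, ?_, ?_⟩
  · have cp : ContinuousAt (fun p : ℂ × (ℂ × ℂ) => ((p.1, star p.1, p.2) : ℂ × ℂ × (ℂ × ℂ))) 0 := by
      fun_prop
    have cΦs : ContinuousAt (fun p : ℂ × (ℂ × ℂ) => Φ (p.1, star p.1, p.2)) 0 := by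
      refine ContinuousAt.comp (g := Φ) ?_ cp
      change ContinuousAt Φ (0, star 0, 0)
      rw [star_zero]
      exact cΦ
    have Φ0' : Φ (0, 0, 0) = 0 := Φ0
    have c1 : ContinuousAt (fun p : ℂ × (ℂ × ℂ) => star p.1) 0 := by fun_prop
    have h1 := eventually_comp_zero (k := fun p : ℂ × (ℂ × ℂ) =>
      (((p.1, star p.1, p.2), Φ (p.1, star p.1, p.2)) : (ℂ × ℂ × (ℂ × ℂ)) × (ℂ × ℂ)))
      (cp.prodMk cΦs) (by simp [Φ0']) Φiff
    have h2 := eventually_comp_zero (k := fun p : ℂ × (ℂ × ℂ) =>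
      (((p.1, star p.1, p.2), star (Φ (p.1, star p.1, p.2))) : (ℂ × ℂ × (ℂ × ℂ)) × (ℂ × ℂ)))
      (cp.prodMk cΦs.star) (by simp [Φ0']) Φiff
    have h3 := eventually_comp_zero (k := fun p : ℂ × (ℂ × ℂ) =>
      ((star p.1, star (p.2 + Complex.I • Φ (p.1, star p.1, p.2))) : C3))
      (c1.prodMk (continuousAt_snd.add (cΦs.const_smul Complex.I)).star) (by simp [Φ0']) GH
    have h4 := eventually_comp_zero (k := fun p : ℂ × (ℂ × ℂ) =>
      ((star p.1, p.2 - Complex.I • Φ (p.1, star p.1, p.2)) : C3))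
      (c1.prodMk (continuousAt_snd.sub (cΦs.const_smul Complex.I)))
      (by simp [Φ0']) GH
    filter_upwards [h1, h2, h3, h4] with p hp1 hp2 hp3 hp4 hreal
    refine hp2.1 ?_
    have e := σ0 _ _ (hp1.2 rfl)
    have e1 : star (p.2 + Complex.I • Φ (p.1, star p.1, p.2)) =
        p.2 - Complex.I • star (Φ (p.1, star p.1, p.2)) := by
      rw [star_add, hreal, star_smul, starI, neg_smul, sub_eq_add_neg]
    have e2 : star (p.2 - Complex.I • Φ (p.1, star p.1, p.2)) =
        p.2 + Complex.I • star (Φ (p.1, star p.1, p.2)) := by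
      rw [star_sub, hreal, star_smul, starI, neg_smul, sub_neg_eq_add]
    simp only [star_mk, star_star] at hp3 hp4
    simp only [kGv, kHv, star_mk, star_star] at e ⊢
    rw [← e1, ← e2, ← hp3]
    rw [← hp4, star_star] at e
    exact e
  · have c1 : ContinuousAt (fun p : (ℂ × (ℂ × ℂ)) × (ℂ × ℂ) => star p.1.1) 0 := by fun_prop
    have c2 : ContinuousAt (fun p : (ℂ × (ℂ × ℂ)) × (ℂ × ℂ) =>
      star (p.1.2 + Complex.I • p.2)) 0 := by fun_prop
    have h1 := eventually_comp_zero (k := fun p : (ℂ × (ℂ × ℂ)) × (ℂ × ℂ) =>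
      (((p.1.1, star p.1.1, p.1.2), p.2) : (ℂ × ℂ × (ℂ × ℂ)) × (ℂ × ℂ)))
      (by fun_prop) (by simp) Φiff
    have h2 := eventually_comp_zero (k := fun p : (ℂ × (ℂ × ℂ)) × (ℂ × ℂ) =>
      ((star p.1.1, star (p.1.2 + Complex.I • p.2)) : C3)) (c1.prodMk c2) (by simp) GH
    -- For real `u` and `v` the conjugate of `u + √-1 v` is `u - √-1 v`, so conjugating `G` produces
    -- exactly the argument `H` used to define `Φ`.
    filter_upwards [h1, h2] with p hp1 hp2 hu hv
    have e1 : star (p.1.2 + Complex.I • p.2) = p.1.2 - Complex.I • p.2 := by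
      rw [star_add, hu, star_smul, starI, hv, neg_smul, sub_eq_add_neg]
    rw [← hp1]
    simp only [star_mk, star_star] at hp2
    simp only [kGv, kHv, star_mk]
    rw [hp2, e1]

end NormalCoordinates

/-! ### The graph `v = z z̄ ψ(z, u)` -/

section GraphChart

/-- Division by `ζ` and then by `z`. The first quotient `g` is not shown to vanish on `z = 0`; only
`ζ g(0, ζ, u) = Φ(0, ζ, u) = 0` is available, and it suffices because the second division is
multiplied by `ζ`. -/
theorem exists_factorization {Φ : ℂ × ℂ × (ℂ × ℂ) → ℂ × ℂ} (hΦ : AnalyticAt ℂ Φ 0)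
    (h1 : ∀ᶠ p in 𝓝 (0 : ℂ × (ℂ × ℂ)), Φ (p.1, 0, p.2) = 0)
    (h2 : ∀ᶠ p in 𝓝 (0 : ℂ × (ℂ × ℂ)), Φ (0, p.1, p.2) = 0) :
    ∃ h : ℂ × ℂ × (ℂ × ℂ) → ℂ × ℂ, AnalyticAt ℂ h 0 ∧
      ∀ᶠ p in 𝓝 0, Φ p = (p.1 * p.2.1) • h p := by
  obtain ⟨g, ga, hg⟩ := hΦ.exists_sub_eq_smul
    ((ContinuousLinearMap.fst ℂ ℂ (ℂ × ℂ)).comp (ContinuousLinearMap.snd ℂ ℂ (ℂ × ℂ × ℂ)))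
    (0, 1, 0)
  obtain ⟨h, ha, hh⟩ := ga.exists_sub_eq_smul (ContinuousLinearMap.fst ℂ ℂ (ℂ × ℂ × ℂ)) (1, 0, 0)
  have g1 : ∀ᶠ p in 𝓝 (0 : ℂ × ℂ × (ℂ × ℂ)), Φ p = p.2.1 • g p := by
    have k := eventually_comp_zero (k := fun p : ℂ × ℂ × (ℂ × ℂ) => (p.1, p.2.2))
      (by fun_prop) rfl h1
    filter_upwards [hg, k] with p hp hk
    have e : p - ((ContinuousLinearMap.fst ℂ ℂ (ℂ × ℂ)).comp
        (ContinuousLinearMap.snd ℂ ℂ (ℂ × ℂ × ℂ))) p • ((0, 1, 0) : ℂ × ℂ × (ℂ × ℂ)) =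
        (p.1, 0, p.2.2) := by
      ext <;> simp
    rw [e, hk, sub_zero] at hp
    exact hp
  have k := eventually_comp_zero (k := fun p : ℂ × ℂ × (ℂ × ℂ) => p.2) (by fun_prop) rfl h2
  have k2 := eventually_comp_zero (k := fun p : ℂ × ℂ × (ℂ × ℂ) => ((0, p.2) : ℂ × ℂ × (ℂ × ℂ)))
    (by fun_prop) rfl g1
  refine ⟨h, ha, ?_⟩
  filter_upwards [g1, hh, k, k2] with p hp hp' hk hk2
  have e : p - ContinuousLinearMap.fst ℂ ℂ (ℂ × ℂ × ℂ) p • ((1, 0, 0) : ℂ × ℂ × (ℂ × ℂ)) =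
      (0, p.2) := by
    ext <;> simp
  rw [e] at hp'
  have e2 : p.2.1 • g (0, p.2) = 0 := by
    rw [← hk2]
    exact hk
  have e3 : p.2.1 • (g p - g (0, p.2)) = p.2.1 • (p.1 • h p) := congrArg (p.2.1 • ·) hp'
  rw [smul_sub, e2, sub_zero, ← hp, smul_smul, mul_comm] at e3
  exact e3

/-- The coordinates on the source of a graph over `(z, u)`, complexified along `ζ = z̄`. -/
def polarize : ℂ × (ℝ × ℝ) →L[ℝ] ℂ × ℂ × (ℂ × ℂ) :=
  (ContinuousLinearMap.fst ℝ ℂ (ℝ × ℝ)).prod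
    ((Complex.conjCLE.toContinuousLinearMap.comp (ContinuousLinearMap.fst ℝ ℂ (ℝ × ℝ))).prod
      ((Complex.ofRealCLM.prodMap Complex.ofRealCLM).comp (ContinuousLinearMap.snd ℝ ℂ (ℝ × ℝ))))

/-- The point of `ℝ²` formed by the real parts of `w₁` and `w₂`. -/
def reW : ℂ × ℂ →L[ℝ] ℝ × ℝ := Complex.reCLM.prodMap Complex.reCLM

/-- The point of `ℝ²` formed by the imaginary parts of `w₁` and `w₂`. -/
def imW : ℂ × ℂ →L[ℝ] ℝ × ℝ := Complex.imCLM.prodMap Complex.imCLM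

theorem reW_apply (w : ℂ × ℂ) : reW w = (w.1.re, w.2.re) := rfl

theorem imW_apply (w : ℂ × ℂ) : imW w = (w.1.im, w.2.im) := rfl

/-- A generic submanifold is, in suitable holomorphic coordinates, a graph
`v = z z̄ ψ(z, z̄, u)`. -/
theorem exists_graph_chart {M : Set C3} (h0 : (0 : C3) ∈ M) (hM : IsAnalyticSubmanifold4 M)
    (hG : IsCRGeneric M) :
    ∃ F : C3 → C3, AnalyticAt ℂ F 0 ∧ F 0 = 0 ∧
      (∃ e : C3 ≃L[ℂ] C3, HasFDerivAt F (e : C3 →L[ℂ] C3) 0) ∧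
      ∃ ψ : ℂ × (ℝ × ℝ) → ℝ × ℝ, AnalyticAt ℝ ψ 0 ∧
        ∀ᶠ q in 𝓝 (0 : C3), F q ∈ M ↔
          imW q.2 = Complex.normSq q.1 • ψ (q.1, reW q.2) := by
  obtain ⟨e, ρ, ρa, hρ, dρ⟩ := exists_linear_coordinates h0 hM hG
  obtain ⟨R, Ra, Rρ, Rσ⟩ := exists_complexification_of_defining ρa
  have hρ0 : ρ 0 = 0 := hρ.self_of_nhds.1 (by rwa [map_zero])
  have R0 : R 0 = 0 := by
    have := Rρ.self_of_nhds
    rw [star_zero, hρ0] at this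
    exact this.trans (by simp)
  obtain ⟨G, Ga, G0, G', Φ, Φa, Φ1, Φ2, Φr, hΦ⟩ := exists_normal_coordinates Ra R0
    (fderiv_complexification ρa dρ Ra Rρ) Rσ
  obtain ⟨h, ha, hh⟩ := exists_factorization Φa Φ1 Φ2
  have kGd : HasFDerivAt (fun q : C3 => ((q.1, G q) : C3)) (ContinuousLinearMap.id ℂ C3) 0 := by
    have h1 : fderiv ℂ G 0 = ContinuousLinearMap.snd ℂ ℂ (ℂ × ℂ) :=
      ContinuousLinearMap.ext G'
    have h2 := Ga.differentiableAt.hasFDerivAt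
    rw [h1] at h2
    exact hasFDerivAt_fst.prodMk h2
  have kG0 : ((0, G 0) : C3) = 0 := by rw [G0]; rfl
  -- `Φ` is real where `ζ = z̄` and `u` is real, and so is `z z̄`; only the real part of the
  -- cofactor `h` matters there.
  refine ⟨fun q => e (q.1, G q), ?_, ?_, ⟨e, ?_⟩, fun x => reW (h (polarize x)), ?_, ?_⟩
  · exact ((e : C3 →L[ℂ] C3).analyticAt _).comp (analyticAt_fst.prod Ga)
  · change e (0, G 0) = 0
    rw [kG0, map_zero]
  · exact (e : C3 →L[ℂ] C3).hasFDerivAt.comp (0 : C3) kGd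
  · refine (reW.analyticAt _).comp ?_
    have : AnalyticAt ℝ h (polarize 0) := by
      rw [map_zero]; exact ha.restrictScalars
    exact this.comp (polarize.analyticAt 0)
  have t1 : ∀ᶠ q in 𝓝 (0 : C3), e (q.1, G q) ∈ M ↔ ρ (q.1, G q) = 0 :=
    eventually_comp_zero (k := fun q : C3 => ((q.1, G q) : C3))
      (continuousAt_fst.prodMk Ga.continuousAt) kG0 hρ
  have t2 := eventually_comp_zero (k := fun q : C3 => ((q.1, G q) : C3))
      (continuousAt_fst.prodMk Ga.continuousAt) kG0 Rρ
  let cW : ℝ × ℝ →L[ℝ] ℂ × ℂ := Complex.ofRealCLM.prodMap Complex.ofRealCLM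
  have cWv : ∀ u, cW u = ((u.1 : ℂ), (u.2 : ℂ)) := fun _ => rfl
  have cWs : ∀ u, star (cW u) = cW u := fun u => by
    rw [cWv]
    exact Prod.ext (Complex.conj_ofReal _) (Complex.conj_ofReal _)
  let kx : C3 →L[ℝ] ℂ × (ℝ × ℝ) := (ContinuousLinearMap.fst ℝ ℂ (ℂ × ℂ)).prod
    (reW.comp (ContinuousLinearMap.snd ℝ ℂ (ℂ × ℂ)))
  have t3 := eventually_comp_zero (k := fun q : C3 => polarize (kx q)) (by fun_prop)
    (by rw [map_zero, map_zero]) hh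
  let kv : C3 →L[ℝ] (ℂ × (ℂ × ℂ)) × (ℂ × ℂ) := ((ContinuousLinearMap.fst ℝ ℂ (ℂ × ℂ)).prod
    ((cW.comp reW).comp (ContinuousLinearMap.snd ℝ ℂ (ℂ × ℂ)))).prod
      ((cW.comp imW).comp (ContinuousLinearMap.snd ℝ ℂ (ℂ × ℂ)))
  have t4 := eventually_comp_zero (k := kv) (by fun_prop) (map_zero kv) hΦ
  have t5 := eventually_comp_zero (k := fun q : C3 => (kv q).1) (by fun_prop)
    (by rw [map_zero]; rfl) Φr
  filter_upwards [t1, t2, t3, t4, t5] with q q1 q2 q3 q4 q5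
  have ew : cW (reW q.2) + Complex.I • cW (imW q.2) = q.2 := by
    refine Prod.ext ?_ ?_
    · change (q.2.1.re : ℂ) + Complex.I * (q.2.1.im : ℂ) = q.2.1
      rw [mul_comm]; exact Complex.re_add_im _
    · change (q.2.2.re : ℂ) + Complex.I * (q.2.2.im : ℂ) = q.2.2
      rw [mul_comm]; exact Complex.re_add_im _
  change star (cW (reW q.2)) = cW (reW q.2) → star (cW (imW q.2)) = cW (imW q.2) →
    (R ((q.1, G (q.1, cW (reW q.2) + Complex.I • cW (imW q.2))),
      star ((q.1, G (q.1, cW (reW q.2) + Complex.I • cW (imW q.2))) : C3)) = 0 ↔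
      cW (imW q.2) = Φ (q.1, star q.1, cW (reW q.2))) at q4
  have q4' := q4 (cWs _) (cWs _)
  have q5' : star (Φ (q.1, star q.1, cW (reW q.2))) = Φ (q.1, star q.1, cW (reW q.2)) :=
    q5 (cWs _)
  have q3' : Φ (q.1, star q.1, cW (reW q.2)) =
      (q.1 * star q.1) • h (q.1, star q.1, cW (reW q.2)) := q3
  rw [ew, Prod.mk.eta] at q4'
  rw [q1]
  have s1 : ρ (q.1, G q) = 0 ↔ R ((q.1, G q), star ((q.1, G q) : C3)) = 0 := by
    rw [q2]
    simp [Prod.ext_iff]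
  rw [s1, q4']
  have n : q.1 * star q.1 = (Complex.normSq q.1 : ℂ) := Complex.mul_conj _
  rw [n] at q3'
  change _ ↔ imW q.2 = Complex.normSq q.1 • reW (h (q.1, star q.1, cW (reW q.2)))
  generalize Φ (q.1, star q.1, cW (reW q.2)) = P at *
  generalize h (q.1, star q.1, cW (reW q.2)) = H at *
  have hre : Complex.normSq q.1 • reW H = reW P := by
    rw [q3']
    refine Prod.ext ?_ ?_
    · change _ = ((Complex.normSq q.1 : ℂ) * H.1).re
      rw [Complex.re_ofReal_mul]; rfl
    · change _ = ((Complex.normSq q.1 : ℂ) * H.2).re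
      rw [Complex.re_ofReal_mul]; rfl
  have hP : cW (reW P) = P :=
    Prod.ext (Complex.conj_eq_iff_re.1 (congrArg Prod.fst q5'))
      (Complex.conj_eq_iff_re.1 (congrArg Prod.snd q5'))
  rw [hre]
  constructor
  · intro h'
    rw [← h']
    rfl
  · intro h'
    rw [h', hP]

end GraphChart

/-! ### The holomorphic tangent space of a graph -/

section HolomorphicTangent

/-- The inclusion `ℝ² → ℂ²`. -/
def ofRealW : ℝ × ℝ →L[ℝ] ℂ × ℂ := Complex.ofRealCLM.prodMap Complex.ofRealCLM

theorem ofRealW_apply (u : ℝ × ℝ) : ofRealW u = ((u.1 : ℂ), (u.2 : ℂ)) := rfl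

theorem ofRealW_reW_add (w : ℂ × ℂ) : ofRealW (reW w) + Complex.I • ofRealW (imW w) = w := by
  refine Prod.ext ?_ ?_ <;> apply Complex.ext <;> simp [ofRealW_apply, reW_apply, imW_apply]

theorem reW_I_smul (w : ℂ × ℂ) : reW (Complex.I • w) = -imW w := by
  simp [reW_apply, imW_apply]

theorem imW_I_smul (w : ℂ × ℂ) : imW (Complex.I • w) = reW w := by
  simp [reW_apply, imW_apply]

/-- The complexification of a real-linear endomorphism of `ℝ²`. -/
def complexifyW (g : ℝ × ℝ →L[ℝ] ℝ × ℝ) : ℂ × ℂ →L[ℝ] ℂ × ℂ :=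
  ofRealW.comp (g.comp reW) + Complex.I • ofRealW.comp (g.comp imW)

theorem complexifyW_apply (g : ℝ × ℝ →L[ℝ] ℝ × ℝ) (w : ℂ × ℂ) :
    complexifyW g w = ofRealW (g (reW w)) + Complex.I • ofRealW (g (imW w)) := rfl

/-- Complex linearity is what permits the factor `z̄` to be taken out of the tangent component `z̄
C`. -/
theorem complexifyW_smul (g : ℝ × ℝ →L[ℝ] ℝ × ℝ) (c : ℂ) (w : ℂ × ℂ) :
    complexifyW g (c • w) = c • complexifyW g w := by
  have hI : complexifyW g (Complex.I • w) = Complex.I • complexifyW g w := by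
    rw [complexifyW_apply, complexifyW_apply, reW_I_smul, imW_I_smul, map_neg, map_neg, smul_add,
      smul_smul, Complex.I_mul_I, neg_one_smul, add_comm]
  have hc : ∀ x : ℂ × ℂ, c • x = c.re • x + c.im • (Complex.I • x) := fun x => by
    conv_lhs => rw [← Complex.re_add_im c]
    rw [add_smul, mul_smul]
    simp only [Complex.coe_smul]
  rw [hc, hc, map_add, map_smul, map_smul, hI]

/-- The map whose zero set is the graph `v = z z̄ ψ(z, u)`. -/
def graphDefining (ψ : ℂ × (ℝ × ℝ) → ℝ × ℝ) (q : C3) : ℝ × ℝ :=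
  imW q.2 - Complex.normSq q.1 • ψ (q.1, reW q.2)

/-- The projection `(z, w) ↦ (z, Re w)`. -/
def graphBase : C3 →L[ℝ] ℂ × (ℝ × ℝ) :=
  (ContinuousLinearMap.fst ℝ ℂ (ℂ × ℂ)).prod (reW.comp (ContinuousLinearMap.snd ℝ ℂ (ℂ × ℂ)))

theorem graphBase_apply (q : C3) : graphBase q = (q.1, reW q.2) := rfl

theorem analyticAt_normSq_fst (q : C3) : AnalyticAt ℝ (fun q : C3 => Complex.normSq q.1) q := by
  have h1 : AnalyticAt ℝ (fun q : C3 => q.1.re) q :=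
    (Complex.reCLM.comp (ContinuousLinearMap.fst ℝ ℂ (ℂ × ℂ))).analyticAt q
  have h2 : AnalyticAt ℝ (fun q : C3 => q.1.im) q :=
    (Complex.imCLM.comp (ContinuousLinearMap.fst ℝ ℂ (ℂ × ℂ))).analyticAt q
  exact (h1.fun_mul h1).fun_add (h2.fun_mul h2)

theorem hasFDerivAt_normSq_fst (q : C3) : HasFDerivAt (fun q : C3 => Complex.normSq q.1)
    ((2 * q.1.re) • Complex.reCLM.comp (ContinuousLinearMap.fst ℝ ℂ (ℂ × ℂ)) +
      (2 * q.1.im) • Complex.imCLM.comp (ContinuousLinearMap.fst ℝ ℂ (ℂ × ℂ))) q := by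
  have h1 : HasFDerivAt (fun q : C3 => q.1.re) _ q :=
    (Complex.reCLM.comp (ContinuousLinearMap.fst ℝ ℂ (ℂ × ℂ))).hasFDerivAt
  have h2 : HasFDerivAt (fun q : C3 => q.1.im) _ q :=
    (Complex.imCLM.comp (ContinuousLinearMap.fst ℝ ℂ (ℂ × ℂ))).hasFDerivAt
  have h := (h1.mul h1).add (h2.mul h2)
  refine h.congr_fderiv (ContinuousLinearMap.ext fun v => ?_)
  simp
  ring

variable {ψ : ℂ × (ℝ × ℝ) → ℝ × ℝ}

theorem analyticAt_graphDefining {q : C3} (hψ : AnalyticAt ℝ ψ (graphBase q)) :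
    AnalyticAt ℝ (graphDefining ψ) q := by
  have h1 : AnalyticAt ℝ (fun q : C3 => imW q.2) q :=
    (imW.comp (ContinuousLinearMap.snd ℝ ℂ (ℂ × ℂ))).analyticAt q
  have h2 : AnalyticAt ℝ (fun q : C3 => ψ (graphBase q)) q := hψ.comp (graphBase.analyticAt q)
  exact h1.fun_sub ((analyticAt_normSq_fst q).fun_smul h2)

theorem fderiv_graphDefining {q : C3} (hψ : DifferentiableAt ℝ ψ (graphBase q)) (v : C3) :
    fderiv ℝ (graphDefining ψ) q v = imW v.2 - (Complex.normSq q.1 •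
      fderiv ℝ ψ (graphBase q) (v.1, reW v.2) +
        (2 * (q.1.re * v.1.re + q.1.im * v.1.im)) • ψ (graphBase q)) := by
  have h1 : HasFDerivAt (fun q : C3 => imW q.2) _ q :=
    (imW.comp (ContinuousLinearMap.snd ℝ ℂ (ℂ × ℂ))).hasFDerivAt
  have h2 : HasFDerivAt (fun q : C3 => ψ (graphBase q)) _ q :=
    hψ.hasFDerivAt.comp q graphBase.hasFDerivAt
  have h : fderiv ℝ (graphDefining ψ) q = _ :=
    (h1.sub ((hasFDerivAt_normSq_fst q).smul h2)).fderiv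
  rw [h]
  change imW v.2 - (Complex.normSq q.1 • fderiv ℝ ψ (graphBase q) (v.1, reW v.2) +
    ((2 * q.1.re) * v.1.re + (2 * q.1.im) * v.1.im) • ψ (graphBase q)) = _
  congr 3
  ring

/-- The differential of `ψ` in the direction of `∂/∂x - √-1 ∂/∂y`, where `z = x + √-1 y`. -/
def holDeriv (D : ℂ × (ℝ × ℝ) →L[ℝ] ℝ × ℝ) : ℂ × ℂ :=
  ofRealW (D (1, 0)) - Complex.I • ofRealW (D (Complex.I, 0))

/-- Tangency of `(1, A)` prescribes `Im A` and tangency of `√-1 (1, A)` prescribes `Re A`; `hA` is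
these two real equations joined into a complex one, with `y` and `D` in the roles of `ψ` and its
differential. -/
theorem graph_tangent_equations {D : ℂ × (ℝ × ℝ) →L[ℝ] ℝ × ℝ} {z : ℂ} {y : ℝ × ℝ} {A : ℂ × ℂ}
    (hA : A = (2 * Complex.I * star z) • ofRealW y + (Complex.I * Complex.normSq z) •
      (holDeriv D + complexifyW (D.comp (ContinuousLinearMap.inr ℝ ℂ (ℝ × ℝ))) A)) :
    (imW A - (Complex.normSq z • D (1, reW A) + (2 * z.re) • y) = 0) ∧
      imW (Complex.I • A) - (Complex.normSq z • D (Complex.I, reW (Complex.I • A)) +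
        (2 * z.im) • y) = 0 := by
  have e1 : ∀ c : ℂ, ∀ u, D (c, u) = D (c, 0) + D (0, u) := fun c u => by
    rw [← map_add]; simp
  have e2 : D (0, -imW A) = -D (0, imW A) :=
    (congrArg D (Prod.ext neg_zero.symm rfl : ((0 : ℂ), -imW A) = -((0 : ℂ), imW A))).trans
      (map_neg D _)
  rw [complexifyW_apply, holDeriv] at hA
  change A = (2 * Complex.I * star z) • ofRealW y + (Complex.I * Complex.normSq z) •
      (ofRealW (D (1, 0)) - Complex.I • ofRealW (D (Complex.I, 0)) +
        (ofRealW (D (0, reW A)) + Complex.I • ofRealW (D (0, imW A)))) at hA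
  rw [reW_I_smul, imW_I_smul, e1 1, e1 Complex.I, e2]
  have hre := congrArg reW hA
  have him := congrArg imW hA
  generalize D (1, 0) = a at *
  generalize D (Complex.I, 0) = b at *
  generalize D (0, reW A) = c at *
  generalize D (0, imW A) = d at *
  rw [hre, him]
  constructor
  · refine Prod.ext ?_ ?_ <;> simp [imW_apply, ofRealW_apply] <;> ring
  · refine Prod.ext ?_ ?_ <;> simp [reW_apply, ofRealW_apply] <;> ring

/-- The homogeneous analogue, for `(0, w)` with `t = z z̄`. Near `0` the factor `t` is small and the
fixed-point equation forces `w = 0`, so holomorphic tangent vectors are determined by their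
`z`-component. -/
theorem eq_of_graph_tangent_equations {D : ℂ × (ℝ × ℝ) →L[ℝ] ℝ × ℝ} {t : ℝ} {w : ℂ × ℂ}
    (h1 : imW w - t • D (0, reW w) = 0) (h2 : imW (Complex.I • w) - t • D (0, reW (Complex.I • w)) = 0) :
    w = t • Complex.I • complexifyW (D.comp (ContinuousLinearMap.inr ℝ ℂ (ℝ × ℝ))) w := by
  rw [reW_I_smul, imW_I_smul] at h2
  have e2 : D (0, -imW w) = -D (0, imW w) :=
    (congrArg D (Prod.ext neg_zero.symm rfl : ((0 : ℂ), -imW w) = -((0 : ℂ), imW w))).trans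
      (map_neg D _)
  rw [e2] at h2
  rw [complexifyW_apply]
  change w = t • Complex.I • (ofRealW (D (0, reW w)) + Complex.I • ofRealW (D (0, imW w)))
  have h3 := ofRealW_reW_add w
  generalize D (0, reW w) = c at *
  generalize D (0, imW w) = d at *
  rw [← h3, sub_eq_zero.1 h1, sub_eq_zero.1 h2]
  refine Prod.ext ?_ ?_ <;> apply Complex.ext <;> simp [ofRealW_apply]

/-- Along the graph `v = z z̄ ψ(z, u)`, the vector fields `(1, z̄ C)` span the holomorphic tangent
space. -/
theorem exists_holomorphic_tangent (hψ : AnalyticAt ℝ ψ 0) :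
    ∃ C : C3 → ℂ × ℂ, AnalyticAt ℝ C 0 ∧ C 0 = (2 * Complex.I) • ofRealW (ψ 0) ∧
      (∀ v : ℂ, fderiv ℝ C 0 (v, 0) = (2 * Complex.I) • ofRealW (fderiv ℝ ψ 0 (v, 0)) +
        (Complex.I * v) • holDeriv (fderiv ℝ ψ 0)) ∧
      ∀ᶠ q in 𝓝 (0 : C3), fderiv ℝ (graphDefining ψ) q (1, star q.1 • C q) = 0 ∧
        fderiv ℝ (graphDefining ψ) q (Complex.I • (1, star q.1 • C q)) = 0 ∧
        ∀ w : ℂ × ℂ, fderiv ℝ (graphDefining ψ) q (0, w) = 0 →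
          fderiv ℝ (graphDefining ψ) q (Complex.I • (0, w)) = 0 → w = 0 := by
  have hψb : AnalyticAt ℝ ψ (graphBase 0) := by rwa [map_zero]
  let D : C3 → ℂ × (ℝ × ℝ) →L[ℝ] ℝ × ℝ := fun q => fderiv ℝ ψ (graphBase q)
  have aD : ContDiffAt ℝ ω D 0 :=
    (AnalyticAt.comp (f := graphBase) hψb.fderiv (graphBase.analyticAt 0)).contDiffAt
  have aψ : ContDiffAt ℝ ω (fun q => ψ (graphBase q)) 0 :=
    (hψb.comp (graphBase.analyticAt 0)).contDiffAt
  let Γ : C3 → ℂ × ℂ →L[ℝ] ℂ × ℂ := fun q =>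
    Complex.I • complexifyW ((D q).comp (ContinuousLinearMap.inr ℝ ℂ (ℝ × ℝ)))
  have aΓ : ContDiffAt ℝ ω Γ 0 := by
    have h1 : ContDiffAt ℝ ω (fun q => (D q).comp (ContinuousLinearMap.inr ℝ ℂ (ℝ × ℝ))) 0 :=
      aD.clm_comp contDiffAt_const
    have h2 : ContDiffAt ℝ ω
      (fun q => complexifyW ((D q).comp (ContinuousLinearMap.inr ℝ ℂ (ℝ × ℝ)))) 0 :=
      (contDiffAt_const.clm_comp (h1.clm_comp contDiffAt_const)).add
        ((contDiffAt_const.clm_comp (h1.clm_comp contDiffAt_const)).const_smul Complex.I)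
    exact h2.const_smul Complex.I
  have an : ContDiffAt ℝ ω (fun q : C3 => Complex.normSq q.1) 0 :=
    (analyticAt_normSq_fst 0).contDiffAt
  -- Substituting `A = z̄ C` into the tangency equation and cancelling `z̄` leaves `N C = Y`. Since
  -- `N` is the identity at `0`, it can be inverted analytically nearby.
  let N : C3 → ℂ × ℂ →L[ℝ] ℂ × ℂ := fun q => 1 - Complex.normSq q.1 • Γ q
  have aN : ContDiffAt ℝ ω N 0 := contDiffAt_const.sub (an.smul aΓ)
  have N0 : N 0 = ((1 : (ℂ × ℂ →L[ℝ] ℂ × ℂ)ˣ) : ℂ × ℂ →L[ℝ] ℂ × ℂ) := by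
    have : (0 : ℝ) • Γ 0 = 0 := zero_smul ℝ (Γ 0)
    simp [N, this]
  let Y : C3 → ℂ × ℂ := fun q => (2 * Complex.I) • ofRealW (ψ (graphBase q)) +
    (Complex.I * q.1) • holDeriv (D q)
  have aH : ContDiffAt ℝ ω (fun q => holDeriv (D q)) 0 :=
    (ofRealW.contDiff.contDiffAt.comp (0 : C3) (aD.clm_apply contDiffAt_const)).sub
      ((ofRealW.contDiff.contDiffAt.comp (0 : C3) (aD.clm_apply contDiffAt_const)).const_smul
        Complex.I)
  have aY : ContDiffAt ℝ ω Y 0 :=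
    ((ofRealW.contDiff.contDiffAt.comp (0 : C3) aψ).const_smul (2 * Complex.I)).add
      ((contDiffAt_const.mul contDiffAt_fst).smul aH)
  let C : C3 → ℂ × ℂ := fun q => Ring.inverse (N q) (Y q)
  have aI : ContDiffAt ℝ ω (fun q => Ring.inverse (N q)) 0 := by
    have h1 : AnalyticAt ℝ Ring.inverse (N 0) := by rw [N0]; exact analyticAt_inverse 1
    exact (h1.comp aN.analyticAt).contDiffAt
  have aC : ContDiffAt ℝ ω C 0 := aI.clm_apply aY
  have hU : ∀ᶠ q in 𝓝 (0 : C3), IsUnit (N q) := by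
    refine aN.continuousAt.eventually (Units.isOpen.mem_nhds ?_)
    rw [N0]
    exact Units.isUnit 1
  have hC : ∀ᶠ q in 𝓝 (0 : C3), C q = Y q + Complex.normSq q.1 • Γ q (C q) := by
    filter_upwards [hU] with q hq
    have h1 : (N q * Ring.inverse (N q)) (Y q) = Y q := by
      rw [Ring.mul_inverse_cancel _ hq]; rfl
    have h2 : C q - Complex.normSq q.1 • Γ q (C q) = Y q := h1
    rw [← h2]; abel
  refine ⟨C, aC.analyticAt, ?_, ?_, ?_⟩
  · rw [hC.self_of_nhds]
    simp [Y]
  · intro v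
    have h1 : HasFDerivAt (fun q => Γ q (C q)) _ 0 :=
      ((aΓ.clm_apply aC).differentiableAt (by simp)).hasFDerivAt
    have hD : HasFDerivAt ψ (fderiv ℝ ψ 0) (graphBase 0) := by
      rw [map_zero]; exact hψ.differentiableAt.hasFDerivAt
    have h2 : HasFDerivAt Y _ 0 :=
      ((ofRealW.hasFDerivAt.comp (0 : C3) (hD.comp (0 : C3) graphBase.hasFDerivAt)).const_smul
        (2 * Complex.I)).add
      ((hasFDerivAt_fst.const_mul Complex.I).smul (aH.differentiableAt (by simp)).hasFDerivAt)
    -- `z z̄` vanishes to second order at `0`, so `C` has the first derivative of `Y` there.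
    have h3 := h2.add ((hasFDerivAt_normSq_fst 0).smul h1)
    have h4 := h3.congr_of_eventuallyEq hC
    rw [h4.fderiv]
    simp [D, graphBase_apply, Prod.mk_zero_zero]
  · have hψe := (eventually_comp_zero (k := graphBase) graphBase.continuous.continuousAt
      (map_zero _) hψ.eventually_analyticAt)
    filter_upwards [hU, hC, hψe] with q hq hCq hψq
    have fd := fderiv_graphDefining hψq.differentiableAt
    have e := graph_tangent_equations (D := D q) (z := q.1) (y := ψ (graphBase q))
      (A := star q.1 • C q) ?_
    · refine ⟨?_, ?_, ?_⟩
      · rw [fd]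
        have := e.1
        simpa using this
      · rw [fd]
        have := e.2
        simpa using this
      · intro w h1 h2
        rw [fd] at h1 h2
        have h3 := eq_of_graph_tangent_equations (D := D q) (t := Complex.normSq q.1) (w := w)
          (by simpa using h1) (by simpa using h2)
        have h4 : N q w = 0 := sub_eq_zero.2 h3
        have h5 : (Ring.inverse (N q) * N q) w = 0 := by
          change Ring.inverse (N q) (N q w) = 0
          rw [h4, map_zero]
        rw [Ring.inverse_mul_cancel _ hq] at h5
        exact h5
    · conv_lhs => rw [hCq]
      rw [complexifyW_smul]
      change star q.1 • ((2 * Complex.I) • ofRealW (ψ (graphBase q)) +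
        (Complex.I * q.1) • holDeriv (D q) + Complex.normSq q.1 • Complex.I •
          complexifyW ((D q).comp (ContinuousLinearMap.inr ℝ ℂ (ℝ × ℝ))) (C q)) = _
      generalize complexifyW ((D q).comp (ContinuousLinearMap.inr ℝ ℂ (ℝ × ℝ))) (C q) = X
      have n : (Complex.normSq q.1 : ℂ) = q.1 * star q.1 := (Complex.mul_conj _).symm
      rw [← Complex.coe_smul, n]
      module

end HolomorphicTangent

/-! ### The frame condition in terms of `ψ` -/

section FrameCondition

theorem exists_local_inverse {F : C3 → C3} (hF : AnalyticAt ℂ F 0) (hF0 : F 0 = 0)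
    {e : C3 ≃L[ℂ] C3} (he : HasFDerivAt F (e : C3 →L[ℂ] C3) 0) :
    ∃ G : C3 → C3, AnalyticAt ℂ G 0 ∧ G 0 = 0 ∧ (∀ᶠ q in 𝓝 0, G (F q) = q) ∧
      ∀ᶠ x in 𝓝 0, F (G x) = x := by
  have hc : ContDiffAt ℂ ω F 0 := hF.contDiffAt
  have hs := hc.hasStrictFDerivAt' he (by simp)
  refine ⟨hc.localInverse he (by simp), ?_, ?_, hs.eventually_left_inverse, ?_⟩
  · have := (hc.to_localInverse he (by simp)).analyticAt
    rwa [hF0] at this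
  · have := hc.localInverse_apply_image he (by simp)
    rwa [hF0] at this
  · have := hs.eventually_right_inverse
    rwa [hF0] at this

theorem fderiv_real_I_smul {F : C3 → C3} {q : C3} (hF : AnalyticAt ℂ F q) (v : C3) :
    fderiv ℝ F q (Complex.I • v) = Complex.I • fderiv ℝ F q v := by
  rw [(hF.differentiableAt.hasFDerivAt.restrictScalars ℝ).fderiv]
  exact map_smul (fderiv ℂ F q) _ _

/-- The differentials of two maps inverse to each other. -/
structure IsInverseAt (F G : C3 → C3) (x : C3) : Prop where
  analyticAt_left : AnalyticAt ℝ F (G x)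
  analyticAt_right : AnalyticAt ℝ G x
  map_I_smul : ∀ v, fderiv ℝ F (G x) (Complex.I • v) = Complex.I • fderiv ℝ F (G x) v
  left_inv : ∀ v, fderiv ℝ G x (fderiv ℝ F (G x) v) = v
  right_inv : ∀ v, fderiv ℝ F (G x) (fderiv ℝ G x v) = v

theorem eventually_isInverseAt {F G : C3 → C3} (hF : AnalyticAt ℂ F 0) (hG : AnalyticAt ℂ G 0)
    (hG0 : G 0 = 0) (h1 : ∀ᶠ q in 𝓝 0, G (F q) = q) (h2 : ∀ᶠ x in 𝓝 0, F (G x) = x) :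
    ∀ᶠ x in 𝓝 0, IsInverseAt F G x := by
  filter_upwards [hG.eventually_analyticAt, h2.eventually_nhds,
    eventually_comp_zero hG.continuousAt hG0 hF.eventually_analyticAt,
    eventually_comp_zero hG.continuousAt hG0 h1.eventually_nhds] with x hGx h2x hFx h1x
  have dG : HasFDerivAt G (fderiv ℝ G x) x := hGx.restrictScalars.differentiableAt.hasFDerivAt
  have dF : HasFDerivAt F (fderiv ℝ F (G x)) (G x) :=
    hFx.restrictScalars.differentiableAt.hasFDerivAt
  have dG' : HasFDerivAt G (fderiv ℝ G x) (F (G x)) := by rwa [h2x.self_of_nhds]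
  refine ⟨hFx.restrictScalars, hGx.restrictScalars, fderiv_real_I_smul hFx, fun v => ?_,
    fun v => ?_⟩
  · have e1 := (dG'.comp (G x) dF).congr_of_eventuallyEq (h1x.mono fun q hq => hq.symm)
    exact DFunLike.congr_fun (e1.unique (hasFDerivAt_id (G x))) v
  · have e1 := (dF.comp x dG).congr_of_eventuallyEq (h2x.mono fun q hq => hq.symm)
    exact DFunLike.congr_fun (e1.unique (hasFDerivAt_id x)) v

/-- The vector field of type `(1,0)` which in the chart `F`, with inverse `G`, has the components
`(1, z̄ C)`. -/
def chartField (F G : C3 → C3) (C : C3 → ℂ × ℂ) : ComplexField where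
  re := fun x => (1 / 2 : ℝ) • fderiv ℝ F (G x) (1, star (G x).1 • C (G x))
  im := fun x => -(Complex.I • (1 / 2 : ℝ) • fderiv ℝ F (G x) (1, star (G x).1 • C (G x)))

variable {M : Set C3} {F G : C3 → C3} {C : C3 → ℂ × ℂ} {ψ : ℂ × (ℝ × ℝ) → ℝ × ℝ} {x : C3}

theorem IsInverseAt.isAnalyticAt_chartField (h : IsInverseAt F G x) (hC : AnalyticAt ℝ C (G x)) :
    (chartField F G C).IsAnalyticAt x := by
  have hG := h.analyticAt_right
  have h1 : AnalyticAt ℝ (fun x => fderiv ℝ F (G x)) x := h.analyticAt_left.fderiv.comp hG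
  have h2 : AnalyticAt ℝ (fun x => C (G x)) x := hC.comp hG
  have h3 : AnalyticAt ℝ (fun x => star (G x).1) x :=
    AnalyticAt.comp (g := Complex.conjCLE.toContinuousLinearMap.comp
      (ContinuousLinearMap.fst ℝ ℂ (ℂ × ℂ))) (ContinuousLinearMap.analyticAt _ _) hG
  have h4 : AnalyticAt ℝ (fun x => ((1, star (G x).1 • C (G x)) : C3)) x :=
    analyticAt_const.prod (h3.fun_smul h2)
  have h5 := (h1.clm_apply h4).fun_const_smul (c := (1 / 2 : ℝ))
  exact ⟨h5, (h5.fun_const_smul (c := Complex.I)).fun_neg⟩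

theorem IsInverseAt.deriv_chartField (h : IsInverseAt F G x) {φ : C3 → ℂ}
    (hφ : DifferentiableAt ℝ φ (G x)) :
    (chartField F G C).deriv (fun y => φ (G y)) x =
        1 / 2 * (fderiv ℝ φ (G x) (1, star (G x).1 • C (G x)) -
          Complex.I * fderiv ℝ φ (G x) (Complex.I • (1, star (G x).1 • C (G x)))) ∧
      (chartField F G C).conj.deriv (fun y => φ (G y)) x =
        1 / 2 * (fderiv ℝ φ (G x) (1, star (G x).1 • C (G x)) +
          Complex.I * fderiv ℝ φ (G x) (Complex.I • (1, star (G x).1 • C (G x)))) := by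
  have hd : fderiv ℝ (fun y => φ (G y)) x = (fderiv ℝ φ (G x)).comp (fderiv ℝ G x) :=
    (hφ.hasFDerivAt.comp x h.analyticAt_right.differentiableAt.hasFDerivAt).fderiv
  have e1 : fderiv ℝ G x (Complex.I • fderiv ℝ F (G x) (1, star (G x).1 • C (G x))) =
      Complex.I • (1, star (G x).1 • C (G x)) := by
    rw [← h.map_I_smul, h.left_inv]
  simp only [ComplexField.deriv, ComplexField.conj, chartField, hd,
    ContinuousLinearMap.comp_apply, map_neg, neg_neg]
  rw [smul_comm Complex.I (1 / 2 : ℝ)]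
  simp only [map_smul, e1, h.left_inv, Complex.real_smul]
  push_cast
  constructor <;> ring

/-- Near `0` the set `M` is the zero set of `graphDefining ψ ∘ G`, which is a submersion because the
vectors `(0, √-1 y)` with `y` real already map onto `ℝ²`. -/
theorem eventually_mem_tangentSpace_iff (hψ : AnalyticAt ℝ ψ 0) (hG : AnalyticAt ℂ G 0)
    (hG0 : G 0 = 0) (h2 : ∀ᶠ x in 𝓝 0, F (G x) = x) (hI : ∀ᶠ x in 𝓝 0, IsInverseAt F G x)
    (hM : ∀ᶠ q in 𝓝 (0 : C3), F q ∈ M ↔ imW q.2 = Complex.normSq q.1 • ψ (q.1, reW q.2)) :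
    ∀ᶠ x in 𝓝 0, x ∈ M → ∀ a, a ∈ tangentSpace M x ↔
      fderiv ℝ (graphDefining ψ) (G x) (fderiv ℝ G x a) = 0 := by
  have hψe := (eventually_comp_zero (k := graphBase) graphBase.continuous.continuousAt
    (map_zero _) hψ.eventually_analyticAt)
  have hM' : ∀ᶠ x in 𝓝 0, x ∈ M ↔ graphDefining ψ (G x) = 0 := by
    filter_upwards [h2, eventually_comp_zero hG.continuousAt hG0 hM] with x hx hMx
    rw [hx] at hMx
    rw [hMx, graphDefining, sub_eq_zero]
  filter_upwards [hI, hM'.eventually_nhds,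
    eventually_comp_zero hG.continuousAt hG0 hψe] with x hIx hMx hψx hxM a
  have hr := analyticAt_graphDefining hψx
  have hρ : AnalyticAt ℝ (fun y => graphDefining ψ (G y)) x := hr.comp hIx.analyticAt_right
  have hd : fderiv ℝ (fun y => graphDefining ψ (G y)) x =
      (fderiv ℝ (graphDefining ψ) (G x)).comp (fderiv ℝ G x) :=
    (hr.differentiableAt.hasFDerivAt.comp x
      hIx.analyticAt_right.differentiableAt.hasFDerivAt).fderiv
  rw [tangentSpace_eq_ker hMx hxM hρ.hasStrictFDerivAt, LinearMap.mem_ker, hd]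
  · rfl
  · intro y
    refine ⟨fderiv ℝ F (G x) (0, Complex.I • ofRealW y), ?_⟩
    rw [hd, ContinuousLinearMap.comp_apply, hIx.left_inv,
      fderiv_graphDefining hψx.differentiableAt]
    have e1 : reW (Complex.I • ofRealW y) = 0 := by simp [reW_apply, ofRealW_apply]
    have e2 : imW (Complex.I • ofRealW y) = y := by simp [imW_apply, ofRealW_apply]
    rw [e1, e2]
    simp [Prod.mk_zero_zero]

/-- In a chart in which `M` is a graph, a local generator of `T^{1,0}M` is `∂_z` corrected by a
field with components `z̄ C`. -/
theorem exists_isLocalGenerator_chartField (hψ : AnalyticAt ℝ ψ 0) (hG : AnalyticAt ℂ G 0)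
    (hG0 : G 0 = 0) (h2 : ∀ᶠ x in 𝓝 0, F (G x) = x) (hI : ∀ᶠ x in 𝓝 0, IsInverseAt F G x)
    (hM : ∀ᶠ q in 𝓝 (0 : C3), F q ∈ M ↔ imW q.2 = Complex.normSq q.1 • ψ (q.1, reW q.2))
    (hCa : AnalyticAt ℝ C 0)
    (hC : ∀ᶠ q in 𝓝 (0 : C3), fderiv ℝ (graphDefining ψ) q (1, star q.1 • C q) = 0 ∧
        fderiv ℝ (graphDefining ψ) q (Complex.I • (1, star q.1 • C q)) = 0 ∧
        ∀ w : ℂ × ℂ, fderiv ℝ (graphDefining ψ) q (0, w) = 0 →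
          fderiv ℝ (graphDefining ψ) q (Complex.I • (0, w)) = 0 → w = 0) :
    ∃ U : Set C3, IsOpen U ∧ (0 : C3) ∈ U ∧ IsLocalGenerator M U (chartField F G C) := by
  have key : ∀ᶠ x in 𝓝 0, (chartField F G C).IsAnalyticAt x ∧
      (x ∈ M → Submodule.span ℂ {(chartField F G C).value x} = T10 M x) := by
    filter_upwards [hI, eventually_mem_tangentSpace_iff hψ hG hG0 h2 hI hM,
      eventually_comp_zero hG.continuousAt hG0 hCa.eventually_analyticAt,
      eventually_comp_zero hG.continuousAt hG0 hC] with x hIx hTx hCax hCx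
    refine ⟨hIx.isAnalyticAt_chartField hCax, fun hxM => ?_⟩
    obtain ⟨c1, c2, c3⟩ := hCx
    have hT := hTx hxM
    set L := chartField F G C
    have him : L.im x = -(Complex.I • L.re x) := rfl
    have hre : L.re x = (1 / 2 : ℝ) • fderiv ℝ F (G x) (1, star (G x).1 • C (G x)) := rfl
    have m1 : L.re x ∈ tangentSpace M x := by
      rw [hT, hre, map_smul, hIx.left_inv, map_smul, c1, smul_zero]
    have m2 : Complex.I • L.re x ∈ tangentSpace M x := by
      rw [hT, hre, smul_comm, ← hIx.map_I_smul, map_smul, hIx.left_inv, map_smul, c2, smul_zero]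
    apply le_antisymm
    · rw [Submodule.span_singleton_le_iff_mem, mem_T10_iff, L.tensorRe_value, L.tensorIm_value]
      refine ⟨m1, ?_, him⟩
      rw [him]
      exact Submodule.neg_mem _ m2
    · intro v hv
      rw [mem_T10_iff] at hv
      obtain ⟨v1, v2, v3⟩ := hv
      have v2' : Complex.I • tensorRe v ∈ tangentSpace M x := by
        rw [v3] at v2
        simpa using Submodule.neg_mem _ v2
      set b := fderiv ℝ G x (tensorRe v) with hb
      have hFb : fderiv ℝ F (G x) b = tensorRe v := hIx.right_inv _
      have hIb : fderiv ℝ G x (Complex.I • tensorRe v) = Complex.I • b := by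
        rw [← hFb, ← hIx.map_I_smul, hIx.left_inv]
      rw [hT] at v1 v2'
      rw [hIb] at v2'
      have hc : ∀ (c : ℂ) (y : C3), c • y = c.re • y + c.im • (Complex.I • y) := fun c y => by
        conv_lhs => rw [← Complex.re_add_im c]
        rw [add_smul, mul_smul]
        simp only [Complex.coe_smul]
      set k : C3 := (1, star (G x).1 • C (G x)) with hk
      have z : ∀ c : ℂ, fderiv ℝ (graphDefining ψ) (G x) (c • k) = 0 := fun c => by
        rw [hc, map_add, map_smul, map_smul, c1, c2, smul_zero, smul_zero, add_zero]
      -- Subtracting the multiple of `k` with the same `z`-component leaves a vertical holomorphic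
      -- tangent vector, which is zero by `c3`.
      have hbk : b - b.1 • k = (0, b.2 - b.1 • k.2) := by
        refine Prod.ext ?_ rfl
        simp [hk]
      have hw := c3 (b.2 - b.1 • k.2) (by rw [← hbk, map_sub, v1, z, sub_zero])
        (by rw [← hbk, smul_sub, map_sub, v2', smul_smul, z, sub_zero])
      rw [hw] at hbk
      have hbk' : b = b.1 • k := sub_eq_zero.1 hbk
      have hFc : ∀ (c : ℂ), fderiv ℝ F (G x) (c • k) = c • fderiv ℝ F (G x) k := fun c => by
        rw [hc, map_add, map_smul, map_smul, hIx.map_I_smul, ← hc]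
      have hre2 : tensorRe v = (2 * b.1) • L.re x := by
        rw [← hFb, hbk', hFc, hre, ← Complex.coe_smul, smul_smul]
        congr 1
        have : (b.1 • k).1 = b.1 := by rw [← hbk']
        rw [this]
        push_cast
        ring
      rw [Submodule.mem_span_singleton]
      refine ⟨2 * b.1, ?_⟩
      generalize 2 * b.1 = d at hre2
      apply tensor_ext
      · rw [tensorRe_smul, L.tensorRe_value, L.tensorIm_value, him, hre2, hc d, smul_neg,
          sub_neg_eq_add]
      · rw [tensorIm_smul, L.tensorRe_value, L.tensorIm_value, him, v3, hre2, hc d]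
        simp only [smul_add, smul_neg, neg_add]
        rw [smul_comm Complex.I d.re, smul_comm Complex.I d.im, smul_smul Complex.I Complex.I,
          Complex.I_mul_I]
        simp
  obtain ⟨U, hU, hUo, h0U⟩ := eventually_nhds_iff.1 key
  exact ⟨U, hUo, h0U, fun y hy => (hU y hy).1.1, fun y hy => (hU y hy).1.2,
    fun y hy => (hU y hy.2).2 hy.1⟩

/-- The frame condition of the general class II, in terms of the graphing function. -/
theorem det_ne_zero_of_isFrameAt (h0 : (0 : C3) ∈ M)
    (hII : ∀ (U : Set C3) (L : ComplexField), IsOpen U → IsLocalGenerator M U L →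
      ∀ p ∈ M ∩ U, IsFrameAt M L p)
    (hF : AnalyticAt ℂ F 0) (hF0 : F 0 = 0) {e : C3 ≃L[ℂ] C3}
    (he : HasFDerivAt F (e : C3 →L[ℂ] C3) 0) (hψ : AnalyticAt ℝ ψ 0)
    (hM : ∀ᶠ q in 𝓝 (0 : C3), F q ∈ M ↔ imW q.2 = Complex.normSq q.1 • ψ (q.1, reW q.2)) :
    ((ψ 0).1 : ℂ) * (holDeriv (fderiv ℝ ψ 0)).2 - ((ψ 0).2 : ℂ) * (holDeriv (fderiv ℝ ψ 0)).1 ≠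
      0 := by
  intro hdet
  -- A vanishing determinant yields a covector annihilating both `ψ(0)` and `H`.
  obtain ⟨c, hc0, hcψ, hcH⟩ : ∃ c : ℂ × ℂ, c ≠ 0 ∧
      c.1 * ((ψ 0).1 : ℂ) + c.2 * ((ψ 0).2 : ℂ) = 0 ∧
      c.1 * (holDeriv (fderiv ℝ ψ 0)).1 + c.2 * (holDeriv (fderiv ℝ ψ 0)).2 = 0 := by
    generalize ((ψ 0).1 : ℂ) = a₁ at *
    generalize ((ψ 0).2 : ℂ) = a₂ at *
    generalize holDeriv (fderiv ℝ ψ 0) = b at *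
    by_cases ha : a₁ = 0 ∧ a₂ = 0
    · obtain ⟨rfl, rfl⟩ := ha
      by_cases hb : b = 0
      · exact ⟨(1, 0), by simp, by simp, by simp [hb]⟩
      · refine ⟨(b.2, -b.1), fun h => hb ?_, by simp, by simp; ring⟩
        rw [Prod.mk_eq_zero, neg_eq_zero] at h
        exact Prod.ext h.2 h.1
    · refine ⟨(a₂, -a₁), fun h => ha ?_, by simp; ring, by simp; linear_combination -hdet⟩
      rw [Prod.mk_eq_zero, neg_eq_zero] at h
      exact ⟨h.2, h.1⟩
  obtain ⟨G, hG, hG0, hGF, hFG⟩ := exists_local_inverse hF hF0 he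
  have hI := eventually_isInverseAt hF hG hG0 hGF hFG
  obtain ⟨C, hCa, hC0, hCd, hC⟩ := exists_holomorphic_tangent hψ
  obtain ⟨U, hU, h0U, hL⟩ := exists_isLocalGenerator_chartField hψ hG hG0 hFG hI hM hCa hC
  have hframe := hII U _ hU hL 0 ⟨h0, h0U⟩
  set L := chartField F G C with hLdef
  -- the functions `f = m (w)`, `z` and `B = m (C)` in the chart, with `m` conjugate-linear
  let m : ℂ × ℂ →L[ℝ] ℂ :=
    (ContinuousLinearMap.mul ℝ ℂ c.1).comp
      (Complex.conjCLE.toContinuousLinearMap.comp (ContinuousLinearMap.fst ℝ ℂ ℂ)) +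
    (ContinuousLinearMap.mul ℝ ℂ c.2).comp
      (Complex.conjCLE.toContinuousLinearMap.comp (ContinuousLinearMap.snd ℝ ℂ ℂ))
  have hm : ∀ w, m w = c.1 * star w.1 + c.2 * star w.2 := fun _ => rfl
  have hmc : ∀ (d : ℂ) w, m (d • w) = star d * m w := fun d w => by
    rw [hm, hm]
    simp only [Prod.smul_fst, Prod.smul_snd, smul_eq_mul, star_mul']
    ring
  have hmr : ∀ u : ℝ × ℝ, m (ofRealW u) = c.1 * (u.1 : ℂ) + c.2 * (u.2 : ℂ) := fun u => by
    simp [hm, ofRealW_apply]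
  have starI : star Complex.I = -Complex.I := by simp
  let mw : C3 →L[ℝ] ℂ := m.comp (ContinuousLinearMap.snd ℝ ℂ (ℂ × ℂ))
  let pz : C3 →L[ℝ] ℂ := ContinuousLinearMap.fst ℝ ℂ (ℂ × ℂ)
  let f : C3 → ℂ := fun x => mw (G x)
  let Z : C3 → ℂ := fun x => pz (G x)
  let B : C3 → ℂ := fun x => m (C (G x))
  have good : ∀ᶠ x in 𝓝 (0 : C3), (L.IsAnalyticAt x ∧ AnalyticAt ℝ f x ∧ AnalyticAt ℝ Z x ∧
      AnalyticAt ℝ B x) ∧ L.deriv Z x = 1 ∧ L.deriv f x = 0 ∧ L.conj.deriv f x = Z x * B x := by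
    filter_upwards [hI, eventually_comp_zero hG.continuousAt hG0 hCa.eventually_analyticAt]
      with x hIx hCx
    have hGx := hIx.analyticAt_right
    refine ⟨⟨hIx.isAnalyticAt_chartField hCx, (mw.analyticAt _).comp hGx, (pz.analyticAt _).comp hGx,
      (m.analyticAt _).comp (hCx.comp hGx)⟩, ?_, ?_, ?_⟩
    · rw [(hIx.deriv_chartField pz.differentiableAt).1, pz.fderiv]
      change 1 / 2 * ((1 : ℂ) - Complex.I * (Complex.I * 1)) = 1
      linear_combination (-1 / 2 : ℂ) * Complex.I_mul_I
    · rw [(hIx.deriv_chartField mw.differentiableAt).1, mw.fderiv]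
      change 1 / 2 * (m (star (G x).1 • C (G x)) -
        Complex.I * m (Complex.I • star (G x).1 • C (G x))) = 0
      rw [hmc Complex.I, starI]
      linear_combination (1 / 2 : ℂ) * m (star (G x).1 • C (G x)) * Complex.I_mul_I
    · rw [(hIx.deriv_chartField mw.differentiableAt).2, mw.fderiv]
      change 1 / 2 * (m (star (G x).1 • C (G x)) +
        Complex.I * m (Complex.I • star (G x).1 • C (G x))) = (G x).1 * m (C (G x))
      rw [hmc Complex.I, starI, hmc, star_star]
      linear_combination (-1 / 2 : ℂ) * (G x).1 * m (C (G x)) * Complex.I_mul_I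
  have good0 := good.self_of_nhds
  obtain ⟨⟨aL, af, aZ, aB⟩, LZ, Lf, Lbf⟩ := good0
  have hZ0 : Z 0 = 0 := by
    change (G 0).1 = 0
    rw [hG0]; rfl
  have hB0 : B 0 = 0 := by
    change m (C (G 0)) = 0
    rw [hG0, hC0, hmc, hmr, hcψ, mul_zero]
  -- The two contributions of `holDeriv` to the derivative of `C` cancel because `m` is
  -- conjugate-linear; what is left is `-√-1 (c₁ H₁ + c₂ H₂)`.
  have hLB : L.deriv B 0 = 0 := by
    have hCd' : HasFDerivAt (fun q => m (C q)) (m.comp (fderiv ℝ C 0)) (G 0) := by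
      rw [hG0]
      exact m.hasFDerivAt.comp (0 : C3) hCa.differentiableAt.hasFDerivAt
    have h1 := (hI.self_of_nhds.deriv_chartField (C := C) hCd'.differentiableAt).1
    have e1 : ((1, star (G 0).1 • C (G 0)) : C3) = (1, 0) := by simp [hG0]
    have e2 : Complex.I • ((1, 0) : C3) = (Complex.I, 0) := by simp
    rw [hCd'.fderiv, e1, e2, ContinuousLinearMap.comp_apply, ContinuousLinearMap.comp_apply,
      hCd, hCd, map_add, map_add, hmc, hmc, hmc, hmc] at h1
    have hmH : m (holDeriv (fderiv ℝ ψ 0)) = m (ofRealW (fderiv ℝ ψ 0 (1, 0))) +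
        Complex.I * m (ofRealW (fderiv ℝ ψ 0 (Complex.I, 0))) := by
      rw [holDeriv, map_sub, hmc, starI]
      ring
    have hcH' : m (ofRealW (fderiv ℝ ψ 0 (1, 0))) -
        Complex.I * m (ofRealW (fderiv ℝ ψ 0 (Complex.I, 0))) = 0 := by
      rw [hmr, hmr, ← hcH, holDeriv]
      simp only [ofRealW_apply, Prod.fst_sub, Prod.snd_sub, Prod.smul_fst, Prod.smul_snd,
        smul_eq_mul]
      ring
    rw [hmH] at h1
    refine h1.trans ?_
    simp only [star_mul', starI, star_one, star_ofNat]
    generalize m (ofRealW (fderiv ℝ ψ 0 (1, 0))) = d₁ at *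
    generalize m (ofRealW (fderiv ℝ ψ 0 (Complex.I, 0))) = d₂ at *
    have hI3 : Complex.I ^ 2 = -1 := Complex.I_sq
    have : d₁ = Complex.I * d₂ := sub_eq_zero.1 hcH'
    rw [this]
    ring_nf
    have hI4 : Complex.I ^ 4 = 1 := Complex.I_pow_four
    rw [hI4, hI3]
    ring
  let T := L.bracket L.conj
  have aT : T.IsAnalyticAt 0 := aL.bracket aL.conj
  -- As `L f = 0` and `L̄ f = Z B` near `0`, the bracket gives `T f = L (Z B)` with `L Z = 1`. At
  -- `0`, where `Z = 0`, this is `B`, and the next bracket gives `2 L B`.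
  let k : C3 → ℂ := fun x => Z x * L.deriv B x + B x * 1
  have hT : ∀ᶠ x in 𝓝 0, T.deriv f x = k x := by
    filter_upwards [good.eventually_nhds] with x hx
    obtain ⟨⟨aLx, afx, aZx, aBx⟩, LZx, -, -⟩ := hx.self_of_nhds
    have e1 : L.deriv (L.conj.deriv f) x = L.deriv (fun y => Z y * B y) x :=
      ComplexField.deriv_congr (hx.mono fun y hy => hy.2.2.2)
    have e2 : L.conj.deriv (L.deriv f) x = L.conj.deriv (fun _ => 0) x :=
      ComplexField.deriv_congr (hx.mono fun y hy => hy.2.2.1)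
    have e3 : T.deriv f x = _ := ComplexField.deriv_bracket aLx aLx.conj afx
    rw [e3, e1, e2, ComplexField.deriv_const, sub_zero,
      ComplexField.deriv_mul aZx.differentiableAt aBx.differentiableAt, LZx]
  have hT0 : T.deriv f 0 = 0 := by
    rw [hT.self_of_nhds]
    simp only [k]
    rw [hZ0, hB0, zero_mul, zero_mul, add_zero]
  have hS0 : (L.bracket T).deriv f 0 = 0 := by
    have e1 : L.deriv (T.deriv f) 0 = L.deriv k 0 := ComplexField.deriv_congr hT
    have e2 : T.deriv (L.deriv f) 0 = T.deriv (fun _ => 0) 0 :=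
      ComplexField.deriv_congr (good.mono fun y hy => hy.2.2.1)
    have d1 := aZ.differentiableAt
    have d2 := aB.differentiableAt
    have d3 := (aL.deriv aB).differentiableAt
    have e3 : L.deriv k 0 = _ :=
      ComplexField.deriv_add (d1.mul d3) (d2.mul (differentiableAt_const 1))
    rw [ComplexField.deriv_bracket aL aT af, e1, e2, ComplexField.deriv_const, sub_zero, e3,
      ComplexField.deriv_mul d1 d3, ComplexField.deriv_mul d2 (differentiableAt_const 1), hZ0, hLB,
      ComplexField.deriv_const]
    ring
  -- the differential of `f` vanishes on the frame, hence on the tangent space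
  have hvan : ∀ v ∈ complexTangentSpace M 0,
      (fderiv ℝ f 0 : C3 →ₗ[ℝ] ℂ).liftBaseChange ℂ v = 0 := by
    intro v hv
    rw [← hframe.2] at hv
    refine Submodule.span_induction ?_ (map_zero _) (fun x y _ _ hx hy => by
      rw [map_add, hx, hy, add_zero]) (fun a x _ hx => by rw [map_smul, hx, smul_zero]) hv
    rintro _ ⟨i, rfl⟩
    fin_cases i
    · exact (ComplexField.deriv_eq_liftBaseChange L f 0).symm.trans Lf
    · refine (ComplexField.deriv_eq_liftBaseChange L.conj f 0).symm.trans ?_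
      rw [Lbf, hZ0, zero_mul]
    · exact (ComplexField.deriv_eq_liftBaseChange T f 0).symm.trans hT0
    · exact (ComplexField.deriv_eq_liftBaseChange (L.bracket T) f 0).symm.trans hS0
  have hI0 := hI.self_of_nhds
  -- In the chart the vectors `(0, u)` with `u` real are tangent at `0`, and the differential of `f`
  -- on them is `c₁ u₁ + c₂ u₂`. Its vanishing contradicts `c ≠ 0`.
  have hreal : ∀ u : ℝ × ℝ, c.1 * (u.1 : ℂ) + c.2 * (u.2 : ℂ) = 0 := by
    intro u
    have ht := ((eventually_mem_tangentSpace_iff hψ hG hG0 hFG hI hM).self_of_nhds h0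
      (fderiv ℝ F (G 0) (0, ofRealW u))).2 (by
        have hψ' : DifferentiableAt ℝ ψ (graphBase (G 0)) := by
          rw [hG0, map_zero]
          exact hψ.differentiableAt
        rw [hI0.left_inv, fderiv_graphDefining hψ']
        simp [hG0, imW_apply, ofRealW_apply])
    have h1 := hvan _ (Submodule.tmul_mem_baseChange_of_mem (1 : ℂ) ht)
    have h2 : fderiv ℝ f 0 (fderiv ℝ F (G 0) (0, ofRealW u)) = 0 := by simpa using h1
    have hd : fderiv ℝ f 0 = mw.comp (fderiv ℝ G 0) :=
      (mw.hasFDerivAt.comp (0 : C3) hI0.analyticAt_right.differentiableAt.hasFDerivAt).fderiv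
    rw [hd, ContinuousLinearMap.comp_apply, hI0.left_inv] at h2
    rw [← hmr]
    exact h2
  refine hc0 (Prod.ext ?_ ?_)
  · simpa using hreal (1, 0)
  · simpa using hreal (0, 1)

end FrameCondition

/-! ### Normalization of the 1-jet of `ψ` -/

section Normalization

/-- The linear automorphism of the plane with a given invertible matrix. -/
def pairEquiv {K : Type*} [Field K] (a b c d : K) (h : a * d - b * c ≠ 0) : (K × K) ≃ₗ[K] K × K where
  toFun x := (a * x.1 + b * x.2, c * x.1 + d * x.2)
  invFun x := ((d * x.1 - b * x.2) / (a * d - b * c), (a * x.2 - c * x.1) / (a * d - b * c))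
  map_add' x y := by ext <;> simp <;> ring
  map_smul' k x := by ext <;> simp <;> ring
  left_inv x := by
    refine Prod.ext ?_ ?_
    · exact (div_eq_iff h).2 (by ring)
    · exact (div_eq_iff h).2 (by ring)
  right_inv x := by
    refine Prod.ext ?_ ?_
    · change a * (_ / _) + b * (_ / _) = _
      rw [mul_div_assoc', mul_div_assoc', ← add_div, div_eq_iff h]
      ring
    · change c * (_ / _) + d * (_ / _) = _
      rw [mul_div_assoc', mul_div_assoc', ← add_div, div_eq_iff h]
      ring

/-- Put `a⊥ = (-a₂, a₁)`, so that `n H = (a·H) a + η a⊥`. The matrix of `Q` has columns `t a` and `t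
a⊥` with `t = |l|²`, which sends `a` to `(1, 0)`. The choice `l = 2n/η` turns the `a⊥`-component
into `2v`, and `ν = -l (a·H)/(2n)` cancels the `a`-component through the quadratic term of `z ↦ l z
(1 + ν z)`. -/
theorem exists_normalizing_constants {a : ℝ × ℝ} {H : ℂ × ℂ}
    (h : (a.1 : ℂ) * H.2 - (a.2 : ℂ) * H.1 ≠ 0) :
    ∃ (Q : (ℝ × ℝ) ≃L[ℝ] ℝ × ℝ) (P : (ℂ × ℂ) ≃L[ℂ] ℂ × ℂ) (l ν : ℂ), l ≠ 0 ∧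
      (∀ w, reW (P w) = Q (reW w)) ∧ (∀ w, imW (P w) = Q (imW w)) ∧
      Complex.normSq l • Q.symm a = (1, 0) ∧
      ∀ v : ℂ, (2 * (ν * v).re) • ((1, 0) : ℝ × ℝ) +
        Complex.normSq l • Q.symm (reW ((l * v) • H)) = (0, 2 * v.re) := by
  set η := (a.1 : ℂ) * H.2 - (a.2 : ℂ) * H.1 with hη
  set n := a.1 ^ 2 + a.2 ^ 2 with hn
  have hn0 : n ≠ 0 := by
    intro h0
    have h1 : a.1 = 0 := by nlinarith [sq_nonneg a.1, sq_nonneg a.2]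
    have h2 : a.2 = 0 := by nlinarith [sq_nonneg a.1, sq_nonneg a.2]
    exact h (by rw [hη, h1, h2]; simp)
  have hnc : (n : ℂ) ≠ 0 := by exact_mod_cast hn0
  set l : ℂ := 2 * n / η with hl
  have hl0 : l ≠ 0 := by simp [hl, hnc, h]
  set t := Complex.normSq l with ht
  have ht0 : t ≠ 0 := by simpa [ht] using hl0
  have htc : (t : ℂ) ≠ 0 := by exact_mod_cast ht0
  have hd : (t * a.1) * (t * a.1) - (-(t * a.2)) * (t * a.2) ≠ 0 := by
    have : (t * a.1) * (t * a.1) - (-(t * a.2)) * (t * a.2) = t ^ 2 * n := by rw [hn]; ring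
    rw [this]
    positivity
  have hdc : ((t : ℂ) * a.1) * (t * a.1) - (-((t : ℂ) * a.2)) * (t * a.2) ≠ 0 := by
    exact_mod_cast hd
  let Q := (pairEquiv _ _ _ _ hd).toContinuousLinearEquiv
  let P := (pairEquiv _ _ _ _ hdc).toContinuousLinearEquiv
  have hQ : ∀ x, Q x = (t * a.1 * x.1 + -(t * a.2) * x.2, t * a.2 * x.1 + t * a.1 * x.2) :=
    fun _ => rfl
  have hP : ∀ x, P x = ((t : ℂ) * a.1 * x.1 + -((t : ℂ) * a.2) * x.2,
      (t : ℂ) * a.2 * x.1 + (t : ℂ) * a.1 * x.2) := fun _ => rfl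
  have hre : ∀ w, reW (P w) = Q (reW w) := fun w => by
    rw [hP, hQ]
    ext <;> simp [reW_apply]
  have him : ∀ w, imW (P w) = Q (imW w) := fun w => by
    rw [hP, hQ]
    ext <;> simp [imW_apply]
  refine ⟨Q, P, l, -(l * (a.1 * H.1 + a.2 * H.2)) / (2 * n), hl0, hre, him, ?_, fun v => ?_⟩
  · have : Q.symm a = (t⁻¹, 0) := by
      rw [Q.symm_apply_eq, hQ]
      ext <;> simp <;> field_simp
    rw [this, ← ht, Prod.smul_mk, smul_eq_mul, mul_inv_cancel₀ ht0, smul_zero]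
  · set y : ℂ × ℂ := (l * v * (a.1 * H.1 + a.2 * H.2) / (t * n), 2 * v / t) with hy
    have hlη : l * η = 2 * n := by rw [hl]; field_simp
    have h2 : (2 : ℂ) = l * η / n := by rw [hlη]; field_simp
    have hPy : P y = (l * v) • H := by
      have hnc' : (n : ℂ) = a.1 ^ 2 + a.2 ^ 2 := by rw [hn]; push_cast; ring
      rw [hP, hy, h2]
      refine Prod.ext ?_ ?_
      · simp only [Prod.smul_fst, smul_eq_mul]
        field_simp
        rw [hη, hnc']; ring
      · simp only [Prod.smul_snd, smul_eq_mul]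
        field_simp
        rw [hη, hnc']; ring
    have hQy : Q.symm (reW ((l * v) • H)) = reW y := by
      rw [Q.symm_apply_eq, ← hre, hPy]
    rw [hQy, reW_apply]
    refine Prod.ext ?_ ?_
    · have e : -(l * (a.1 * H.1 + a.2 * H.2)) / (2 * n) * v * 2 + t * y.1 = 0 := by
        rw [hy]
        field_simp
        ring
      have := congrArg Complex.re e
      simp only [Complex.add_re, Complex.re_ofReal_mul, Complex.zero_re] at this
      rw [mul_comm _ (2 : ℂ), show (2 : ℂ) = ((2 : ℝ) : ℂ) by simp, Complex.re_ofReal_mul] at this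
      simpa using this
    · have e : (t : ℂ) * y.2 = ((2 : ℝ) : ℂ) * v := by
        rw [hy]
        push_cast
        field_simp
      have := congrArg Complex.re e
      rw [Complex.re_ofReal_mul, Complex.re_ofReal_mul] at this
      simpa using this

theorem reW_smul_holDeriv (D : ℂ × (ℝ × ℝ) →L[ℝ] ℝ × ℝ) (v : ℂ) :
    reW (v • holDeriv D) = D (v, 0) := by
  have : ((v, 0) : ℂ × (ℝ × ℝ)) = v.re • (1, 0) + v.im • (Complex.I, 0) := by
    refine Prod.ext ?_ (by simp)
    apply Complex.ext <;> simp
  rw [this, map_add D, map_smul D, map_smul D, holDeriv]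
  ext <;> simp [reW_apply, ofRealW_apply]

/-- Normalization of the lowest order terms of the graphing function. -/
theorem exists_normalized_chart {M : Set C3} {F : C3 → C3} (hF : AnalyticAt ℂ F 0) (hF0 : F 0 = 0)
    {e : C3 ≃L[ℂ] C3} (he : HasFDerivAt F (e : C3 →L[ℂ] C3) 0)
    {ψ : ℂ × (ℝ × ℝ) → ℝ × ℝ} (hψ : AnalyticAt ℝ ψ 0)
    (hM : ∀ᶠ q in 𝓝 (0 : C3), F q ∈ M ↔ imW q.2 = Complex.normSq q.1 • ψ (q.1, reW q.2))
    (hdet : ((ψ 0).1 : ℂ) * (holDeriv (fderiv ℝ ψ 0)).2 -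
      ((ψ 0).2 : ℂ) * (holDeriv (fderiv ℝ ψ 0)).1 ≠ 0) :
    ∃ F : C3 → C3, AnalyticAt ℂ F 0 ∧ F 0 = 0 ∧
      (∃ e : C3 ≃L[ℂ] C3, HasFDerivAt F (e : C3 →L[ℂ] C3) 0) ∧
      ∃ ψ : ℂ × (ℝ × ℝ) → ℝ × ℝ, AnalyticAt ℝ ψ 0 ∧ ψ 0 = (1, 0) ∧
        (∀ v : ℂ, fderiv ℝ ψ 0 (v, 0) = (0, 2 * v.re)) ∧
        ∀ᶠ q in 𝓝 (0 : C3), F q ∈ M ↔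
          imW q.2 = Complex.normSq q.1 • ψ (q.1, reW q.2) := by
  obtain ⟨Q, P, l, ν, hl, hre, him, ha, hv⟩ := exists_normalizing_constants hdet
  -- the change of coordinates
  let ζ : ℂ → ℂ := fun z => l * z * (1 + ν * z)
  have ζa : AnalyticAt ℂ ζ 0 :=
    (analyticAt_const.fun_mul analyticAt_id).fun_mul
      (analyticAt_const.fun_add (analyticAt_const.fun_mul analyticAt_id))
  have ζ0 : ζ 0 = 0 := by simp [ζ]
  have ζd : HasFDerivAt ζ
      ((ContinuousLinearEquiv.unitsEquivAut ℂ (Units.mk0 l hl) : ℂ ≃L[ℂ] ℂ) : ℂ →L[ℂ] ℂ) 0 := by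
    have h1 : HasDerivAt ζ _ 0 :=
      ((hasDerivAt_id (0 : ℂ)).const_mul l).mul
        (((hasDerivAt_id (0 : ℂ)).const_mul ν).const_add 1)
    refine h1.hasFDerivAt.congr_fderiv (ContinuousLinearMap.ext fun v => ?_)
    simp
  let A : C3 → C3 := fun q => (ζ q.1, P q.2)
  have A0 : A 0 = 0 := by
    change ((ζ 0, P 0) : C3) = 0
    rw [ζ0, map_zero]
    rfl
  have ζa' : AnalyticAt ℂ (fun q : C3 => ζ q.1) 0 := by
    have : AnalyticAt ℂ ζ (0 : C3).1 := ζa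
    exact this.comp analyticAt_fst
  have ζar : AnalyticAt ℝ (fun x : ℂ × (ℝ × ℝ) => ζ x.1) 0 := by
    have : AnalyticAt ℝ ζ (0 : ℂ × (ℝ × ℝ)).1 := ζa.restrictScalars
    exact this.comp analyticAt_fst
  have Aa : AnalyticAt ℂ A 0 := ζa'.prod
    (((P : ℂ × ℂ →L[ℂ] ℂ × ℂ).comp (ContinuousLinearMap.snd ℂ ℂ (ℂ × ℂ))).analyticAt 0)
  have Ad : HasFDerivAt A (((ContinuousLinearEquiv.unitsEquivAut ℂ (Units.mk0 l hl)).prodCongr P :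
      C3 ≃L[ℂ] C3) : C3 →L[ℂ] C3) 0 :=
    (HasFDerivAt.comp (f := fun q : C3 => q.1) (0 : C3) ζd hasFDerivAt_fst).prodMk
      ((P : ℂ × ℂ →L[ℂ] ℂ × ℂ).comp (ContinuousLinearMap.snd ℂ ℂ (ℂ × ℂ))).hasFDerivAt
  have FAa : AnalyticAt ℂ F (A 0) := by rwa [A0]
  have FAd : HasFDerivAt F (e : C3 →L[ℂ] C3) (A 0) := by rwa [A0]
  -- the new graphing function
  let B : ℂ × (ℝ × ℝ) → ℂ × (ℝ × ℝ) := fun x => (ζ x.1, Q x.2)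
  have B0 : B 0 = 0 := by
    change ((ζ 0, Q 0) : ℂ × (ℝ × ℝ)) = 0
    rw [ζ0, map_zero]
    rfl
  have Ba : AnalyticAt ℝ B 0 :=
    ζar.prod
      (((Q : ℝ × ℝ →L[ℝ] ℝ × ℝ).comp (ContinuousLinearMap.snd ℝ ℂ (ℝ × ℝ))).analyticAt 0)
  have Bd : HasFDerivAt B _ 0 :=
    (HasFDerivAt.comp (f := fun x : ℂ × (ℝ × ℝ) => x.1) (0 : ℂ × (ℝ × ℝ))
      (ζd.restrictScalars ℝ) hasFDerivAt_fst).prodMk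
      ((Q : ℝ × ℝ →L[ℝ] ℝ × ℝ).comp (ContinuousLinearMap.snd ℝ ℂ (ℝ × ℝ))).hasFDerivAt
  have ψBa : AnalyticAt ℝ ψ (B 0) := by rwa [B0]
  have ψBd : HasFDerivAt ψ (fderiv ℝ ψ 0) (B 0) := by
    rw [B0]; exact hψ.differentiableAt.hasFDerivAt
  let cr : ℂ × (ℝ × ℝ) →L[ℝ] ℝ := Complex.reCLM.comp
    ((ContinuousLinearMap.mul ℝ ℂ ν).comp (ContinuousLinearMap.fst ℝ ℂ (ℝ × ℝ)))
  let ci : ℂ × (ℝ × ℝ) →L[ℝ] ℝ := Complex.imCLM.comp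
    ((ContinuousLinearMap.mul ℝ ℂ ν).comp (ContinuousLinearMap.fst ℝ ℂ (ℝ × ℝ)))
  let N : ℂ × (ℝ × ℝ) → ℝ := fun x =>
    Complex.normSq l * ((1 + cr x) * (1 + cr x) + ci x * ci x)
  have hN : ∀ x, Complex.normSq (l * (1 + ν * x.1)) = N x := fun x => by
    rw [Complex.normSq_mul, Complex.normSq_apply (1 + ν * x.1)]
    simp [N, cr, ci]
  have Na : AnalyticAt ℝ N 0 := by
    have h1 : AnalyticAt ℝ (fun x => 1 + cr x) 0 := analyticAt_const.fun_add (cr.analyticAt 0)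
    have h2 := ci.analyticAt 0
    exact analyticAt_const.fun_mul ((h1.fun_mul h1).fun_add (h2.fun_mul h2))
  have Nd : HasFDerivAt N _ 0 :=
    (((cr.hasFDerivAt.const_add 1).mul (cr.hasFDerivAt.const_add 1)).add
      (ci.hasFDerivAt.mul ci.hasFDerivAt)).const_mul (Complex.normSq l)
  have N0 : N 0 = Complex.normSq l := by simp [N]
  -- The substitution multiplies `z z̄` by `N = |l (1 + ν z)|²`; solving for the new `v` applies the
  -- inverse of `Q`.
  let ψ' : ℂ × (ℝ × ℝ) → ℝ × ℝ := fun x => N x • Q.symm (ψ (B x))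
  have ψ'd : HasFDerivAt ψ' _ 0 :=
    Nd.smul ((Q.symm : ℝ × ℝ →L[ℝ] ℝ × ℝ).hasFDerivAt.comp (0 : ℂ × (ℝ × ℝ))
      (ψBd.comp (0 : ℂ × (ℝ × ℝ)) Bd))
  refine ⟨fun q => F (A q), FAa.comp Aa, by change F (A 0) = 0; rw [A0, hF0],
    ⟨((ContinuousLinearEquiv.unitsEquivAut ℂ (Units.mk0 l hl)).prodCongr P).trans e,
      FAd.comp (0 : C3) Ad⟩, ψ', ?_, ?_, ?_, ?_⟩
  · exact Na.fun_smul (((Q.symm : ℝ × ℝ →L[ℝ] ℝ × ℝ).analyticAt _).comp (ψBa.comp Ba))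
  · change N 0 • Q.symm (ψ (B 0)) = (1, 0)
    rw [N0, B0, ha]
  · intro v
    rw [ψ'd.fderiv, ← hv v, ← ha, reW_smul_holDeriv]
    simp only [add_apply, smul_apply, ContinuousLinearMap.smulRight_apply, N0, B0,
      ContinuousLinearMap.comp_apply]
    have e1 : ∀ x : ℂ × (ℝ × ℝ), ((ContinuousLinearMap.prod
        ((((ContinuousLinearEquiv.unitsEquivAut ℂ (Units.mk0 l hl) : ℂ ≃L[ℂ] ℂ) :
          ℂ →L[ℂ] ℂ).restrictScalars ℝ).comp (ContinuousLinearMap.fst ℝ ℂ (ℝ × ℝ)))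
        ((Q : ℝ × ℝ →L[ℝ] ℝ × ℝ).comp (ContinuousLinearMap.snd ℝ ℂ (ℝ × ℝ)))) x) =
        (l * x.1, Q x.2) := fun x => Prod.ext (mul_comm _ _) rfl
    rw [e1]
    simp [cr, ci, smul_smul]
    rw [add_comm]
    congr 2
    ring
  · filter_upwards [eventually_comp_zero Aa.continuousAt A0 hM] with q hq
    rw [hq]
    change imW (P q.2) = Complex.normSq (l * q.1 * (1 + ν * q.1)) •
      ψ (ζ q.1, reW (P q.2)) ↔ _
    rw [him, hre, ← Q.eq_symm_apply, map_smul]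
    have e1 : l * q.1 * (1 + ν * q.1) = q.1 * (l * (1 + ν * q.1)) := by ring
    have e2 : ψ' (q.1, reW q.2) = N (q.1, reW q.2) • Q.symm (ψ (ζ q.1, Q (reW q.2))) := rfl
    rw [e1, Complex.normSq_mul, e2, ← hN, mul_smul]

end Normalization

/-! ### Remainders and the normal form -/

section Conclusion

/-- The normalized graphing function, written with remainders. -/
theorem exists_remainders {ψ : ℂ × (ℝ × ℝ) → ℝ × ℝ} (hψ : AnalyticAt ℝ ψ 0) (h0 : ψ 0 = (1, 0))
    (h1 : ∀ v : ℂ, fderiv ℝ ψ 0 (v, 0) = (0, 2 * v.re)) :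
    ∃ r₁ r₂ : Remainder, (∃ δ > 0, r₁.IsAdmissible δ ∧ r₂.IsAdmissible δ) ∧
      ∀ᶠ x in 𝓝 (0 : ℂ × (ℝ × ℝ)), ψ x =
        (1 + r₁.eval x.1 x.2.1 x.2.2, 2 * x.1.re + r₂.eval x.1 x.2.1 x.2.2) := by
  obtain ⟨g₁, ga₁, hg₁⟩ := hψ.exists_sub_eq_smul
    ((ContinuousLinearMap.fst ℝ ℝ ℝ).comp (ContinuousLinearMap.snd ℝ ℂ (ℝ × ℝ))) (0, 1, 0)
  obtain ⟨g₂, ga₂, hg₂⟩ := hψ.exists_sub_eq_smul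
    ((ContinuousLinearMap.snd ℝ ℝ ℝ).comp (ContinuousLinearMap.snd ℝ ℂ (ℝ × ℝ))) (0, 0, 1)
  let i : ℂ →L[ℝ] ℂ × (ℝ × ℝ) := ContinuousLinearMap.inl ℝ ℂ (ℝ × ℝ)
  -- `k` sets `u₁ = 0`. Dividing first along `u₁` and then along `u₂` on the image of `k` gives
  -- `ψ(z, u) = ψ(z, 0) + u₁ g₁(z, u) + u₂ g₂(z, 0, u₂)`.
  let k : ℂ × (ℝ × ℝ) →L[ℝ] ℂ × (ℝ × ℝ) := (ContinuousLinearMap.fst ℝ ℂ (ℝ × ℝ)).prod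
    ((0 : ℂ × (ℝ × ℝ) →L[ℝ] ℝ).prod
      ((ContinuousLinearMap.snd ℝ ℝ ℝ).comp (ContinuousLinearMap.snd ℝ ℂ (ℝ × ℝ))))
  have ψi : AnalyticAt ℝ ψ (i 0) := by rwa [map_zero]
  have gk : AnalyticAt ℝ g₂ (k 0) := by rwa [map_zero]
  have ai : AnalyticAt ℝ (fun z => ψ (i z)) 0 := ψi.comp (i.analyticAt 0)
  have ak : AnalyticAt ℝ (fun x => g₂ (k x)) 0 := gk.comp (k.analyticAt 0)
  let mdl : ℂ →L[ℝ] ℝ × ℝ := (0 : ℂ →L[ℝ] ℝ).prod ((2 : ℝ) • Complex.reCLM)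
  let a : ℂ → ℝ × ℝ := fun z => ψ (i z) - ((1, 0) + mdl z)
  have aa : AnalyticAt ℝ a 0 := ai.fun_sub (analyticAt_const.fun_add (mdl.analyticAt 0))
  have aO : a =O[𝓝 0] (fun z : ℂ => ‖z‖ ^ 2) := by
    refine aa.isBigO_norm_sq ?_ ?_
    · simp [a, h0]
    · have hd : HasFDerivAt ψ (fderiv ℝ ψ 0) (i 0) := by
        rw [map_zero]; exact hψ.differentiableAt.hasFDerivAt
      have h2 := (hd.comp (0 : ℂ) i.hasFDerivAt).sub (mdl.hasFDerivAt.const_add (1, 0))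
      refine h2.congr_fderiv (ContinuousLinearMap.ext fun v => ?_)
      change fderiv ℝ ψ 0 (v, 0) - (0, 2 * v.re) = 0
      rw [h1, sub_self]
  let r₁ : Remainder := ⟨fun z => (a z).1, fun x => (g₁ x).1, fun x => (g₂ (k x)).1⟩
  let r₂ : Remainder := ⟨fun z => (a z).2, fun x => (g₁ x).2, fun x => (g₂ (k x)).2⟩
  have ev : ∀ᶠ x in 𝓝 (0 : ℂ × (ℝ × ℝ)), AnalyticAt ℝ g₁ x ∧ AnalyticAt ℝ (fun x => g₂ (k x)) x :=
    ga₁.eventually_analyticAt.and ak.eventually_analyticAt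
  obtain ⟨δ₁, hδ₁, hb₁⟩ := Metric.eventually_nhds_iff_ball.1 aa.eventually_analyticAt
  obtain ⟨δ₂, hδ₂, hb₂⟩ := Metric.eventually_nhds_iff_ball.1 ev
  have s₁ := Metric.ball_subset_ball (x := (0 : ℂ)) (min_le_left δ₁ δ₂)
  have s₂ := Metric.ball_subset_ball (x := (0 : ℂ × (ℝ × ℝ))) (min_le_right δ₁ δ₂)
  refine ⟨r₁, r₂, ⟨min δ₁ δ₂, lt_min hδ₁ hδ₂, ⟨?_, ?_, ?_, ?_⟩, ⟨?_, ?_, ?_, ?_⟩⟩, ?_⟩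
  · exact fun z hz => (ContinuousLinearMap.fst ℝ ℝ ℝ).analyticAt _ |>.comp (hb₁ z (s₁ hz))
  · exact fun x hx => (ContinuousLinearMap.fst ℝ ℝ ℝ).analyticAt _ |>.comp (hb₂ x (s₂ hx)).1
  · exact fun x hx => (ContinuousLinearMap.fst ℝ ℝ ℝ).analyticAt _ |>.comp (hb₂ x (s₂ hx)).2
  · exact (Asymptotics.isBigO_fst_prod' (f' := a)).trans aO
  · exact fun z hz => (ContinuousLinearMap.snd ℝ ℝ ℝ).analyticAt _ |>.comp (hb₁ z (s₁ hz))
  · exact fun x hx => (ContinuousLinearMap.snd ℝ ℝ ℝ).analyticAt _ |>.comp (hb₂ x (s₂ hx)).1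
  · exact fun x hx => (ContinuousLinearMap.snd ℝ ℝ ℝ).analyticAt _ |>.comp (hb₂ x (s₂ hx)).2
  · exact (Asymptotics.isBigO_snd_prod' (f' := a)).trans aO
  · filter_upwards [hg₁, eventually_comp_zero k.continuous.continuousAt (map_zero k) hg₂]
      with x hx₁ hx₂
    have e1 : x - ((ContinuousLinearMap.fst ℝ ℝ ℝ).comp (ContinuousLinearMap.snd ℝ ℂ (ℝ × ℝ))) x •
        ((0, 1, 0) : ℂ × (ℝ × ℝ)) = k x := by
      ext <;> simp [k]
    have e2 : k x - ((ContinuousLinearMap.snd ℝ ℝ ℝ).comp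
        (ContinuousLinearMap.snd ℝ ℂ (ℝ × ℝ))) (k x) • ((0, 0, 1) : ℂ × (ℝ × ℝ)) = i x.1 := by
      ext <;> simp [k, i]
    rw [e1] at hx₁
    rw [e2] at hx₂
    have hx : ψ x = ψ (i x.1) + x.2.1 • g₁ x + x.2.2 • g₂ (k x) := by
      have h1 : ψ x - ψ (k x) = x.2.1 • g₁ x := hx₁
      have h2 : ψ (k x) - ψ (i x.1) = x.2.2 • g₂ (k x) := hx₂
      rw [← h1, ← h2]
      abel
    rw [hx]
    refine Prod.ext ?_ ?_
    · simp [Remainder.eval, r₁, a, mdl]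
      ring
    · simp [Remainder.eval, r₂, a, mdl]
      ring

/-- Uses `z² z̄ + z z̄² = z z̄ (2 Re z)`. -/
theorem mem_normalForm_iff {r₁ r₂ : Remainder} {q : C3} : q ∈ normalForm r₁ r₂ ↔
    imW q.2 = Complex.normSq q.1 • (1 + r₁.eval q.1 q.2.1.re q.2.2.re,
      2 * q.1.re + r₂.eval q.1 q.2.1.re q.2.2.re) := by
  have e1 : (starRingEnd ℂ) q.1 = 2 * (q.1.re : ℂ) - q.1 := by
    apply Complex.ext <;> simp
    ring
  have n : q.1 * (starRingEnd ℂ) q.1 = (Complex.normSq q.1 : ℂ) := Complex.mul_conj _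
  have n2 : q.1 ^ 2 * (starRingEnd ℂ) q.1 + q.1 * (starRingEnd ℂ) q.1 ^ 2 =
      ((Complex.normSq q.1 * (2 * q.1.re) : ℝ) : ℂ) := by
    push_cast
    rw [← n, e1]
    ring
  rw [normalForm, Set.mem_ofPred_eq, n2, n, Prod.ext_iff]
  norm_cast
  simp only [imW_apply, Prod.smul_fst, Prod.smul_snd, smul_eq_mul, mul_add, mul_one]

theorem exists_normal_form {M : Set C3} (h0 : (0 : C3) ∈ M) (hM : IsGeneralClassII M) :
    ∃ (Φ : OpenPartialHomeomorph C3 C3) (δ : ℝ) (r₁ r₂ : Remainder),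
      0 < δ ∧ (0 : C3) ∈ Φ.source ∧ Φ 0 = 0 ∧ Φ.target = Metric.ball (0 : C3) δ ∧
      DifferentiableOn ℂ Φ Φ.source ∧ DifferentiableOn ℂ Φ.symm Φ.target ∧
      r₁.IsAdmissible δ ∧ r₂.IsAdmissible δ ∧
      Φ '' (M ∩ Φ.source) = normalForm r₁ r₂ ∩ Metric.ball (0 : C3) δ := by
  obtain ⟨hsub, hgen, hII⟩ := hM
  obtain ⟨F₀, F₀a, F₀0, ⟨e₀, F₀d⟩, ψ₀, ψ₀a, hF₀⟩ := exists_graph_chart h0 hsub hgen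
  obtain ⟨F, Fa, F0, ⟨e, Fd⟩, ψ, ψa, ψ0, ψ1, hF⟩ := exists_normalized_chart F₀a F₀0 F₀d ψ₀a hF₀
    (det_ne_zero_of_isFrameAt h0 hII F₀a F₀0 F₀d ψ₀a hF₀)
  obtain ⟨r₁, r₂, ⟨δ₁, hδ₁, hr₁, hr₂⟩, hψ⟩ := exists_remainders ψa ψ0 ψ1
  have hc : ContDiffAt ℂ ω F 0 := Fa.contDiffAt
  let P : OpenPartialHomeomorph C3 C3 := hc.toOpenPartialHomeomorph F Fd (by simp)
  have hPF : ∀ q, P q = F q := fun _ => rfl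
  have P0s : (0 : C3) ∈ P.source := hc.mem_toOpenPartialHomeomorph_source Fd (by simp)
  have P0 : P.symm 0 = 0 := by
    have := P.left_inv P0s
    rwa [hPF, F0] at this
  have Pa : AnalyticAt ℂ P.symm 0 := by
    have := (hc.to_localInverse Fd (by simp)).analyticAt
    rwa [F0] at this
  have ev : ∀ᶠ q in 𝓝 (0 : C3), q ∈ P.source ∧ AnalyticAt ℂ F q ∧ AnalyticAt ℂ P.symm (F q) ∧
      (F q ∈ M ↔ q ∈ normalForm r₁ r₂) := by
    filter_upwards [P.open_source.mem_nhds P0s, Fa.eventually_analyticAt,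
      eventually_comp_zero Fa.continuousAt F0 Pa.eventually_analyticAt, hF,
      eventually_comp_zero graphBase.continuous.continuousAt (map_zero _) hψ] with q h1 h2 h3 h4 h5
    refine ⟨h1, h2, h3, ?_⟩
    rw [h4, mem_normalForm_iff, ← graphBase_apply, h5]
    rfl
  obtain ⟨δ₂, hδ₂, hb⟩ := Metric.eventually_nhds_iff_ball.1 ev
  set δ := min δ₁ δ₂
  have hδ : 0 < δ := lt_min hδ₁ hδ₂
  have hb' : ∀ q ∈ Metric.ball (0 : C3) δ, _ := fun q hq =>
    hb q (Metric.ball_subset_ball (min_le_right δ₁ δ₂) hq)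
  have adm : ∀ r : Remainder, r.IsAdmissible δ₁ → r.IsAdmissible δ := fun r hr =>
    ⟨hr.1.mono (Metric.ball_subset_ball (min_le_left _ _)),
      hr.2.1.mono (Metric.ball_subset_ball (min_le_left _ _)),
      hr.2.2.1.mono (Metric.ball_subset_ball (min_le_left _ _)), hr.2.2.2⟩
  -- `F` maps normal coordinates to the original ones, so the required chart is the inverse of its
  -- restriction. The norm of `C3` is the maximum norm, whence the ball is the polydisc.
  let Q := P.restrOpen (Metric.ball (0 : C3) δ) Metric.isOpen_ball
  have Qs : Q.source = Metric.ball (0 : C3) δ := by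
    rw [P.restrOpen_source]
    exact Set.inter_eq_right.2 fun q hq => (hb' q hq).1
  have hQF : ∀ q, Q q = F q := fun _ => rfl
  have hQs : ∀ x, Q.symm x = P.symm x := fun _ => rfl
  have h0b : (0 : C3) ∈ Q.source := by rw [Qs]; exact Metric.mem_ball_self hδ
  refine ⟨Q.symm, δ, r₁, r₂, hδ, ?_, ?_, ?_, ?_, ?_, adm r₁ hr₁, adm r₂ hr₂, ?_⟩
  · have := Q.map_source h0b
    rwa [hQF, F0] at this
  · rw [hQs, P0]
  · exact Qs
  · intro x hx
    have hx' : Q.symm x ∈ Q.source := Q.map_target hx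
    rw [Qs] at hx'
    have h1 := (hb' _ hx').2.2.1
    rw [← hQF, Q.right_inv hx] at h1
    exact h1.differentiableAt.differentiableWithinAt
  · intro q hq
    have hq' : q ∈ Metric.ball (0 : C3) δ := by rw [← Qs]; exact hq
    exact (hb' _ hq').2.1.differentiableAt.differentiableWithinAt
  · ext q
    constructor
    · rintro ⟨x, ⟨hxM, hx⟩, rfl⟩
      have hx' : Q.symm x ∈ Q.source := Q.map_target hx
      rw [Qs] at hx'
      refine ⟨(hb' _ hx').2.2.2.1 ?_, hx'⟩
      rw [← hQF, Q.right_inv hx]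
      exact hxM
    · rintro ⟨hqN, hq⟩
      have hq' : q ∈ Q.source := by rw [Qs]; exact hq
      exact ⟨Q q, ⟨(hb' q hq).2.2.2.2 hqN, Q.map_source hq'⟩, Q.left_inv hq'⟩

end Conclusion

end CRClassII

end

theorem mainTheorem4 :
    (∀ M : Set CRClassII.C3, (0 : CRClassII.C3) ∈ M → CRClassII.IsGeneralClassII M →
      ∃ (Φ : OpenPartialHomeomorph CRClassII.C3 CRClassII.C3) (δ : ℝ)
        (r₁ r₂ : CRClassII.Remainder),
        0 < δ ∧ (0 : CRClassII.C3) ∈ Φ.source ∧ Φ 0 = 0 ∧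
        Φ.target = Metric.ball (0 : CRClassII.C3) δ ∧
        DifferentiableOn ℂ Φ Φ.source ∧ DifferentiableOn ℂ Φ.symm Φ.target ∧
        r₁.IsAdmissible δ ∧ r₂.IsAdmissible δ ∧
        Φ '' (M ∩ Φ.source) =
          CRClassII.normalForm r₁ r₂ ∩ Metric.ball (0 : CRClassII.C3) δ) ∧
    CRClassII.normalForm CRClassII.Remainder.zero CRClassII.Remainder.zero =
      CRClassII.beloshapkaCubic ∧
    CRClassII.IsGeneralClassII CRClassII.beloshapkaCubic :=
  ⟨fun _ h0 hM => CRClassII.exists_normal_form h0 hM, CRClassII.normalForm_zero,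
    CRClassII.isGeneralClassII_beloshapkaCubic⟩
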